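/- Let $\Delta$ be a finite $3$-colored simplicial complex (no face contains two vertices of the same color $1,2,3$). For $S\subseteq\{1,2,3\}$ let $f_S(\Delta)$ be the number of faces of $\Delta$ whose set of colors is $S$ (written $f_1, f_{12}$, etc.), and put $$b_1(\Delta)=\Big\lfloor\sqrt{f_{12}f_{13}/f_{23}}\Big\rfloor,\quad b_2(\Delta)=\Big\lfloor\sqrt{f_{12}f_{23}/f_{13}}\Big\rfloor,\quad v(\Delta,t)=b_1f_{23}+(f_{12}-b_1t)\Big(f_{13}-\frac{b_1f_{23}}{t}\Big),$$ where $f_S=f_S(\Delta)$ and $b_1=b_1(\Delta)$. Given positive integers $g_1,g_2,g_3$ and colors $p\ne q$, construct a $3$-colored complex $\Gamma$ as follows. Take $g_i$ vertices of each color $i$ and join all pairs of vertices of different colors. If $f_p(\Delta)>g_p$, add one more vertex of color $p$ and join it to as many vertices of each other color as possible while keeping $f_{ij}(\Gamma)\le f_{ij}(\Delta)$ for all colors $i\neq j$, the earliest vertices of each color being taken first. Then, if $f_q(\Delta)>g_q$, add one more vertex of color $q$ in the same way. All sets of pairwise adjacent vertices are faces. Write $g_i(\Gamma),p(\Gamma),q(\Gamma)$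 for the constants used and $r(\Gamma)=6-p-q$ for the third color. Let $\mathcal A(\Delta)$ be the set of those $\Gamma$ with $f_S(\Gamma)\le f_S(\Delta)$ for all $S\neq\{1,2,3\}$, let $\mathcal B(\Delta)\subseteq\mathcal A(\Delta)$ be the set of those with the largest $f_{123}(\Gamma)$, let $\mathcal C(\Delta)\subseteq\mathcal B(\Delta)$ be the set of those with the largest number of edges $f_{12}(\Gamma)+f_{13}(\Gamma)+f_{23}(\Gamma)$, and let $$\mathcal D(\Delta)=\{\Gamma\in\mathcal C(\Delta)\mid f_{123}(\Gamma)<\min\{f_1(\Delta)f_{23}(\Delta),f_2(\Delta)f_{13}(\Delta),f_3(\Delta)f_{12}(\Delta)\}\}.$$ For an integer $x\ge1$ let $\Gamma_x$ be the construction with the following constants. Put $y=f_{12}(\Delta)/x$ and $z=f_{23}(\Delta)/x$. Then $g_2=x$; $g_1=\lfloor y\rfloor$ if $y\notin\mathbb Z$, $g_1=y-1$ if $y\in\mathbb Z$ and $y\lceil z-1\rceil>f_{13}(\Delta)$, and $g_1=y$ otherwise; $g_3=\lfloor z\rfloor$ if $z\notin\mathbb Z$, $g_3=z-1$ if $z\in\mathbb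 Z$ and $z g_1>f_{13}(\Delta)$, and $g_3=z$ otherwise; $(p,q)=(1,3)$ if $f_{12}(\Delta)-g_1x\ge f_{23}(\Delta)-g_3x$, and $(p,q)=(3,1)$ otherwise. To check the value $x$ of $g_2$ means to compute $f_{123}(\Gamma_x)$. Call $x$ a potential value if some $\Gamma\in\mathcal A(\Delta)$ with $g_1(\Gamma)=b_1(\Delta)$, $r(\Gamma)=2$ and $g_2(\Gamma)=x$ has $f_{ij}(\Gamma)=f_{ij}(\Delta)$ for all $i\neq j$. Consider the following search. Go through the potential values $x\le b_2(\Delta)$ in decreasing order, checking them one after the other, and stop as soon as the next value $x$ satisfies $v(\Delta,x)\le m$, where $m$ is the largest number of facets $f_{123}(\Gamma_{x'})$ found so far ($m=0$ at the beginning). Then, keeping $m$, go through the potential values $x>b_2(\Delta)$ in increasing order, with the same stopping rule. Assume that $f_{12}(\Delta)\le f_{13}(\Delta)\le f_{23}(\Delta)$, that $b_1(\Delta)\ge1$, and that there is some $\Gamma_0\in\mathcal D(\Delta)$ with $g_1(\Gamma_0)=b_1(\Delta)$ and $r(\Gamma_0)=2$. Then the search checks at least one value of $g_2$ and fewer than $$6+2\sqrt2\,\frac{\sqrt{f_{12}(\Delta)f_{23}(\Delta)}}{f_{13}(\Delta)}$$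 values of $g_2$, and it finds a complex in $\mathcal D(\Delta)$: every $\Gamma_x$ with the largest number of facets among those for the checked values $x$ belongs to $\mathcal D(\Delta)$. -/

import Mathlib

/-- A finite 3-colored simplicial complex with vertices in `V`.  The colors 1, 2, 3 are represented
by `0, 1, 2 : Fin 3`.  No two vertices of a face have the same color.  (Mathlib's complexes list the
nonempty faces only.) -/
structure ColoredComplex (V : Type*) extends PreAbstractSimplicialComplex V where
  finite_faces : faces.Finite
  color : V → Fin 3
  color_injOn : ∀ s ∈ faces, Set.InjOn color (s : Set V)

namespace ColoredComplex

variable {V : Type*}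

/-- The flag f-number `f_S`: the number of faces whose color set is `S`. -/
noncomputable def flag (K : ColoredComplex V) (S : Finset (Fin 3)) : ℕ :=
  {s : Finset V | s ∈ K.faces ∧ K.color '' (s : Set V) = (S : Set (Fin 3))}.ncard

/-- The number of edges, `f₁₂ + f₁₃ + f₂₃`. -/
noncomputable def edges (K : ColoredComplex V) : ℕ :=
  K.flag {0, 1} + K.flag {0, 2} + K.flag {1, 2}

/-- The number of facets, `f₁₂₃`. -/
noncomputable def facets (K : ColoredComplex V) : ℕ :=
  K.flag Finset.univ

/-- `b₁ = ⌊√(f₁₂ f₁₃ / f₂₃)⌋`. -/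
noncomputable def b1 (K : ColoredComplex V) : ℕ :=
  ⌊√((K.flag {0, 1} : ℝ) * K.flag {0, 2} / K.flag {1, 2})⌋₊

/-- `b₂ = ⌊√(f₁₂ f₂₃ / f₁₃)⌋`. -/
noncomputable def b2 (K : ColoredComplex V) : ℕ :=
  ⌊√((K.flag {0, 1} : ℝ) * K.flag {1, 2} / K.flag {0, 2})⌋₊

/-- The upper bound
`v(Δ, t) = b₁ f₂₃ + (f₁₂ - b₁ t) (f₁₃ - b₁ f₂₃ / t)`. -/
noncomputable def v (K : ColoredComplex V) (t : ℝ) : ℝ :=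
  (K.b1 : ℝ) * K.flag {1, 2} +
    ((K.flag {0, 1} : ℝ) - K.b1 * t) * ((K.flag {0, 2} : ℝ) - K.b1 * K.flag {1, 2} / t)

end ColoredComplex

/-- The constants `g₁, g₂, g₃, p, q` that determine a complex constructed from `Δ`. -/
structure Params where
  g : Fin 3 → ℕ
  p : Fin 3
  q : Fin 3

namespace Params

variable {V : Type*}

/-- The third color: for `p ≠ q`, the element of `Fin 3` other than `p` and `q`. -/
def r (Γ : Params) : Fin 3 := -(Γ.p + Γ.q)

/-- Whether there is room for an extra vertex of color `i`, as a number: `1` if `g_i < f_i(Δ)`,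
and `0` otherwise. -/
noncomputable def room (Γ : Params) (Δ : ColoredComplex V) (i : Fin 3) : ℕ :=
  if Γ.g i < Δ.flag {i} then 1 else 0

/-- The number of vertices of color `k` to which the first extra vertex (of color `p`) is joined:
as many of the `g_k` present ones as the number of edges of color `pk` still available allows. -/
noncomputable def pDeg (Γ : Params) (Δ : ColoredComplex V) (k : Fin 3) : ℕ :=
  if Γ.g Γ.p < Δ.flag {Γ.p} then
    min (Γ.g k) (Δ.flag {Γ.p, k} - Γ.g Γ.p * Γ.g k)
  else 0

/-- The number of vertices of color `k` to which the second extra vertex (of color `q`) is joined.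
For `k = p`, the first extra vertex is one of the vertices present, and the edges of color `pq`
that it uses are no longer available. -/
noncomputable def qDeg (Γ : Params) (Δ : ColoredComplex V) (k : Fin 3) : ℕ :=
  if Γ.g Γ.q < Δ.flag {Γ.q} then
    if k = Γ.p then
      min (Γ.g k + Γ.room Δ k) (Δ.flag {Γ.q, k} - Γ.g Γ.q * Γ.g k - Γ.pDeg Δ Γ.q)
    else
      min (Γ.g k) (Δ.flag {Γ.q, k} - Γ.g Γ.q * Γ.g k)
  else 0

/-- The number of vertices of color `i` of the constructed complex. -/
noncomputable def numVert (Γ : Params) (Δ : ColoredComplex V) (i : Fin 3) : ℕ :=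
  Γ.g i + if i = Γ.p ∨ i = Γ.q then Γ.room Δ i else 0

/-- Edges of the constructed complex, up to symmetry.  The pair `(i, a)` is the vertex number
`a + 1` of color `i`; the extra vertices are `(p, g_p)` and `(q, g_q)`, and each of them is joined
to the earliest vertices of the other colors. -/
def Edge (Γ : Params) (Δ : ColoredComplex V) (x y : Fin 3 × ℕ) : Prop :=
  x.1 ≠ y.1 ∧
    ((x.2 < Γ.g x.1 ∧ y.2 < Γ.g y.1) ∨
      (x = (Γ.p, Γ.g Γ.p) ∧ y.2 < Γ.pDeg Δ y.1) ∨
      (x = (Γ.q, Γ.g Γ.q) ∧ y.2 < Γ.qDeg Δ y.1))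

/-- The complex constructed from `Δ` and `g₁, g₂, g₃, p, q`: the complete tripartite complex on
`g₁ + g₂ + g₃` vertices, then an extra vertex of color `p` (if `f_p(Δ) > g_p`) and then one of
color `q` (if `f_q(Δ) > g_q`), each joined to as many vertices of every other color as the numbers
of edges of `Δ` allow.  A set of vertices is a face when all its pairs are edges. -/
noncomputable def complex (Γ : Params) (Δ : ColoredComplex V) : ColoredComplex (Fin 3 × ℕ) where
  faces := {s | s.Nonempty ∧ (∀ x ∈ s, x.2 < Γ.numVert Δ x.1) ∧
    ∀ x ∈ s, ∀ y ∈ s, x ≠ y → Γ.Edge Δ x y ∨ Γ.Edge Δ y x}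
  isRelLowerSet_faces := by
    rintro s ⟨hs, hv, he⟩
    refine ⟨hs, fun t hts ht => ⟨ht, fun x hx => hv x (hts hx), fun x hx y hy => ?_⟩⟩
    exact he x (hts hx) y (hts hy)
  finite_faces := by
    refine Set.Finite.subset (Finset.finite_toSet
      (((Finset.univ : Finset (Fin 3)) ×ˢ
        Finset.range (Finset.univ.sup (Γ.numVert Δ))).powerset)) ?_
    rintro s ⟨-, hv, -⟩
    simp only [Finset.coe_powerset, Set.mem_preimage, Set.mem_powerset_iff, Finset.coe_subset]
    intro x hx
    simp only [Finset.mem_product, Finset.mem_univ, Finset.mem_range, true_and]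
    exact (hv x hx).trans_le (Finset.le_sup (f := Γ.numVert Δ) (Finset.mem_univ x.1))
  color := Prod.fst
  color_injOn := by
    rintro s ⟨-, -, he⟩ x hx y hy hxy
    by_contra hne
    rcases he x hx y hy hne with h | h
    · exact h.1 hxy
    · exact h.1 hxy.symm

end Params

namespace ColoredComplex

variable {V : Type*}

/-- The class `𝒜(Δ)`: the constructed complexes `Γ` with `f_S(Γ) ≤ f_S(Δ)` for all `S ≠ [3]`.
(That the first `g₁`, `g₂`, `g₃` vertices of the colors span a complete tripartite complex, and that
at most two other vertices lie in a facet, holds by construction.) -/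
def classA (Δ : ColoredComplex V) : Set Params :=
  {Γ | Γ.p ≠ Γ.q ∧ (∀ i, 0 < Γ.g i) ∧
    ∀ S : Finset (Fin 3), S ≠ Finset.univ → (Γ.complex Δ).flag S ≤ Δ.flag S}

/-- The class `ℬ(Δ)`: members of `𝒜(Δ)` with the maximum number of facets. -/
def classB (Δ : ColoredComplex V) : Set Params :=
  {Γ | Γ ∈ Δ.classA ∧ ∀ Γ' ∈ Δ.classA, (Γ'.complex Δ).facets ≤ (Γ.complex Δ).facets}

/-- The class `𝒞(Δ)`: members of `ℬ(Δ)` with the maximum number of edges. -/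
def classC (Δ : ColoredComplex V) : Set Params :=
  {Γ | Γ ∈ Δ.classB ∧ ∀ Γ' ∈ Δ.classB, (Γ'.complex Δ).edges ≤ (Γ.complex Δ).edges}

/-- The class `𝒟(Δ)`: members `Γ` of `𝒞(Δ)` with
`f₁₂₃(Γ) < min {f₁(Δ) f₂₃(Δ), f₂(Δ) f₁₃(Δ), f₃(Δ) f₁₂(Δ)}`. -/
def classD (Δ : ColoredComplex V) : Set Params :=
  {Γ | Γ ∈ Δ.classC ∧ (Γ.complex Δ).facets <
    min (Δ.flag {0} * Δ.flag {1, 2})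
      (min (Δ.flag {1} * Δ.flag {0, 2}) (Δ.flag {2} * Δ.flag {0, 1}))}

/-- The prescribed parameters with third color `r` and `g_r = x`, where `i`, `k`, `r` are the three
colors: with `y = f_{ir}(Δ) / x` and `z = f_{kr}(Δ) / x`,
* `g_i` is `⌊y⌋` if `y` is not an integer, `y - 1` if `y` is an integer and
  `y ⌈z - 1⌉ > f_{ik}(Δ)`, and `y` otherwise;
* `g_k` is `⌊z⌋` if `z` is not an integer, `z - 1` if `z` is an integer and
  `z g_i > f_{ik}(Δ)`, and `z` otherwise;
* the first extra vertex has color `i` if `f_{ir}(Δ) - g_i x ≥ f_{kr}(Δ) - g_k x`, and color `k`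
  otherwise. -/
noncomputable def prescribed (Δ : ColoredComplex V) (i k r : Fin 3) (x : ℕ) : Params :=
  let fi := Δ.flag {i, r}
  let fk := Δ.flag {k, r}
  let fik := Δ.flag {i, k}
  let gi := if ¬ x ∣ fi then fi / x
    else if fik < fi / x * ⌈(fk : ℚ) / x - 1⌉₊ then fi / x - 1
    else fi / x
  let gk := if ¬ x ∣ fk then fk / x
    else if fik < fk / x * gi then fk / x - 1
    else fk / x
  { g := fun c => if c = r then x else if c = i then gi else gk
    p := if fk - gk * x ≤ fi - gi * x then i else k
    q := if fk - gk * x ≤ fi - gi * x then k else i }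

/-- The complex that is tried when the value `x` of `g₂` is checked (third color `r = 2`). -/
noncomputable def trial (Δ : ColoredComplex V) (x : ℕ) : Params :=
  Δ.prescribed 0 2 1 x

/-- The number of facets found when the value `x` of `g₂` is checked. -/
noncomputable def trialFacets (Δ : ColoredComplex V) (x : ℕ) : ℕ :=
  ((Δ.trial x).complex Δ).facets

/-- The potential values of `g₂`: those of the complexes in `𝒜(Δ)` with `g₁ = b₁(Δ)` and `r = 2`
that have as many edges of each color set as `Δ`. -/
def potential (Δ : ColoredComplex V) : Set ℕ :=
  {x | ∃ Γ ∈ Δ.classA,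
    (∀ S : Finset (Fin 3), S.card = 2 → (Γ.complex Δ).flag S = Δ.flag S) ∧
    Γ.g 0 = Δ.b1 ∧ Γ.r = 1 ∧ Γ.g 1 = x}

/-- Go through a list of values of `g₂` in order, `best` being the largest number of facets found so
far, and stop as soon as the upper bound `v(Δ, x)` says that the next value `x` cannot give more
than `best` facets.  The result is the list of the values that were checked. -/
noncomputable def scan (Δ : ColoredComplex V) : ℕ → List ℕ → List ℕ
  | _, [] => []
  | best, x :: l =>
    open Classical in
    if (best : ℝ) < Δ.v x then x :: Δ.scan (max best (Δ.trialFacets x)) l else []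

open Classical in
/-- The potential values that are at most `b₂(Δ)`, in decreasing order. -/
noncomputable def downList (Δ : ColoredComplex V) : List ℕ :=
  ((List.range (Δ.b2 + 1)).filter (fun x => x ∈ Δ.potential)).reverse

open Classical in
/-- The potential values above `b₂(Δ)`, in increasing order (all of them are at most `f₂(Δ)`). -/
noncomputable def upList (Δ : ColoredComplex V) : List ℕ :=
  (List.range (Δ.flag {1} + 1)).filter (fun x => Δ.b2 < x ∧ x ∈ Δ.potential)

/-- The values of `g₂` checked on the way down from `b₂(Δ)`. -/
noncomputable def checkedDown (Δ : ColoredComplex V) : List ℕ :=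
  Δ.scan 0 Δ.downList

/-- All values of `g₂` that the search checks: first down from `b₂(Δ)`, then up from
`b₂(Δ) + 1`, the latter starting with the best number of facets found on the way down. -/
noncomputable def checked (Δ : ColoredComplex V) : List ℕ :=
  Δ.checkedDown ++ Δ.scan ((Δ.checkedDown.map Δ.trialFacets).foldr max 0) Δ.upList

end ColoredComplex

/-!
The argument has three steps.

*All edges are used.*  A constructed complex in `𝒜(Δ)` has `min (f_ij(Δ)) (n_i n_j)` edges of color
`ij`, where `n_i` counts the vertices of color `i`, the extra one included (`flag_complex_pair`).
If a member of `𝒟(Δ)` left edges of `Δ` unused, then changing a constant `g_i` by one, or adding the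
extra vertices in other colors, would give more facets, or as many facets and more edges; only a
complex with `f_i f_jk` facets for some `i` could not be improved in this way, and the definition of
`𝒟(Δ)` excludes it.  This is `flag_eq_of_mem_classD`, and it makes `g₂(Γ₀)` a potential value.  For
a potential value `x`, the complex `Γ_x` uses all edges, too, and it has the most facets of all
complexes with third color `2` and `g₂ = x` that use all edges (`prescribed_spec`).

*The search loses nothing.*  The number `v(Δ, x)` bounds the facets found with the value `x`
(`facets_le_v`), and as a function of `x` it increases up to `√(f₁₂ f₂₃ / f₁₃)` and decreases from
there on.  So no value behind the point where a pass stops can improve on the largest number found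
(`mem_scan_or`), and some checked value reaches the number of facets of `Γ₀` (`exists_mem_checked`).
A checked `Γ_x` with the most facets therefore lies in `ℬ(Δ)`, in `𝒞(Δ)` since it uses all edges,
and in `𝒟(Δ)` since it has only as many facets as `Γ₀`.

*The search is short.*  Let `x₀` be the first value checked in a pass.  Every other value `x`
checked in this pass has `v(Δ, x) > f₁₂₃(Γ_{x₀})`, while `v(Δ, x₀) - f₁₂₃(Γ_{x₀})` is small: at
most `b₁ x₀` below the maximum of `v` and essentially `b₁ (f₁₂ - b₁ x₀)` above it.  Since `v` falls at least
quadratically with the distance from `x₀`, this distance is less than `R = √(f₁₂ f₂₃) / f₁₃` in the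
first pass (`sq_lt_of_mem_downList`), and less than `√2 R` or less than `4` in the second
(`lt_of_mem_upList`).  Hence fewer than `(R + 1) + (√2 R + 5) ≤ 6 + 2 √2 R` values are checked.
-/

/-! ### Faces of colored complexes and of constructed complexes -/

namespace ColoredComplex

variable {V : Type*}

theorem finite_setOf_flag (K : ColoredComplex V) (S : Finset (Fin 3)) :
    {s : Finset V | s ∈ K.faces ∧ K.color '' (s : Set V) = (S : Set (Fin 3))}.Finite :=
  K.finite_faces.subset fun _ hs => hs.1

theorem flag_empty (K : ColoredComplex V) : K.flag ∅ = 0 := by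
  rw [flag, Set.ncard_eq_zero (K.finite_setOf_flag ∅), Set.eq_empty_iff_forall_notMem]
  rintro s ⟨hs, hc⟩
  have hne := (K.isRelLowerSet_faces hs).1
  simp at hc
  subst hc
  simp at hne

/-- An edge is determined by its two ends. -/
theorem flag_pair_le (K : ColoredComplex V) (i j : Fin 3) :
    K.flag {i, j} ≤ K.flag {i} * K.flag {j} := by
  classical
  unfold flag
  rw [← Set.ncard_prod]
  have key : ∀ s : Finset V, K.color '' (s : Set V) = (({i, j} : Finset (Fin 3)) : Set (Fin 3)) →
      ∀ x ∈ s, K.color x = i ∨ K.color x = j := by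
    intro s hs x hx
    have : K.color x ∈ K.color '' (s : Set V) := ⟨x, hx, rfl⟩
    rw [hs] at this
    simpa using this
  have aux : ∀ s : Finset V, s ∈ K.faces → ∀ l : Fin 3, l ∈ K.color '' (s : Set V) →
      s.filter (fun x => K.color x = l) ∈ K.faces ∧
        K.color '' (s.filter (fun x => K.color x = l) : Set V)
          = (({l} : Finset (Fin 3)) : Set (Fin 3)) := by
    rintro s hs l ⟨x, hx, rfl⟩
    have hxm : x ∈ s.filter (fun y => K.color y = K.color x) := by simpa using hx
    refine ⟨(K.isRelLowerSet_faces hs).2 (Finset.filter_subset _ _) ⟨x, hxm⟩, ?_⟩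
    ext m
    simp only [Finset.coe_filter, Set.mem_image, Set.mem_ofPred_eq, Finset.coe_singleton,
      Set.mem_singleton_iff]
    constructor
    · rintro ⟨y, ⟨-, hy⟩, rfl⟩
      exact hy
    · rintro rfl
      exact ⟨x, ⟨hx, rfl⟩, rfl⟩
  refine Set.ncard_le_ncard_of_injOn
    (fun s => (s.filter (fun x => K.color x = i), s.filter (fun x => K.color x = j))) ?_ ?_
    ((K.finite_setOf_flag {i}).prod (K.finite_setOf_flag {j}))
  · rintro s ⟨hs, hc⟩
    refine ⟨aux s hs i ?_, aux s hs j ?_⟩ <;> rw [hc] <;> simp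
  · rintro s ⟨-, hs⟩ t ⟨-, ht⟩ hst
    simp only [Prod.mk.injEq] at hst
    ext x
    have h1 := Finset.ext_iff.1 hst.1 x
    have h2 := Finset.ext_iff.1 hst.2 x
    simp only [Finset.mem_filter] at h1 h2
    have h3 := key s hs x
    have h4 := key t ht x
    tauto

/-- In a complex whose vertices are pairs `(color, number)`, the edges of color set `{i, j}`
correspond to pairs of numbers. -/
theorem flag_pair_eq (K : ColoredComplex (Fin 3 × ℕ)) (hK : K.color = Prod.fst) {i j : Fin 3}
    (hij : i ≠ j) :
    K.flag {i, j} = {w : ℕ × ℕ | ({(i, w.1), (j, w.2)} : Finset (Fin 3 × ℕ)) ∈ K.faces}.ncard := by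
  symm
  unfold flag
  refine Set.ncard_congr (fun w _ => ({(i, w.1), (j, w.2)} : Finset (Fin 3 × ℕ))) ?_ ?_ ?_
  · intro w hw
    refine ⟨hw, ?_⟩
    simp [hK, Set.image_insert_eq]
  · rintro ⟨a, b⟩ ⟨c, d⟩ - - h
    have h1 := Finset.ext_iff.1 h (i, a)
    have h2 := Finset.ext_iff.1 h (j, b)
    simp [hij, hij.symm] at h1 h2
    simp [h1, h2]
  · rintro s ⟨hs, hc⟩
    have hinj := K.color_injOn s hs
    rw [hK] at hc hinj
    have hi : i ∈ Prod.fst '' (s : Set (Fin 3 × ℕ)) := by rw [hc]; simp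
    have hj : j ∈ Prod.fst '' (s : Set (Fin 3 × ℕ)) := by rw [hc]; simp
    obtain ⟨⟨i, a⟩, ha, rfl⟩ := hi
    obtain ⟨⟨j, b⟩, hb, rfl⟩ := hj
    have hse : s = {(i, a), (j, b)} := by
      ext w
      simp only [Finset.mem_insert, Finset.mem_singleton]
      constructor
      · intro hw
        have : w.1 ∈ Prod.fst '' (s : Set (Fin 3 × ℕ)) := ⟨w, hw, rfl⟩
        rw [hc] at this
        simp only [Finset.coe_insert, Finset.coe_singleton, Set.mem_insert_iff,
          Set.mem_singleton_iff] at this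
        exact this.imp (fun h => hinj hw ha h) (fun h => hinj hw hb h)
      · rintro (rfl | rfl)
        exacts [ha, hb]
    exact ⟨(a, b), by rw [hse] at hs; exact hs, hse.symm⟩

theorem flag_singleton_eq (K : ColoredComplex (Fin 3 × ℕ)) (hK : K.color = Prod.fst) (i : Fin 3) :
    K.flag {i} = {a : ℕ | ({(i, a)} : Finset (Fin 3 × ℕ)) ∈ K.faces}.ncard := by
  symm
  unfold flag
  refine Set.ncard_congr (fun a _ => ({(i, a)} : Finset (Fin 3 × ℕ))) ?_ ?_ ?_
  · intro w hw
    refine ⟨hw, ?_⟩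
    simp [hK]
  · rintro a c - - h
    simpa using h
  · rintro s ⟨hs, hc⟩
    have hinj := K.color_injOn s hs
    rw [hK] at hc hinj
    have hi : i ∈ Prod.fst '' (s : Set (Fin 3 × ℕ)) := by rw [hc]; simp
    obtain ⟨⟨i, a⟩, ha, rfl⟩ := hi
    have hse : s = {(i, a)} := by
      ext w
      simp only [Finset.mem_singleton]
      constructor
      · intro hw
        have : w.1 ∈ Prod.fst '' (s : Set (Fin 3 × ℕ)) := ⟨w, hw, rfl⟩
        rw [hc] at this
        simp only [Finset.coe_singleton, Set.mem_singleton_iff] at this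
        exact hinj hw ha this
      · rintro rfl
        exact ha
    exact ⟨a, by rw [hse] at hs; exact hs, hse.symm⟩

theorem flag_univ_eq (K : ColoredComplex (Fin 3 × ℕ)) (hK : K.color = Prod.fst) {i j k : Fin 3}
    (hij : i ≠ j) (hik : i ≠ k) (hjk : j ≠ k) :
    K.flag Finset.univ = {w : ℕ × ℕ × ℕ |
      ({(i, w.1), (j, w.2.1), (k, w.2.2)} : Finset (Fin 3 × ℕ)) ∈ K.faces}.ncard := by
  have huniv : (Finset.univ : Finset (Fin 3)) = {i, j, k} := by
    revert i j k; decide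
  rw [huniv]
  symm
  unfold flag
  refine Set.ncard_congr
    (fun w _ => ({(i, w.1), (j, w.2.1), (k, w.2.2)} : Finset (Fin 3 × ℕ))) ?_ ?_ ?_
  · intro w hw
    refine ⟨hw, ?_⟩
    simp [hK, Set.image_insert_eq]
  · rintro ⟨a, b, c⟩ ⟨a', b', c'⟩ - - h
    have h1 := Finset.ext_iff.1 h (i, a)
    have h2 := Finset.ext_iff.1 h (j, b)
    have h3 := Finset.ext_iff.1 h (k, c)
    simp [hij, hij.symm, hik, hik.symm, hjk, hjk.symm] at h1 h2 h3
    simp [h1, h2, h3]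
  · rintro s ⟨hs, hc⟩
    have hinj := K.color_injOn s hs
    rw [hK] at hc hinj
    have hi : i ∈ Prod.fst '' (s : Set (Fin 3 × ℕ)) := by rw [hc]; simp
    have hj : j ∈ Prod.fst '' (s : Set (Fin 3 × ℕ)) := by rw [hc]; simp
    have hk : k ∈ Prod.fst '' (s : Set (Fin 3 × ℕ)) := by rw [hc]; simp
    obtain ⟨⟨i, a⟩, ha, rfl⟩ := hi
    obtain ⟨⟨j, b⟩, hb, rfl⟩ := hj
    obtain ⟨⟨k, c⟩, hc', rfl⟩ := hk
    have hse : s = {(i, a), (j, b), (k, c)} := by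
      ext w
      simp only [Finset.mem_insert, Finset.mem_singleton]
      constructor
      · intro hw
        have : w.1 ∈ Prod.fst '' (s : Set (Fin 3 × ℕ)) := ⟨w, hw, rfl⟩
        rw [hc] at this
        simp only [Finset.coe_insert, Finset.coe_singleton, Set.mem_insert_iff,
          Set.mem_singleton_iff] at this
        exact this.imp (fun h => hinj hw ha h)
          (fun h => h.imp (fun h => hinj hw hb h) (fun h => hinj hw hc' h))
      · rintro (rfl | rfl | rfl)
        exacts [ha, hb, hc']
    exact ⟨(a, b, c), by rw [hse] at hs; exact hs, hse.symm⟩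

end ColoredComplex

namespace Params

variable {V : Type*} (Γ : Params) (Δ : ColoredComplex V)

theorem room_le_one (i : Fin 3) : Γ.room Δ i ≤ 1 := by
  unfold room; split_ifs <;> simp

theorem pDeg_le (k : Fin 3) : Γ.pDeg Δ k ≤ Γ.room Δ Γ.p * Γ.g k := by
  unfold pDeg room; split_ifs <;> simp

theorem qDeg_le_of_ne {k : Fin 3} (hk : k ≠ Γ.p) : Γ.qDeg Δ k ≤ Γ.room Δ Γ.q * Γ.g k := by
  unfold qDeg room; split_ifs <;> simp

theorem qDeg_p_le : Γ.qDeg Δ Γ.p ≤ Γ.room Δ Γ.q * (Γ.g Γ.p + Γ.room Δ Γ.p) := by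
  unfold qDeg
  by_cases h : Γ.g Γ.q < Δ.flag {Γ.q}
  · have : Γ.room Δ Γ.q = 1 := by simp [room, h]
    rw [this]; simp [h]
  · simp [h]

theorem mem_faces_pair {i j : Fin 3} (hij : i ≠ j) (a b : ℕ) :
    ({(i, a), (j, b)} : Finset (Fin 3 × ℕ)) ∈ (Γ.complex Δ).faces ↔
      a < Γ.numVert Δ i ∧ b < Γ.numVert Δ j ∧
        (Γ.Edge Δ (i, a) (j, b) ∨ Γ.Edge Δ (j, b) (i, a)) := by
  simp only [complex, Set.mem_ofPred_eq, Finset.insert_nonempty, true_and, Finset.mem_insert,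
    Finset.mem_singleton, forall_eq_or_imp, forall_eq, ne_eq, not_true_eq_false, false_imp_iff,
    Prod.mk.injEq, hij, hij.symm, false_and, not_false_eq_true, true_imp_iff, and_true]
  tauto

/-- The constructed complexes are flag complexes. -/
theorem mem_faces_triple {i j k : Fin 3} (hij : i ≠ j) (hik : i ≠ k) (hjk : j ≠ k) (a b c : ℕ) :
    ({(i, a), (j, b), (k, c)} : Finset (Fin 3 × ℕ)) ∈ (Γ.complex Δ).faces ↔
      ({(i, a), (j, b)} : Finset (Fin 3 × ℕ)) ∈ (Γ.complex Δ).faces ∧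
      ({(i, a), (k, c)} : Finset (Fin 3 × ℕ)) ∈ (Γ.complex Δ).faces ∧
      ({(j, b), (k, c)} : Finset (Fin 3 × ℕ)) ∈ (Γ.complex Δ).faces := by
  rw [mem_faces_pair Γ Δ hij, mem_faces_pair Γ Δ hik, mem_faces_pair Γ Δ hjk]
  simp only [complex, Set.mem_ofPred_eq, Finset.insert_nonempty, true_and, Finset.mem_insert,
    Finset.mem_singleton, forall_eq_or_imp, forall_eq, ne_eq, not_true_eq_false, false_imp_iff,
    Prod.mk.injEq, hij, hij.symm, hik, hik.symm, hjk, hjk.symm, false_and, not_false_eq_true,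
    true_imp_iff, and_true]
  tauto

theorem ne_r {Γ : Params} (h : Γ.p ≠ Γ.q) : Γ.p ≠ Γ.r ∧ Γ.q ≠ Γ.r := by
  unfold r
  generalize Γ.p = p at *
  generalize Γ.q = q at *
  revert p q; decide

section Counting

variable {Γ} {r : Fin 3}

theorem mem_faces_pq (hpq : Γ.p ≠ Γ.q) (a b : ℕ) :
    ({(Γ.p, a), (Γ.q, b)} : Finset (Fin 3 × ℕ)) ∈ (Γ.complex Δ).faces ↔
      (a < Γ.g Γ.p ∧ b < Γ.g Γ.q) ∨ (a = Γ.g Γ.p ∧ b < Γ.pDeg Δ Γ.q) ∨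
        (b = Γ.g Γ.q ∧ a < Γ.qDeg Δ Γ.p) := by
  rw [mem_faces_pair Γ Δ hpq]
  have h1 := Γ.pDeg_le Δ Γ.q
  have h2 := Γ.qDeg_p_le Δ
  have h3 := Γ.room_le_one Δ Γ.p
  have h4 := Γ.room_le_one Δ Γ.q
  simp only [Edge, numVert, Prod.mk.injEq, true_and, hpq, hpq.symm, ne_eq, not_false_eq_true,
    false_and, or_true, if_true, or_false, false_or]
  interval_cases Γ.room Δ Γ.p <;> interval_cases Γ.room Δ Γ.q <;> simp at h1 h2 ⊢ <;> omega

theorem mem_faces_pr (hpq : Γ.p ≠ Γ.q) (hpr : Γ.p ≠ r) (hqr : Γ.q ≠ r) (a b : ℕ) :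
    ({(Γ.p, a), (r, b)} : Finset (Fin 3 × ℕ)) ∈ (Γ.complex Δ).faces ↔
      (a < Γ.g Γ.p ∧ b < Γ.g r) ∨ (a = Γ.g Γ.p ∧ b < Γ.pDeg Δ r) := by
  rw [mem_faces_pair Γ Δ hpr]
  have h1 := Γ.pDeg_le Δ r
  have h3 := Γ.room_le_one Δ Γ.p
  simp only [Edge, numVert, Prod.mk.injEq, true_and, hpq, hpr, hpr.symm, hqr.symm, ne_eq,
    not_false_eq_true, false_and, if_true, or_false, if_false]
  interval_cases Γ.room Δ Γ.p <;> simp at h1 ⊢ <;> omega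

theorem mem_faces_qr (hpq : Γ.p ≠ Γ.q) (hpr : Γ.p ≠ r) (hqr : Γ.q ≠ r) (a b : ℕ) :
    ({(Γ.q, a), (r, b)} : Finset (Fin 3 × ℕ)) ∈ (Γ.complex Δ).faces ↔
      (a < Γ.g Γ.q ∧ b < Γ.g r) ∨ (a = Γ.g Γ.q ∧ b < Γ.qDeg Δ r) := by
  rw [mem_faces_pair Γ Δ hqr]
  have h1 := Γ.qDeg_le_of_ne Δ hpr.symm
  have h3 := Γ.room_le_one Δ Γ.q
  simp only [Edge, numVert, Prod.mk.injEq, true_and, hqr, hpq.symm, hpr.symm, hqr.symm, ne_eq,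
    not_false_eq_true, false_and, or_true, if_true, or_false, false_or, if_false]
  interval_cases Γ.room Δ Γ.q <;> simp at h1 ⊢ <;> omega

theorem flag_complex_singleton (i : Fin 3) : (Γ.complex Δ).flag {i} = Γ.numVert Δ i := by
  rw [ColoredComplex.flag_singleton_eq _ rfl]
  have : {a : ℕ | ({(i, a)} : Finset (Fin 3 × ℕ)) ∈ (Γ.complex Δ).faces}
      = (Finset.range (Γ.numVert Δ i) : Set ℕ) := by
    ext a
    simp [complex]
  rw [this, Set.ncard_coe_finset, Finset.card_range]

theorem flag_complex_pq (hpq : Γ.p ≠ Γ.q) : (Γ.complex Δ).flag {Γ.p, Γ.q} =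
    Γ.g Γ.p * Γ.g Γ.q + Γ.pDeg Δ Γ.q + Γ.qDeg Δ Γ.p := by
  have h1 := Γ.pDeg_le Δ Γ.q
  have h2 := Γ.room_le_one Δ Γ.p
  have h3 : Γ.pDeg Δ Γ.q ≤ Γ.g Γ.q := h1.trans (by nlinarith)
  rw [ColoredComplex.flag_pair_eq _ rfl hpq]
  have : {w : ℕ × ℕ | ({(Γ.p, w.1), (Γ.q, w.2)} : Finset (Fin 3 × ℕ)) ∈ (Γ.complex Δ).faces}
      = ((Finset.range (Γ.g Γ.p) ×ˢ Finset.range (Γ.g Γ.q) ∪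
          {Γ.g Γ.p} ×ˢ Finset.range (Γ.pDeg Δ Γ.q) ∪
          Finset.range (Γ.qDeg Δ Γ.p) ×ˢ {Γ.g Γ.q} : Finset (ℕ × ℕ)) : Set (ℕ × ℕ)) := by
    ext ⟨a, b⟩
    rw [Set.mem_ofPred_eq, mem_faces_pq Δ hpq]
    simp
    omega
  rw [this, Set.ncard_coe_finset, Finset.card_union_of_disjoint, Finset.card_union_of_disjoint]
  · simp
  · simp only [Finset.disjoint_left, Finset.mem_product, Finset.mem_range, Finset.mem_singleton,
      Prod.forall]
    omega
  · simp only [Finset.disjoint_left, Finset.mem_product, Finset.mem_range, Finset.mem_singleton,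
      Prod.forall, Finset.mem_union]
    omega

theorem flag_complex_pr (hpq : Γ.p ≠ Γ.q) (hpr : Γ.p ≠ r) (hqr : Γ.q ≠ r) :
    (Γ.complex Δ).flag {Γ.p, r} = Γ.g Γ.p * Γ.g r + Γ.pDeg Δ r := by
  rw [ColoredComplex.flag_pair_eq _ rfl hpr]
  have : {w : ℕ × ℕ | ({(Γ.p, w.1), (r, w.2)} : Finset (Fin 3 × ℕ)) ∈ (Γ.complex Δ).faces}
      = ((Finset.range (Γ.g Γ.p) ×ˢ Finset.range (Γ.g r) ∪
          {Γ.g Γ.p} ×ˢ Finset.range (Γ.pDeg Δ r) : Finset (ℕ × ℕ)) : Set (ℕ × ℕ)) := by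
    ext ⟨a, b⟩
    rw [Set.mem_ofPred_eq, mem_faces_pr Δ hpq hpr hqr]
    simp
    omega
  rw [this, Set.ncard_coe_finset, Finset.card_union_of_disjoint]
  · simp
  · simp only [Finset.disjoint_left, Finset.mem_product, Finset.mem_range, Finset.mem_singleton,
      Prod.forall]
    omega

theorem flag_complex_qr (hpq : Γ.p ≠ Γ.q) (hpr : Γ.p ≠ r) (hqr : Γ.q ≠ r) :
    (Γ.complex Δ).flag {Γ.q, r} = Γ.g Γ.q * Γ.g r + Γ.qDeg Δ r := by
  rw [ColoredComplex.flag_pair_eq _ rfl hqr]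
  have : {w : ℕ × ℕ | ({(Γ.q, w.1), (r, w.2)} : Finset (Fin 3 × ℕ)) ∈ (Γ.complex Δ).faces}
      = ((Finset.range (Γ.g Γ.q) ×ˢ Finset.range (Γ.g r) ∪
          {Γ.g Γ.q} ×ˢ Finset.range (Γ.qDeg Δ r) : Finset (ℕ × ℕ)) : Set (ℕ × ℕ)) := by
    ext ⟨a, b⟩
    rw [Set.mem_ofPred_eq, mem_faces_qr Δ hpq hpr hqr]
    simp
    omega
  rw [this, Set.ncard_coe_finset, Finset.card_union_of_disjoint]
  · simp
  · simp only [Finset.disjoint_left, Finset.mem_product, Finset.mem_range, Finset.mem_singleton,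
      Prod.forall]
    omega

/-- The facets of the constructed complex, sorted by the extra vertices which they contain: none,
only the one of color `p`, only the one of color `q`, or both. -/
theorem facets_complex (hpq : Γ.p ≠ Γ.q) (hpr : Γ.p ≠ r) (hqr : Γ.q ≠ r) : (Γ.complex Δ).facets =
    Γ.g Γ.p * Γ.g Γ.q * Γ.g r + Γ.pDeg Δ Γ.q * Γ.pDeg Δ r +
      min (Γ.g Γ.p) (Γ.qDeg Δ Γ.p) * Γ.qDeg Δ r +
      (Γ.qDeg Δ Γ.p - Γ.g Γ.p) * min (Γ.pDeg Δ r) (Γ.qDeg Δ r) := by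
  have h1 : Γ.pDeg Δ Γ.q ≤ Γ.g Γ.q := (Γ.pDeg_le Δ Γ.q).trans (by nlinarith [Γ.room_le_one Δ Γ.p])
  have h2 : Γ.pDeg Δ r ≤ Γ.g r := (Γ.pDeg_le Δ r).trans (by nlinarith [Γ.room_le_one Δ Γ.p])
  have h3 : Γ.qDeg Δ r ≤ Γ.g r :=
    (Γ.qDeg_le_of_ne Δ hpr.symm).trans (by nlinarith [Γ.room_le_one Δ Γ.q])
  have h4 : Γ.qDeg Δ Γ.p ≤ Γ.g Γ.p + 1 := (Γ.qDeg_p_le Δ).trans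
    (by nlinarith [Γ.room_le_one Δ Γ.q, Γ.room_le_one Δ Γ.p])
  rw [ColoredComplex.facets, ColoredComplex.flag_univ_eq _ rfl hpq hpr hqr]
  have : {w : ℕ × ℕ × ℕ |
      ({(Γ.p, w.1), (Γ.q, w.2.1), (r, w.2.2)} : Finset (Fin 3 × ℕ)) ∈ (Γ.complex Δ).faces}
      = ((Finset.range (Γ.g Γ.p) ×ˢ Finset.range (Γ.g Γ.q) ×ˢ Finset.range (Γ.g r) ∪
          {Γ.g Γ.p} ×ˢ Finset.range (Γ.pDeg Δ Γ.q) ×ˢ Finset.range (Γ.pDeg Δ r) ∪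
          Finset.range (min (Γ.g Γ.p) (Γ.qDeg Δ Γ.p)) ×ˢ {Γ.g Γ.q} ×ˢ Finset.range (Γ.qDeg Δ r) ∪
          Finset.Ico (Γ.g Γ.p) (Γ.qDeg Δ Γ.p) ×ˢ {Γ.g Γ.q} ×ˢ
            Finset.range (min (Γ.pDeg Δ r) (Γ.qDeg Δ r)) : Finset (ℕ × ℕ × ℕ)) :
          Set (ℕ × ℕ × ℕ)) := by
    ext ⟨a, b, c⟩
    rw [Set.mem_ofPred_eq, mem_faces_triple Γ Δ hpq hpr hqr, mem_faces_pq Δ hpq,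
      mem_faces_pr Δ hpq hpr hqr, mem_faces_qr Δ hpq hpr hqr]
    simp
    omega
  rw [this, Set.ncard_coe_finset, Finset.card_union_of_disjoint, Finset.card_union_of_disjoint,
    Finset.card_union_of_disjoint]
  · simp
    ring
  · simp only [Finset.disjoint_left, Finset.mem_product, Finset.mem_range, Finset.mem_singleton,
      Prod.forall]
    omega
  · simp only [Finset.disjoint_left, Finset.mem_product, Finset.mem_range, Finset.mem_singleton,
      Prod.forall, Finset.mem_union]
    omega
  · simp only [Finset.disjoint_left, Finset.mem_product, Finset.mem_range, Finset.mem_singleton,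
      Prod.forall, Finset.mem_union, Finset.mem_Ico]
    omega

end Counting

end Params

/-! ### The numbers of edges and facets of a constructed complex -/

namespace Params

variable {V : Type*} {Γ : Params} {Δ : ColoredComplex V}

theorem le_numVert (i : Fin 3) : Γ.g i ≤ Γ.numVert Δ i := Nat.le_add_right _ _

theorem numVert_le_succ (i : Fin 3) : Γ.numVert Δ i ≤ Γ.g i + 1 := by
  have := Γ.room_le_one Δ i
  unfold numVert; split_ifs <;> omega

theorem numVert_of_ne {r : Fin 3} (hpr : Γ.p ≠ r) (hqr : Γ.q ≠ r) : Γ.numVert Δ r = Γ.g r := by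
  simp [numVert, hpr.symm, hqr.symm]

/-- The extra vertices are added exactly when there is room for them. -/
theorem numVert_eq_min {i : Fin 3} (hi : i = Γ.p ∨ i = Γ.q) (h : Γ.g i ≤ Δ.flag {i}) :
    Γ.numVert Δ i = min (Γ.g i + 1) (Δ.flag {i}) := by
  simp only [numVert, hi, if_true, room]
  split_ifs <;> omega

theorem pDeg_eq (h : Γ.g Γ.p ≤ Δ.flag {Γ.p}) (k : Fin 3) : Γ.pDeg Δ k =
    (Γ.numVert Δ Γ.p - Γ.g Γ.p) * min (Γ.g k) (Δ.flag {Γ.p, k} - Γ.g Γ.p * Γ.g k) := by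
  have h1 := numVert_eq_min (Or.inl rfl) h
  unfold pDeg
  split_ifs with h'
  · rw [show Γ.numVert Δ Γ.p - Γ.g Γ.p = 1 by omega, one_mul]
  · rw [show Γ.numVert Δ Γ.p - Γ.g Γ.p = 0 by omega, zero_mul]

theorem qDeg_eq (h : Γ.g Γ.q ≤ Δ.flag {Γ.q}) {k : Fin 3} (hk : k ≠ Γ.p) : Γ.qDeg Δ k =
    (Γ.numVert Δ Γ.q - Γ.g Γ.q) * min (Γ.g k) (Δ.flag {Γ.q, k} - Γ.g Γ.q * Γ.g k) := by
  have h1 := numVert_eq_min (Or.inr rfl) h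
  unfold qDeg
  split_ifs with h'
  · rw [show Γ.numVert Δ Γ.q - Γ.g Γ.q = 1 by omega, one_mul]
  · rw [show Γ.numVert Δ Γ.q - Γ.g Γ.q = 0 by omega, zero_mul]

theorem qDeg_p_eq (h : Γ.g Γ.q ≤ Δ.flag {Γ.q}) : Γ.qDeg Δ Γ.p =
    (Γ.numVert Δ Γ.q - Γ.g Γ.q) * min (Γ.numVert Δ Γ.p)
      (Δ.flag {Γ.p, Γ.q} - Γ.g Γ.p * Γ.g Γ.q - Γ.pDeg Δ Γ.q) := by
  have h1 : Γ.numVert Δ Γ.p = Γ.g Γ.p + Γ.room Δ Γ.p := by simp [numVert]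
  have h2 := numVert_eq_min (Or.inr rfl) h
  unfold qDeg
  simp only [↓reduceIte]
  rw [Finset.pair_comm Γ.q Γ.p, mul_comm (Γ.g Γ.q), h1]
  split_ifs with h'
  · rw [show Γ.numVert Δ Γ.q - Γ.g Γ.q = 1 by omega, one_mul]
  · rw [show Γ.numVert Δ Γ.q - Γ.g Γ.q = 0 by omega, zero_mul]

/-- An extra vertex is joined to as many vertices as the numbers of vertices and of edges allow. -/
theorem mul_add_extra_mul_min {a a' b f : ℕ} (h1 : a ≤ a') (h2 : a' ≤ a + 1) (h : a * b ≤ f) :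
    a * b + (a' - a) * min b (f - a * b) = min f (a' * b) := by
  obtain rfl | rfl : a' = a ∨ a' = a + 1 := by omega
  · simpa using h
  · rw [add_mul, one_mul, show a + 1 - a = 1 by omega, one_mul]; omega

theorem flag_complex_pq_eq_min (hpq : Γ.p ≠ Γ.q) (hp : Γ.g Γ.p ≤ Δ.flag {Γ.p})
    (hq : Γ.g Γ.q ≤ Δ.flag {Γ.q}) (h : Γ.g Γ.p * Γ.g Γ.q ≤ Δ.flag {Γ.p, Γ.q}) :
    (Γ.complex Δ).flag {Γ.p, Γ.q} =
      min (Δ.flag {Γ.p, Γ.q}) (Γ.numVert Δ Γ.p * Γ.numVert Δ Γ.q) := by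
  have h1 := le_numVert (Γ := Γ) (Δ := Δ) Γ.q
  have h2 := numVert_le_succ (Γ := Γ) (Δ := Δ) Γ.q
  have h3 := le_numVert (Γ := Γ) (Δ := Δ) Γ.p
  have h4 := numVert_le_succ (Γ := Γ) (Δ := Δ) Γ.p
  have h5 : Γ.g Γ.p * Γ.g Γ.q + Γ.pDeg Δ Γ.q =
      min (Δ.flag {Γ.p, Γ.q}) (Γ.numVert Δ Γ.p * Γ.g Γ.q) := by
    rw [pDeg_eq hp, mul_add_extra_mul_min h3 h4 h]
  rw [flag_complex_pq Δ hpq, qDeg_p_eq hq, Nat.sub_sub, h5]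
  obtain h6 | h6 : Γ.numVert Δ Γ.q = Γ.g Γ.q ∨ Γ.numVert Δ Γ.q = Γ.g Γ.q + 1 := by omega
  · simp [h6]
  · rw [h6, show Γ.g Γ.q + 1 - Γ.g Γ.q = 1 by omega, one_mul, mul_add, mul_one]; omega

theorem flag_complex_pr_eq_min {r : Fin 3} (hpq : Γ.p ≠ Γ.q) (hpr : Γ.p ≠ r) (hqr : Γ.q ≠ r)
    (hp : Γ.g Γ.p ≤ Δ.flag {Γ.p}) (h : Γ.g Γ.p * Γ.g r ≤ Δ.flag {Γ.p, r}) :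
    (Γ.complex Δ).flag {Γ.p, r} = min (Δ.flag {Γ.p, r}) (Γ.numVert Δ Γ.p * Γ.numVert Δ r) := by
  rw [flag_complex_pr Δ hpq hpr hqr, pDeg_eq hp,
    mul_add_extra_mul_min (le_numVert _) (numVert_le_succ _) h, numVert_of_ne hpr hqr]

theorem flag_complex_qr_eq_min {r : Fin 3} (hpq : Γ.p ≠ Γ.q) (hpr : Γ.p ≠ r) (hqr : Γ.q ≠ r)
    (hq : Γ.g Γ.q ≤ Δ.flag {Γ.q}) (h : Γ.g Γ.q * Γ.g r ≤ Δ.flag {Γ.q, r}) :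
    (Γ.complex Δ).flag {Γ.q, r} = min (Δ.flag {Γ.q, r}) (Γ.numVert Δ Γ.q * Γ.numVert Δ r) := by
  rw [flag_complex_qr Δ hpq hpr hqr, qDeg_eq hq hpr.symm,
    mul_add_extra_mul_min (le_numVert _) (numVert_le_succ _) h, numVert_of_ne hpr hqr]

theorem pair_cases {p q r : Fin 3} (hpq : p ≠ q) (hpr : p ≠ r) (hqr : q ≠ r) {i j : Fin 3}
    (hij : i ≠ j) : (i = p ∧ j = q) ∨ (i = p ∧ j = r) ∨ (i = q ∧ j = r) ∨
      (j = p ∧ i = q) ∨ (j = p ∧ i = r) ∨ (j = q ∧ i = r) := by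
  revert p q r i j; decide

/-- Every symmetric relation between two colors can be checked on the pairs `pq`, `pr`, `qr`. -/
theorem forall_pair {P : Fin 3 → Fin 3 → Prop} (hP : ∀ i j, P i j → P j i) {p q r : Fin 3}
    (hpq : p ≠ q) (hpr : p ≠ r) (hqr : q ≠ r) (h1 : P p q) (h2 : P p r) (h3 : P q r) :
    ∀ i j, i ≠ j → P i j := by
  intro i j hij
  rcases pair_cases hpq hpr hqr hij with ⟨rfl, rfl⟩ | ⟨rfl, rfl⟩ | ⟨rfl, rfl⟩ | ⟨rfl, rfl⟩ |
    ⟨rfl, rfl⟩ | ⟨rfl, rfl⟩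
  exacts [h1, h2, h3, hP _ _ h1, hP _ _ h2, hP _ _ h3]

theorem mul_le_flag_complex_pair (hpq : Γ.p ≠ Γ.q) :
    ∀ i j, i ≠ j → Γ.g i * Γ.g j ≤ (Γ.complex Δ).flag {i, j} := by
  obtain ⟨hpr, hqr⟩ := ne_r hpq
  refine forall_pair (fun i j h => by rwa [mul_comm, Finset.pair_comm]) hpq hpr hqr ?_ ?_ ?_
  · rw [flag_complex_pq Δ hpq]; omega
  · rw [flag_complex_pr Δ hpq hpr hqr]; omega
  · rw [flag_complex_qr Δ hpq hpr hqr]; omega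

theorem flag_complex_pair_of_le (hpq : Γ.p ≠ Γ.q) (h1 : ∀ i, Γ.g i ≤ Δ.flag {i})
    (h2 : ∀ i j, i ≠ j → Γ.g i * Γ.g j ≤ Δ.flag {i, j}) : ∀ i j, i ≠ j →
    (Γ.complex Δ).flag {i, j} = min (Δ.flag {i, j}) (Γ.numVert Δ i * Γ.numVert Δ j) := by
  obtain ⟨hpr, hqr⟩ := ne_r hpq
  exact forall_pair
    (fun i j h => by rwa [Finset.pair_comm, mul_comm (Γ.numVert Δ j)]) hpq hpr hqr
    (flag_complex_pq_eq_min hpq (h1 _) (h1 _) (h2 _ _ hpq))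
    (flag_complex_pr_eq_min hpq hpr hqr (h1 _) (h2 _ _ hpr))
    (flag_complex_qr_eq_min hpq hpr hqr (h1 _) (h2 _ _ hqr))

theorem finset_fin_three_cases (S : Finset (Fin 3)) (hS : S ≠ Finset.univ) :
    S = ∅ ∨ (∃ i, S = {i}) ∨ ∃ i j, i ≠ j ∧ S = {i, j} := by
  revert S; decide

theorem finset_fin_three_card_two (S : Finset (Fin 3)) (hS : S.card = 2) :
    ∃ i j, i ≠ j ∧ S = {i, j} := by
  revert S; decide

/-- Since the extra vertices respect the bounds by construction, membership in `𝒜(Δ)` depends only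
on the complete tripartite part. -/
theorem mem_classA_iff : Γ ∈ Δ.classA ↔ Γ.p ≠ Γ.q ∧ (∀ i, 0 < Γ.g i) ∧
    (∀ i, Γ.g i ≤ Δ.flag {i}) ∧ ∀ i j, i ≠ j → Γ.g i * Γ.g j ≤ Δ.flag {i, j} := by
  constructor
  · rintro ⟨hpq, hpos, h⟩
    refine ⟨hpq, hpos, fun i => ?_, fun i j hij => ?_⟩
    · refine le_trans ?_ (h {i} (by revert i; decide))
      rw [flag_complex_singleton]
      exact le_numVert i
    · exact (mul_le_flag_complex_pair hpq i j hij).trans (h {i, j} (by revert i j; decide))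
  · rintro ⟨hpq, hpos, h1, h2⟩
    refine ⟨hpq, hpos, fun S hS => ?_⟩
    rcases finset_fin_three_cases S hS with rfl | ⟨i, rfl⟩ | ⟨i, j, hij, rfl⟩
    · rw [ColoredComplex.flag_empty]; exact Nat.zero_le _
    · rw [flag_complex_singleton]
      by_cases hi : i = Γ.p ∨ i = Γ.q
      · rw [numVert_eq_min hi (h1 i)]; exact min_le_right _ _
      · simpa [numVert, hi] using h1 i
    · rw [flag_complex_pair_of_le hpq h1 h2 i j hij]; exact min_le_left _ _

/-- The edges of a member of `𝒜(Δ)` are as many as the numbers of vertices and the bounds `f_ij(Δ)`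
allow; in particular, the order of the two extra vertices does not matter. -/
theorem flag_complex_pair (hA : Γ ∈ Δ.classA) {i j : Fin 3} (hij : i ≠ j) :
    (Γ.complex Δ).flag {i, j} = min (Δ.flag {i, j}) (Γ.numVert Δ i * Γ.numVert Δ j) := by
  obtain ⟨hpq, -, h1, h2⟩ := mem_classA_iff.1 hA
  exact flag_complex_pair_of_le hpq h1 h2 i j hij

theorem edges_eq (K : ColoredComplex V) {i k r : Fin 3} (hik : i ≠ k) (hir : i ≠ r) (hkr : k ≠ r) :
    K.edges = K.flag {i, k} + K.flag {i, r} + K.flag {k, r} := by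
  have h1 := Finset.pair_comm (0 : Fin 3) 1
  have h2 := Finset.pair_comm (0 : Fin 3) 2
  have h3 := Finset.pair_comm (1 : Fin 3) 2
  unfold ColoredComplex.edges
  fin_cases i <;> fin_cases k <;> fin_cases r <;>
    first
      | exact absurd rfl hik
      | exact absurd rfl hir
      | exact absurd rfl hkr
      | (simp only [Fin.zero_eta, Fin.mk_one, Fin.reduceFinMk, h1, h2, h3]; try ring)

/-- The data of the facets of a constructed complex: `u`, `u'` and `ε` are the numbers of edges of
color `ik` that contain the extra vertex of color `i` only, the one of color `k` only, or both,
while `s` and `t` are the numbers of vertices of color `r` to which these two are joined. -/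
structure IsFacetData (Γ : Params) (Δ : ColoredComplex V) (i k r : Fin 3) (s t u u' ε : ℕ) :
    Prop where
  flag_eq : (Γ.complex Δ).flag {i, k} = Γ.g i * Γ.g k + u + u' + ε
  facets_eq : (Γ.complex Δ).facets = Γ.g i * Γ.g k * Γ.g r + s * u + t * u' + ε * min s t
  u_le : u ≤ Γ.g k
  u'_le : u' ≤ Γ.g i
  ε_le : ε ≤ 1
  full_of_pos : 0 < ε → u = Γ.g k ∧ u' = Γ.g i
  left_eq_zero : Γ.numVert Δ i = Γ.g i → s = 0 ∧ u = 0 ∧ ε = 0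
  right_eq_zero : Γ.numVert Δ k = Γ.g k → t = 0 ∧ u' = 0 ∧ ε = 0
  of_p_eq_left : Γ.p = i → Γ.numVert Δ i = Γ.g i + 1 → u = Γ.g k ∨ (u' = 0 ∧ ε = 0)
  of_p_eq_right : Γ.p = k → Γ.numVert Δ k = Γ.g k + 1 → u' = Γ.g i ∨ (u = 0 ∧ ε = 0)

theorem IsFacetData.symm {i k r : Fin 3} {s t u u' ε : ℕ} (h : IsFacetData Γ Δ i k r s t u u' ε) :
    IsFacetData Γ Δ k i r t s u' u ε where
  flag_eq := by rw [Finset.pair_comm, h.flag_eq]; ring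
  facets_eq := by rw [h.facets_eq, min_comm]; ring
  u_le := h.u'_le
  u'_le := h.u_le
  ε_le := h.ε_le
  full_of_pos := fun h' => (h.full_of_pos h').symm
  left_eq_zero := h.right_eq_zero
  right_eq_zero := h.left_eq_zero
  of_p_eq_left := h.of_p_eq_right
  of_p_eq_right := h.of_p_eq_left

theorem isFacetData_pq (hA : Γ ∈ Δ.classA) {r : Fin 3} (hpr : Γ.p ≠ r) (hqr : Γ.q ≠ r) :
    IsFacetData Γ Δ Γ.p Γ.q r (Γ.pDeg Δ r) (Γ.qDeg Δ r) (Γ.pDeg Δ Γ.q)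
      (min (Γ.g Γ.p) (Γ.qDeg Δ Γ.p)) (Γ.qDeg Δ Γ.p - Γ.g Γ.p) := by
  obtain ⟨hpq, hpos, h1, h2⟩ := mem_classA_iff.1 hA
  have hp := pDeg_eq (h1 Γ.p) Γ.q
  have hp' := pDeg_eq (h1 Γ.p) r
  have hq := qDeg_p_eq (h1 Γ.q)
  have hq' := qDeg_eq (h1 Γ.q) hpr.symm
  have e1 := le_numVert (Γ := Γ) (Δ := Δ) Γ.p
  have e2 := le_numVert (Γ := Γ) (Δ := Δ) Γ.q
  have e3 := numVert_le_succ (Γ := Γ) (Δ := Δ) Γ.p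
  have e4 := numVert_le_succ (Γ := Γ) (Δ := Δ) Γ.q
  have hle : Γ.qDeg Δ Γ.p ≤ Γ.numVert Δ Γ.p := by
    rw [hq]
    calc _ ≤ 1 * min (Γ.numVert Δ Γ.p) _ := Nat.mul_le_mul_right _ (by omega)
      _ ≤ _ := by rw [one_mul]; exact min_le_left _ _
  have hle' : Γ.pDeg Δ Γ.q ≤ Γ.g Γ.q := by
    rw [hp]
    calc _ ≤ 1 * min (Γ.g Γ.q) _ := Nat.mul_le_mul_right _ (by omega)
      _ ≤ _ := by rw [one_mul]; exact min_le_left _ _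
  constructor
  · rw [flag_complex_pq Δ hpq]; omega
  · rw [facets_complex Δ hpq hpr hqr]; ring
  · exact hle'
  · exact min_le_left _ _
  · omega
  · intro hε
    have e5 : Γ.numVert Δ Γ.p - Γ.g Γ.p = 1 := by omega
    have e6 : Γ.numVert Δ Γ.q - Γ.g Γ.q = 1 := by
      by_contra h
      rw [show Γ.numVert Δ Γ.q - Γ.g Γ.q = 0 by omega, zero_mul] at hq
      omega
    rw [e6, one_mul] at hq
    rw [e5, one_mul] at hp
    omega
  · intro h
    rw [h, Nat.sub_self, zero_mul] at hp hp'
    exact ⟨hp', hp, by omega⟩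
  · intro h
    rw [h, Nat.sub_self, zero_mul] at hq hq'
    exact ⟨hq', by omega, by omega⟩
  · intro _ h
    rw [h, show Γ.g Γ.p + 1 - Γ.g Γ.p = 1 by omega, one_mul] at hp
    by_cases h' : Γ.pDeg Δ Γ.q = Γ.g Γ.q
    · exact Or.inl h'
    · have : Γ.qDeg Δ Γ.p = 0 := by
        rw [hq, mul_eq_zero]; right; omega
      right; omega
  · intro h; exact absurd h hpq

/-- The facets of a constructed complex, described without reference to the order of the two extra
vertices. -/
theorem exists_isFacetData (hA : Γ ∈ Δ.classA) {i k r : Fin 3} (hik : i ≠ k)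
    (hpr : Γ.p ≠ r) (hqr : Γ.q ≠ r) (hir : i ≠ r) (hkr : k ≠ r) {s t : ℕ}
    (hs : (Γ.complex Δ).flag {i, r} = Γ.g i * Γ.g r + s)
    (ht : (Γ.complex Δ).flag {k, r} = Γ.g k * Γ.g r + t) :
    ∃ u u' ε, IsFacetData Γ Δ i k r s t u u' ε := by
  have hpq := hA.1
  have main := isFacetData_pq hA hpr hqr
  have : (i = Γ.p ∧ k = Γ.q) ∨ (i = Γ.q ∧ k = Γ.p) := by
    generalize Γ.p = p at *
    generalize Γ.q = q at *
    clear hs ht main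
    revert i k r p q; decide
  rcases this with ⟨rfl, rfl⟩ | ⟨rfl, rfl⟩
  · rw [flag_complex_pr Δ hpq hpr hqr] at hs
    rw [flag_complex_qr Δ hpq hpr hqr] at ht
    obtain rfl : s = Γ.pDeg Δ r := by omega
    obtain rfl : t = Γ.qDeg Δ r := by omega
    exact ⟨_, _, _, main⟩
  · rw [flag_complex_pr Δ hpq hpr hqr] at ht
    rw [flag_complex_qr Δ hpq hpr hqr] at hs
    obtain rfl : t = Γ.pDeg Δ r := by omega
    obtain rfl : s = Γ.qDeg Δ r := by omega
    exact ⟨_, _, _, main.symm⟩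

end Params

/-! ### Members of `𝒟(Δ)` use all edges with the third color -/

namespace Params

variable {V : Type*} {Γ : Params} {Δ : ColoredComplex V}

/-- A purely numerical statement: for all `x`, `y`, `z`, a complex constructed with `x`, `y`, `z`
vertices of three colors `α`, `β`, `γ` and extra vertices of the colors `α` and `β`, in this order,
does not have more than `F` facets, and it does not have `F` facets and more than `E` edges.  Here
`n` and `m` are the numbers of vertices of the colors `α` and `β` with the extra ones included, `P`
and `S` are the numbers of vertices of the colors `β` and `γ` to which the first extra vertex is
joined, and `Q` and `T` are those of the colors `α` and `γ` for the second extra vertex. -/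
def NotImprovable (F E fα fβ fγ fαβ fαγ fβγ : ℕ) : Prop :=
  ∀ x y z n m P S Q T : ℕ, 0 < x → 0 < y → 0 < z → x ≤ fα → y ≤ fβ → z ≤ fγ →
    x * y ≤ fαβ → x * z ≤ fαγ → y * z ≤ fβγ → n = min (x + 1) fα → m = min (y + 1) fβ →
    P = (n - x) * min y (fαβ - x * y) → S = (n - x) * min z (fαγ - x * z) →
    Q = (m - y) * min n (fαβ - x * y - P) → T = (m - y) * min z (fβγ - y * z) →
    x * y * z + P * S + min x Q * T + (Q - x) * min S T ≤ F ∧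
      (F ≤ x * y * z + P * S + min x Q * T + (Q - x) * min S T →
        min fαβ (n * m) + min fαγ (n * z) + min fβγ (m * z) ≤ E)

/-- The numerical content of membership in `𝒞(Δ)`: the complex has the most facets and, among the
complexes with as many facets, the most edges. -/
theorem notImprovable_of_mem_classC (hC : Γ ∈ Δ.classC) {α β γ : Fin 3} (hαβ : α ≠ β) (hαγ : α ≠ γ)
    (hβγ : β ≠ γ) :
    NotImprovable (Γ.complex Δ).facets (Γ.complex Δ).edges (Δ.flag {α}) (Δ.flag {β}) (Δ.flag {γ})
      (Δ.flag {α, β}) (Δ.flag {α, γ}) (Δ.flag {β, γ}) := by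
  intro x y z n m P S Q T hx hy hz hx' hy' hz' hxy hxz hyz hn hm hP hS hQ hT
  let Γ' : Params := ⟨fun c => if c = α then x else if c = β then y else z, α, β⟩
  have gα : Γ'.g α = x := by simp [Γ']
  have gβ : Γ'.g β = y := by simp [Γ', hαβ.symm]
  have gγ : Γ'.g γ = z := by simp [Γ', hαγ.symm, hβγ.symm]
  have hcol : ∀ c, c = α ∨ c = β ∨ c = γ := by
    clear gα gβ gγ Γ' hx' hy' hz' hxy hxz hyz hn hm hP hS hQ hT
    revert α β γ; decide
  have hA : Γ' ∈ Δ.classA := by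
    refine mem_classA_iff.2 ⟨hαβ, fun c => ?_, fun c => ?_, ?_⟩
    · rcases hcol c with rfl | rfl | rfl
      · rwa [gα]
      · rwa [gβ]
      · rwa [gγ]
    · rcases hcol c with rfl | rfl | rfl
      · rwa [gα]
      · rwa [gβ]
      · rwa [gγ]
    · refine forall_pair (fun i j h => by rwa [mul_comm, Finset.pair_comm]) hαβ hαγ hβγ ?_ ?_ ?_
      · rwa [gα, gβ]
      · rwa [gα, gγ]
      · rwa [gβ, gγ]
  obtain ⟨-, -, h1, -⟩ := mem_classA_iff.1 hA
  have nα : Γ'.numVert Δ α = min (x + 1) (Δ.flag {α}) := by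
    rw [← gα]; exact numVert_eq_min (Or.inl rfl) (h1 α)
  have nβ : Γ'.numVert Δ β = min (y + 1) (Δ.flag {β}) := by
    rw [← gβ]; exact numVert_eq_min (Or.inr rfl) (h1 β)
  have nγ : Γ'.numVert Δ γ = z := by
    rw [← gγ]; exact numVert_of_ne hαγ hβγ
  have hfac := facets_complex (Γ := Γ') Δ hαβ hαγ hβγ
  have e1 := pDeg_eq (Γ := Γ') (h1 α) β
  have e2 := pDeg_eq (Γ := Γ') (h1 α) γ
  have e3 := qDeg_p_eq (Γ := Γ') (h1 β)
  have e4 := qDeg_eq (Γ := Γ') (h1 β) hαγ.symm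
  have e5 := edges_eq (Γ'.complex Δ) hαβ hαγ hβγ
  rw [flag_complex_pair hA hαβ, flag_complex_pair hA hαγ, flag_complex_pair hA hβγ, nα, nβ,
    nγ] at e5
  change _ = (Γ'.numVert Δ α - Γ'.g α) * min _ (Δ.flag {α, β} - Γ'.g α * Γ'.g β) at e1
  change _ = (Γ'.numVert Δ α - Γ'.g α) * min _ (Δ.flag {α, γ} - Γ'.g α * Γ'.g γ) at e2
  change Γ'.qDeg Δ α = (Γ'.numVert Δ β - Γ'.g β) * min (Γ'.numVert Δ α)
    (Δ.flag {α, β} - Γ'.g α * Γ'.g β - Γ'.pDeg Δ β) at e3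
  change _ = (Γ'.numVert Δ β - Γ'.g β) * min _ (Δ.flag {β, γ} - Γ'.g β * Γ'.g γ) at e4
  rw [gα, gβ, nα] at e1
  rw [gα, gγ, nα] at e2
  rw [gα, gβ, nα, nβ] at e3
  rw [gβ, gγ, nβ] at e4
  have hfac' : (Γ'.complex Δ).facets = x * y * z + Γ'.pDeg Δ β * Γ'.pDeg Δ γ +
      min x (Γ'.qDeg Δ α) * Γ'.qDeg Δ γ +
      (Γ'.qDeg Δ α - x) * min (Γ'.pDeg Δ γ) (Γ'.qDeg Δ γ) := by
    change (Γ'.complex Δ).facets = Γ'.g α * Γ'.g β * Γ'.g γ + Γ'.pDeg Δ β * Γ'.pDeg Δ γ +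
      min (Γ'.g α) (Γ'.qDeg Δ α) * Γ'.qDeg Δ γ +
      (Γ'.qDeg Δ α - Γ'.g α) * min (Γ'.pDeg Δ γ) (Γ'.qDeg Δ γ) at hfac
    rwa [gα, gβ, gγ] at hfac
  rw [← hn] at e1 e2 e3 e5
  rw [← hm] at e3 e4 e5
  rw [← hP] at e1
  rw [← hS] at e2
  rw [e1, ← hQ] at e3
  rw [← hT] at e4
  rw [e1, e2, e3, e4] at hfac'
  rw [← hfac', ← e5]
  exact ⟨hC.1.2 Γ' hA, fun h => hC.2 Γ' ⟨hA, fun Γ'' h'' => (hC.1.2 Γ'' h'').trans h⟩⟩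

/-- The numbers of vertices and of edges of a member of `𝒜(Δ)` whose extra vertices have the colors
`i` and `k`. -/
theorem exists_numbers (hA : Γ ∈ Δ.classA) {i k r : Fin 3} (hik : i ≠ k)
    (hir : i ≠ r) (hkr : k ≠ r) (hpr : Γ.p ≠ r) (hqr : Γ.q ≠ r) :
    Γ.numVert Δ i = min (Γ.g i + 1) (Δ.flag {i}) ∧ Γ.numVert Δ k = min (Γ.g k + 1) (Δ.flag {k}) ∧
    (Γ.complex Δ).flag {i, k} = min (Δ.flag {i, k}) (Γ.numVert Δ i * Γ.numVert Δ k) ∧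
    (Γ.complex Δ).flag {i, r} = min (Δ.flag {i, r}) (Γ.numVert Δ i * Γ.g r) ∧
    (Γ.complex Δ).flag {k, r} = min (Δ.flag {k, r}) (Γ.numVert Δ k * Γ.g r) := by
  obtain ⟨hpq, -, h1, -⟩ := mem_classA_iff.1 hA
  have hi : i = Γ.p ∨ i = Γ.q := by
    generalize Γ.p = p at *
    generalize Γ.q = q at *
    clear h1
    revert i k r p q; decide
  have hk : k = Γ.p ∨ k = Γ.q := by
    generalize Γ.p = p at *
    generalize Γ.q = q at *
    clear h1
    revert i k r p q; decide
  have hr : Γ.numVert Δ r = Γ.g r := numVert_of_ne hpr hqr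
  refine ⟨numVert_eq_min hi (h1 i), numVert_eq_min hk (h1 k), flag_complex_pair hA hik, ?_, ?_⟩
  · rw [flag_complex_pair hA hir, hr]
  · rw [flag_complex_pair hA hkr, hr]

/-- The numbers that describe a member of `𝒜(Δ)` whose extra vertices have the colors `i` and `k`,
with third color `r`: the flag numbers `f` of `Δ`, the constants `g`, the numbers `n` of vertices
with the extra ones included, and the data of the facets, whose number is `F`. -/
structure FacetNumbers (fi fk fr fik fir fkr gi gk gr ni nk s t u u' ε F : ℕ) : Prop where
  gi_pos : 0 < gi
  gk_pos : 0 < gk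
  gr_pos : 0 < gr
  gi_le : gi ≤ fi
  gk_le : gk ≤ fk
  gr_le : gr ≤ fr
  gik_le : gi * gk ≤ fik
  gir_le : gi * gr ≤ fir
  gkr_le : gk * gr ≤ fkr
  fik_le : fik ≤ fi * fk
  fir_le : fir ≤ fi * fr
  fkr_le : fkr ≤ fk * fr
  ni_eq : ni = min (gi + 1) fi
  nk_eq : nk = min (gk + 1) fk
  s_eq : gi * gr + s = min fir (ni * gr)
  t_eq : gk * gr + t = min fkr (nk * gr)
  u_eq : gi * gk + u + u' + ε = min fik (ni * nk)
  F_eq : F = gi * gk * gr + s * u + t * u' + ε * min s t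
  u_le : u ≤ gk
  u'_le : u' ≤ gi
  ε_le : ε ≤ 1
  full_of_pos : 0 < ε → u = gk ∧ u' = gi
  left_eq_zero : ni = gi → s = 0 ∧ u = 0 ∧ ε = 0
  right_eq_zero : nk = gk → t = 0 ∧ u' = 0 ∧ ε = 0

namespace FacetNumbers

variable {fi fk fr fik fir fkr gi gk gr ni nk s t u u' ε F : ℕ}

theorem symm (h : FacetNumbers fi fk fr fik fir fkr gi gk gr ni nk s t u u' ε F) :
    FacetNumbers fk fi fr fik fkr fir gk gi gr nk ni t s u' u ε F := by
  refine ⟨h.gk_pos, h.gi_pos, h.gr_pos, h.gk_le, h.gi_le, h.gr_le, ?_, h.gkr_le, h.gir_le, ?_,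
    h.fkr_le, h.fir_le, h.nk_eq, h.ni_eq, h.t_eq, h.s_eq, ?_, ?_, h.u'_le, h.u_le, h.ε_le,
    fun h' => (h.full_of_pos h').symm, h.right_eq_zero, h.left_eq_zero⟩
  · rw [mul_comm]; exact h.gik_le
  · rw [mul_comm]; exact h.fik_le
  · rw [mul_comm nk, ← h.u_eq]; ring
  · rw [h.F_eq, min_comm]; ring

theorem ni_cases (h : FacetNumbers fi fk fr fik fir fkr gi gk gr ni nk s t u u' ε F) :
    (ni = gi ∧ fi = gi) ∨ (ni = gi + 1 ∧ gi + 1 ≤ fi) := by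
  have h1 := h.ni_eq
  have h2 := h.gi_le
  omega

theorem nk_cases (h : FacetNumbers fi fk fr fik fir fkr gi gk gr ni nk s t u u' ε F) :
    (nk = gk ∧ fk = gk) ∨ (nk = gk + 1 ∧ gk + 1 ≤ fk) := h.symm.ni_cases

theorem t_le (h : FacetNumbers fi fk fr fik fir fkr gi gk gr ni nk s t u u' ε F) : t ≤ gr := by
  have h1 := h.t_eq
  rcases h.nk_cases with ⟨rfl, -⟩ | ⟨rfl, -⟩
  · omega
  · rw [add_mul, one_mul] at h1; omega

theorem t_eq_mul_min (h : FacetNumbers fi fk fr fik fir fkr gi gk gr ni nk s t u u' ε F) :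
    t = (nk - gk) * min gr (fkr - gk * gr) := by
  have h1 := h.t_eq
  have h2 := h.gkr_le
  rcases h.nk_cases with ⟨rfl, -⟩ | ⟨rfl, -⟩
  · rw [Nat.sub_self, zero_mul]; omega
  · rw [add_mul, one_mul] at h1
    rw [Nat.add_sub_cancel_left, one_mul]; omega

theorem F_le (h : FacetNumbers fi fk fr fik fir fkr gi gk gr ni nk s t u u' ε F) :
    F ≤ gi * gk * gr + s * u + t * (u' + ε) := by
  rw [h.F_eq, mul_add, mul_comm t ε]
  have : ε * min s t ≤ ε * t := Nat.mul_le_mul_left _ (min_le_right _ _)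
  omega

/-- Every edge between the colors of the extra vertices lies in at most `gr` facets. -/
theorem F_le_mul (h : FacetNumbers fi fk fr fik fir fkr gi gk gr ni nk s t u u' ε F) :
    F ≤ fik * gr := by
  have h1 := h.u_eq
  have h2 := h.F_le
  have h3 := Nat.mul_le_mul_right u h.symm.t_le
  have h4 := Nat.mul_le_mul_right (u' + ε) h.t_le
  have h5 : gi * gk + u + (u' + ε) ≤ fik := by omega
  have h6 := Nat.mul_le_mul_right gr h5
  nlinarith

/-- Replacing an extra vertex of color `i` that is joined to all vertices of color `r` by a vertex
that is joined to all vertices of color `k`, too, does not lose facets. -/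
theorem F_le_of_s_eq (h : FacetNumbers fi fk fr fik fir fkr gi gk gr ni nk s t u u' ε F)
    (hs : s = gr) (hc : (gi + 1) * gk ≤ fik) :
    F ≤ gk * gr * (gi + 1) + t * ((nk - gk) * min (gi + 1) (fik - gk * (gi + 1))) := by
  subst hs
  have hF := h.F_le
  have ht := h.t_le
  have hu := h.u_eq
  obtain ⟨d, hd⟩ := Nat.exists_eq_add_of_le h.u_le
  have e1 : gk * (gi + 1) = gi * gk + gk := by ring
  have e2 : (gi + 1) * gk = gi * gk + gk := by ring
  rcases h.nk_cases with ⟨rfl, -⟩ | ⟨rfl, -⟩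
  · obtain ⟨rfl, rfl, rfl⟩ := h.right_eq_zero rfl
    nlinarith
  · rw [Nat.add_sub_cancel_left, one_mul]
    have h1 : u' + ε ≤ min (gi + 1) (fik - gk * (gi + 1)) + d := by
      have := h.u'_le
      have := h.ε_le
      omega
    generalize min (gi + 1) (fik - gk * (gi + 1)) = S at *
    have h2 := Nat.mul_le_mul_left t h1
    have h3 := Nat.mul_le_mul_right d ht
    nlinarith

end FacetNumbers

/-- The numbers that describe a member of `𝒞(Δ)`, which cannot be improved by any choice of the
colors of the extra vertices.  Each of the additional fields is named after an order of the colors,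
those of the extra vertices first. -/
structure MaximalNumbers (fi fk fr fik fir fkr gi gk gr ni nk s t u u' ε F : ℕ) : Prop
    extends FacetNumbers fi fk fr fik fir fkr gi gk gr ni nk s t u u' ε F where
  ikr : NotImprovable F (gi * gk + u + u' + ε + (gi * gr + s) + (gk * gr + t)) fi fk fr fik fir fkr
  irk : NotImprovable F (gi * gk + u + u' + ε + (gi * gr + s) + (gk * gr + t)) fi fr fk fir fik fkr
  kir : NotImprovable F (gi * gk + u + u' + ε + (gi * gr + s) + (gk * gr + t)) fk fi fr fik fkr fir
  kri : NotImprovable F (gi * gk + u + u' + ε + (gi * gr + s) + (gk * gr + t)) fk fr fi fkr fik fir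
  rik : NotImprovable F (gi * gk + u + u' + ε + (gi * gr + s) + (gk * gr + t)) fr fi fk fir fkr fik
  rki : NotImprovable F (gi * gk + u + u' + ε + (gi * gr + s) + (gk * gr + t)) fr fk fi fkr fir fik

namespace MaximalNumbers

variable {fi fk fr fik fir fkr gi gk gr ni nk s t u u' ε F : ℕ}

theorem symm (h : MaximalNumbers fi fk fr fik fir fkr gi gk gr ni nk s t u u' ε F) :
    MaximalNumbers fk fi fr fik fkr fir gk gi gr nk ni t s u' u ε F := by
  have e : gk * gi + u' + u + ε + (gk * gr + t) + (gi * gr + s) =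
      gi * gk + u + u' + ε + (gi * gr + s) + (gk * gr + t) := by ring
  refine ⟨h.toFacetNumbers.symm, ?_, ?_, ?_, ?_, ?_, ?_⟩ <;> rw [e]
  exacts [h.kir, h.kri, h.ikr, h.irk, h.rki, h.rik]

/-- The case in which there is no room for an extra vertex of color `i`. If edges of color `ir`
were unused, then there would be room for an extra vertex of color `r`, and with extra vertices of
the colors `k` and `r` instead there would be at least as many facets and more edges. -/
theorem fir_eq_of_no_room (h : MaximalNumbers fi fk fr fik fir fkr gi gk gr ni nk s t u u' ε F)
    (hi : ni = gi) (hfi : fi = gi) : gi * gr + s = fir := by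
  by_contra hne
  subst hi
  obtain ⟨rfl, rfl, rfl⟩ := h.left_eq_zero rfl
  have hs := h.s_eq
  have ht := h.t_eq
  have hu := h.u_eq
  have hF := h.F_eq
  have hlt : ni * gr < fir := by omega
  have hr : gr < fr := Nat.lt_of_mul_lt_mul_left (hlt.trans_le (hfi ▸ h.fir_le))
  have hS : u' = (nk - gk) * min ni (fik - gk * ni) := by
    have := h.gik_le
    rw [mul_comm gk]
    rcases h.nk_cases with ⟨rfl, -⟩ | ⟨rfl, -⟩
    · rw [Nat.sub_self, zero_mul]; omega
    · rw [mul_add, mul_one] at hu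
      rw [Nat.add_sub_cancel_left, one_mul]; omega
  obtain ⟨-, h2⟩ := h.kri gk gr ni nk (gr + 1) t u' _ _ h.gk_pos h.gr_pos h.gi_pos h.gk_le h.gr_le
    h.gi_le h.gkr_le (by rw [mul_comm]; exact h.gik_le) (by rw [mul_comm]; exact h.gir_le)
    h.nk_eq (by omega) h.t_eq_mul_min hS rfl rfl
  have h3 := h2 (by rw [hF, show gk * gr * ni = ni * gk * gr by ring]; omega)
  have h4 : nk * (gr + 1) = nk * gr + nk := by ring
  have h5 : (gr + 1) * ni = ni * gr + ni := by ring
  have h6 : nk * ni = ni * nk := by ring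
  have h7 := h.gi_pos
  rw [h4, h5, h6] at h3
  omega

/-- The case in which the extra vertex of color `i` can be joined to all `g_k` vertices of color
`k`. If edges of color `ir` were unused, then this vertex would also be joined to all vertices of
color `r` and could be counted in `g_i`. This makes room for another extra vertex, of color `i` if
possible and of color `r` otherwise, which uses more edges. -/
theorem fir_eq_of_le (h : MaximalNumbers fi fk fr fik fir fkr gi gk gr ni nk s t u u' ε F)
    (hi : ni = gi + 1) (hfi : gi + 1 ≤ fi) (hc : (gi + 1) * gk ≤ fik) : gi * gr + s = fir := by
  by_contra hne
  have hs := h.s_eq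
  have e0 : ni * gr = gi * gr + gr := by rw [hi]; ring
  rw [e0] at hs
  have hsr : s = gr := by omega
  have hlt : gi * gr + gr < fir := by omega
  have hF := h.F_le_of_s_eq hsr hc
  have ht := h.t_eq
  have hu := h.u_eq
  have hgi := h.gi_pos
  have hgr := h.gr_pos
  rw [hi] at hu
  rcases Nat.lt_or_ge (gi + 1) fi with hfi' | hfi'
  · obtain ⟨-, h2⟩ := h.kir gk (gi + 1) gr nk (gi + 2) _ t _ _ h.gk_pos (by omega) h.gr_pos
      h.gk_le hfi h.gr_le (by rw [mul_comm]; exact hc) h.gkr_le (by rw [add_mul, one_mul]; omega)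
      h.nk_eq (by omega) rfl h.t_eq_mul_min rfl rfl
    have h3 := h2 (by
      rw [mul_comm t] at hF
      rw [show gk * (gi + 1) * gr = gk * gr * (gi + 1) by ring]; omega)
    have h4 : nk * (gi + 2) = (gi + 1) * nk + nk := by ring
    have h5 : (gi + 2) * gr = gi * gr + gr + gr := by ring
    rw [h4, h5] at h3
    omega
  · have hr : gr < fr := by
      have : (gi + 1) * gr < (gi + 1) * fr := by
        rw [add_mul, one_mul]
        exact hlt.trans_le ((show fi = gi + 1 by omega) ▸ h.fir_le)
      exact Nat.lt_of_mul_lt_mul_left this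
    obtain ⟨-, h2⟩ := h.kri gk gr (gi + 1) nk (gr + 1) t _ _ _ h.gk_pos h.gr_pos (by omega) h.gk_le
      h.gr_le hfi h.gkr_le (by rw [mul_comm]; exact hc) (by rw [mul_comm, add_mul, one_mul]; omega)
      h.nk_eq (by omega) h.t_eq_mul_min rfl rfl rfl
    have h3 := h2 (by omega)
    have h4 : nk * (gr + 1) = nk * gr + nk := by ring
    have h5 : (gr + 1) * (gi + 1) = gi * gr + gr + gi + 1 := by ring
    rw [h4, h5, mul_comm nk (gi + 1)] at h3
    omega

/-- The case in which the edges of color `ik` do not suffice for joining the extra vertex of color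
`i` to all `g_k` vertices of color `k`. If edges of color `ir` were unused, then extra vertices of
the colors `i` and `r` would give at least as many facets and use more edges, unless there were no
room for an extra vertex of color `r`; but then every edge of color `ik` would lie in a facet with
each vertex of color `r`. -/
theorem fir_eq_of_lt (h : MaximalNumbers fi fk fr fik fir fkr gi gk gr ni nk s t u u' ε F)
    (hi : ni = gi + 1) (hc : fik < (gi + 1) * gk) (hD : F < fr * fik) :
    gi * gr + s = fir := by
  by_contra hne
  have hs := h.s_eq
  have e0 : ni * gr = gi * gr + gr := by rw [hi]; ring
  rw [e0] at hs
  have hlt : gi * gr + gr < fir := by omega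
  have ht := h.t_eq
  have hu := h.u_eq
  have hgi := h.gi_pos
  have hgk := h.gk_pos
  have hgr := h.gr_pos
  have hgik := h.gik_le
  have hgkr := h.gkr_le
  have hF := h.F_le_mul
  rw [add_mul, one_mul] at hc
  have e1 : gi * gk * gr + (fik - gi * gk) * gr = fik * gr := by
    rw [← add_mul, Nat.add_sub_cancel' hgik]
  have hn : ni - gi = 1 := by omega
  have hP : fik - gi * gk = (ni - gi) * min gk (fik - gi * gk) := by rw [hn]; omega
  have hS : gr = (ni - gi) * min gr (fir - gi * gr) := by rw [hn]; omega
  have hr : gr < fr := by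
    obtain ⟨h1, -⟩ := h.ikr gi gk gr ni nk _ _ _ _ h.gi_pos h.gk_pos h.gr_pos h.gi_le h.gk_le
      h.gr_le h.gik_le h.gir_le h.gkr_le h.ni_eq h.nk_eq hP hS rfl rfl
    by_contra hr
    have : fr = gr := by have := h.gr_le; omega
    rw [this, mul_comm] at hD
    omega
  obtain ⟨h1, h2⟩ := h.irk gi gr gk ni (gr + 1) gr (fik - gi * gk) (min ni (fir - gi * gr - gr))
    (min gk (fkr - gr * gk)) h.gi_pos h.gr_pos h.gk_pos
    h.gi_le h.gr_le h.gk_le h.gir_le h.gik_le (by rw [mul_comm]; exact hgkr) h.ni_eq (by omega)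
    hS hP (by simp) (by simp)
  have e2 : gi * gr * gk + gr * (fik - gi * gk) = fik * gr := by rw [← e1]; ring
  rw [e2] at h1 h2
  have hQ : 0 < min gi (min ni (fir - gi * gr - gr)) := by omega
  have hT : min gk (fkr - gr * gk) = 0 := by
    by_contra hT
    have := Nat.mul_pos hQ (Nat.pos_of_ne_zero hT)
    omega
  have h3 := h2 (by omega)
  have h4 : ni * (gr + 1) = gi * gr + gr + ni := by rw [hi]; ring
  have h5 : (gr + 1) * gk = gk * gr + gk := by ring
  have h6 : ni * gk = gi * gk + gk := by rw [hi]; ring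
  rw [h4, h5, h6] at h3
  rw [mul_comm gr] at hT
  omega

/-- All edges between the color `i` of an extra vertex and the third color `r` are used. -/
theorem fir_eq (h : MaximalNumbers fi fk fr fik fir fkr gi gk gr ni nk s t u u' ε F)
    (hD : F < fr * fik) : gi * gr + s = fir := by
  rcases h.ni_cases with ⟨h1, h2⟩ | ⟨h1, h2⟩
  · exact h.fir_eq_of_no_room h1 h2
  · rcases Nat.lt_or_ge fik ((gi + 1) * gk) with h3 | h3
    · exact h.fir_eq_of_lt h1 h3 hD
    · exact h.fir_eq_of_le h1 h2 h3

end MaximalNumbers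

end Params

/-! ### Members of `𝒟(Δ)` use all edges -/

namespace Params

variable {V : Type*} {Γ : Params} {Δ : ColoredComplex V}

namespace MaximalNumbers

variable {fi fk fr fik fir fkr gi gk gr ni nk s t u u' ε F : ℕ}

/-- With an extra vertex of color `i` only, unused edges of color `ik` would mean that every edge
of color `ir` lies in a facet with each vertex of color `k`. -/
theorem fik_eq_of_one_room (h : MaximalNumbers fi fk fr fik fir fkr gi gk gr ni nk s t u u' ε F)
    (hi : ni = gi + 1) (hk : nk = gk) (hfk : fk = gk) (hir : gi * gr + s = fir)
    (hD : F < fk * fir) : gi * gk + u + u' + ε = fik := by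
  by_contra hne
  obtain ⟨rfl, rfl, rfl⟩ := h.right_eq_zero hk
  have hu := h.u_eq
  have hul := h.u_le
  have hF := h.F_eq
  rw [hi, hk, add_mul, one_mul] at hu
  have : u = gk := by omega
  subst hir hfk this
  have : F = u * (gi * gr + s) := by rw [hF]; ring
  omega

/-- If edges of color `ik` are unused and the extra vertex of color `i` is joined to all vertices
of color `r`, then it can be counted in `g_i`. With another extra vertex of color `i` there are
more edges; if there is no room for one, then every edge of color `kr` lies in a facet with each
vertex of color `i`. -/
theorem false_of_s_eq (h : MaximalNumbers fi fk fr fik fir fkr gi gk gr ni nk s t u u' ε F)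
    (hi : ni = gi + 1) (hk : nk = gk + 1) (hlt : (gi + 1) * (gk + 1) < fik)
    (hF : F = gi * gk * gr + s * gk + t * gi + min s t) (hir : gi * gr + s = fir)
    (hkr : gk * gr + t = fkr) (hs : s = gr) (hfi : gi + 1 ≤ fi) (hD : F < fi * fkr) : False := by
  have ht := h.t_le
  have hu := h.u_eq
  have e1 : ni * nk = (gi + 1) * (gk + 1) := by rw [hi, hk]
  rw [min_eq_right (by omega)] at hF
  subst hs
  have hF' : F = (gi + 1) * (gk * s + t) := by rw [hF]; ring
  rcases Nat.lt_or_ge (gi + 1) fi with hfi' | hfi'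
  · have e2 : gk * (gi + 1) + (gi + 1) = (gi + 1) * (gk + 1) := by ring
    have e3 : (gi + 1) * s = gi * s + s := by ring
    have e4 : (gi + 2) * s = gi * s + s + s := by ring
    obtain ⟨-, h2⟩ := h.kir gk (gi + 1) s nk (gi + 2) (gi + 1) t _ _ h.gk_pos (by omega) h.gr_pos
      h.gk_le hfi h.gr_le (by omega) h.gkr_le (by omega) h.nk_eq (by omega)
      (by rw [hk, Nat.add_sub_cancel_left, one_mul]; omega) h.t_eq_mul_min rfl rfl
    have e5 : gk * (gi + 1) * s + (gi + 1) * t = F := by rw [hF']; ring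
    have h3 := h2 (by rw [e5]; omega)
    have e6 : nk * (gi + 2) = (gi + 1) * (gk + 1) + gk + 1 := by rw [hk]; ring
    have e7 := h.t_eq
    rw [e6, e4] at h3
    omega
  · rw [show fi = gi + 1 by omega, ← hkr] at hD
    omega

/-- Taking away one vertex of color `r` frees `g_i + g_k` edges.  If the two extra vertices can take
up all of these, then facets are gained. -/
theorem false_of_no_overflow {c : ℕ}
    (h : MaximalNumbers fi fk fr fik fir fkr gi gk (c + 1) ni nk s t u u' ε F) (hc : 0 < c)
    (hi : ni = gi + 1) (hk : nk = gk + 1) (hlt : (gi + 1) * (gk + 1) < fik)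
    (hF : F = gi * gk * (c + 1) + s * gk + t * gi + min s t) (hir : gi * (c + 1) + s = fir)
    (hkr : gk * (c + 1) + t = fkr) (hs : s + gi ≤ c) (ht : t + gk ≤ c) : False := by
  have e1 : (gi + 1) * (gk + 1) = gi * gk + gi + gk + 1 := by ring
  have e2 : gi * (c + 1) = gi * c + gi := by ring
  have e3 : gk * (c + 1) = gk * c + gk := by ring
  have hfr := h.gr_le
  have hgi := h.gi_pos
  have hgk := h.gk_pos
  obtain ⟨h1, -⟩ := h.ikr gi gk c ni nk gk (s + gi) (gi + 1) (t + gk) h.gi_pos h.gk_pos hc h.gi_le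
    h.gk_le (by omega) h.gik_le (by omega) (by omega) h.ni_eq h.nk_eq
    (by rw [hi, Nat.add_sub_cancel_left, one_mul]; omega)
    (by rw [hi, Nat.add_sub_cancel_left, one_mul]; omega)
    (by rw [hi, hk, Nat.add_sub_cancel_left, one_mul]; omega)
    (by rw [hk, Nat.add_sub_cancel_left, one_mul]; omega)
  rw [min_eq_left (by omega), Nat.add_sub_cancel_left, one_mul] at h1
  have e4 : gi * gk * c + gk * (s + gi) + gi * (t + gk) =
      gi * gk * (c + 1) + s * gk + t * gi + gi * gk := by ring
  omega

/-- If only the extra vertex of color `k` can take up the edges of a vertex of color `r` that is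
taken away, then the extra vertex of color `i` is now joined to all other vertices of color `r` and
can be counted in `g_i`. The vertex taken away returns as an extra one, and facets are gained. -/
theorem false_of_one_overflow {c : ℕ}
    (h : MaximalNumbers fi fk fr fik fir fkr gi gk (c + 1) ni nk s t u u' ε F) (hc : 0 < c)
    (hk : nk = gk + 1) (hfi : gi + 1 ≤ fi) (hlt : (gi + 1) * (gk + 1) < fik)
    (hF : F = gi * gk * (c + 1) + s * gk + t * gi + min s t) (hir : gi * (c + 1) + s = fir)
    (hkr : gk * (c + 1) + t = fkr) (hsc : s ≤ c) (hs : c < s + gi) (ht : t + gk ≤ c) : False := by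
  have e1 : (gi + 1) * (gk + 1) = gi * gk + gi + gk + 1 := by ring
  have e2 : gi * (c + 1) = gi * c + gi := by ring
  have e3 : gk * (c + 1) = gk * c + gk := by ring
  have e4 : gk * (gi + 1) = gi * gk + gk := by ring
  have e5 : c * (gi + 1) = gi * c + c := by ring
  have hfr := h.gr_le
  have hgk := h.gk_pos
  obtain ⟨h1, -⟩ := h.kri gk c (gi + 1) nk (c + 1) (t + gk) (gi + 1) _ _ h.gk_pos hc (by omega)
    h.gk_le (by omega) hfi (by omega) (by omega) (by omega) h.nk_eq (by omega)
    (by rw [hk, Nat.add_sub_cancel_left, one_mul]; omega)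
    (by rw [hk, Nat.add_sub_cancel_left, one_mul]; omega) rfl rfl
  have e6 : gk * c * (gi + 1) + (t + gk) * (gi + 1) =
      gi * gk * (c + 1) + (c + 1) * gk + t * gi + t := by ring
  have e7 : (s + 1) * gk ≤ (c + 1) * gk := Nat.mul_le_mul_right _ (by omega)
  rw [add_mul, one_mul] at e7
  omega

/-- If neither of the two extra vertices can take up the edges of a vertex of color `r` that is
taken away, then both can be counted in `g_i` and `g_k`. With extra vertices of the colors `r` and
`i`, there are at least as many facets and more edges. -/
theorem false_of_two_overflows {c : ℕ}
    (h : MaximalNumbers fi fk fr fik fir fkr gi gk (c + 1) ni nk s t u u' ε F) (hc : 0 < c)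
    (hi : ni = gi + 1) (hk : nk = gk + 1) (hfi : gi + 2 ≤ fi) (hlt : (gi + 1) * (gk + 1) < fik)
    (hF : F = gi * gk * (c + 1) + s * gk + t * gi + min s t) (hir : gi * (c + 1) + s = fir)
    (hkr : gk * (c + 1) + t = fkr) (hsc : s ≤ c) (htc : t ≤ c) (hs : c < s + gi) (ht : c < t + gk) :
    False := by
  have e1 : (gi + 1) * (gk + 1) = gi * gk + gi + gk + 1 := by ring
  have e2 : gi * (c + 1) = gi * c + gi := by ring
  have e3 : gk * (c + 1) = gk * c + gk := by ring
  have e4 : c * (gk + 1) = gk * c + c := by ring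
  have e5 : c * (gi + 1) = gi * c + c := by ring
  have hfr := h.gr_le
  have hk' := h.nk_eq
  have hgk := h.gk_pos
  obtain ⟨σ, hσ⟩ := Nat.exists_eq_add_of_le hs.le
  obtain ⟨τ, hτ⟩ := Nat.exists_eq_add_of_le ht.le
  obtain ⟨h1, h2⟩ := h.rik c (gi + 1) (gk + 1) (c + 1) (gi + 2) σ τ _ _ hc (by omega) (by omega)
    (by omega) (by omega) (by omega) (by omega) (by omega) hlt.le (by omega) (by omega)
    (by rw [Nat.add_sub_cancel_left, one_mul]; omega)
    (by rw [Nat.add_sub_cancel_left, one_mul]; omega) rfl rfl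
  have key : F ≤ c * (gi + 1) * (gk + 1) + σ * τ := by
    obtain ⟨S, hS⟩ := Nat.exists_eq_add_of_le hsc
    obtain ⟨T, hT⟩ := Nat.exists_eq_add_of_le htc
    have key : c * (gi + 1) * (gk + 1) + σ * τ =
        gi * gk * (c + 1) + s * gk + t * gi + c + S * T := by
      have a1 : (s : ℤ) = c - S := by omega
      have a2 : (t : ℤ) = c - T := by omega
      have a3 : (σ : ℤ) = gi - S := by omega
      have a4 : (τ : ℤ) = gk - T := by omega
      zify
      rw [a1, a2, a3, a4]
      ring
    omega
  have h3 := h2 (by omega)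
  have e6 : (c + 1) * (gi + 2) = gi * c + gi + c + 1 + c + 1 := by ring
  have e7 : (c + 1) * (gk + 1) = gk * c + gk + c + 1 := by ring
  have e8 : (gi + 2) * (gk + 1) = (gi + 1) * (gk + 1) + gk + 1 := by ring
  have e9 := h.u_eq
  rw [hi, hk] at e9
  rw [e6, e7, e8] at h3
  omega

/-- All edges between the colors of the two extra vertices are used.  Otherwise both extra vertices
are joined to all vertices of the color of the other one, so that only the numbers `s` and `t` of
their neighbors of color `r` are left to distinguish cases.  The hypothesis `fik ≤ fkr` excludes
`gr = 1`, where no vertex of color `r` can be taken away. -/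
theorem fik_eq (h : MaximalNumbers fi fk fr fik fir fkr gi gk gr ni nk s t u u' ε F)
    (hir : gi * gr + s = fir) (hkr : gk * gr + t = fkr) (hDi : F < fi * fkr) (hDk : F < fk * fir)
    (hle : fik ≤ fkr) : gi * gk + u + u' + ε = fik := by
  by_contra hne
  have hu := h.u_eq
  have hul := h.u_le
  have hul' := h.u'_le
  have hε := h.ε_le
  have hgi := h.gi_pos
  have hgk := h.gk_pos
  have hgr := h.gr_pos
  rcases h.ni_cases with ⟨hi, hfi⟩ | ⟨hi, hfi⟩ <;> rcases h.nk_cases with ⟨hk, hfk⟩ | ⟨hk, hfk⟩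
  · have := h.fik_le
    rw [hfi, hfk] at this
    rw [hi, hk] at hu
    omega
  · refine hne ?_
    rw [← h.symm.fik_eq_of_one_room hk hi hfi hkr hDi]; ring
  · exact hne (h.fik_eq_of_one_room hi hk hfk hir hDk)
  · have e1 : ni * nk = gi * gk + gi + gk + 1 := by rw [hi, hk]; ring
    have e2 : (gi + 1) * (gk + 1) = gi * gk + gi + gk + 1 := by ring
    have e3 : (gk + 1) * (gi + 1) = gi * gk + gi + gk + 1 := by ring
    have hF := h.F_eq
    rw [show u = gk by omega, show u' = gi by omega, show ε = 1 by omega, one_mul] at hF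
    have hF' : F = gk * gi * gr + t * gi + s * gk + min t s := by rw [hF, min_comm]; ring
    have hsr := h.symm.t_le
    have htr := h.t_le
    rcases Nat.lt_or_ge s gr with hs | hs
    · rcases Nat.lt_or_ge t gr with ht | ht
      · obtain ⟨c, rfl⟩ : ∃ c, gr = c + 1 := ⟨gr - 1, by omega⟩
        have hc : 0 < c := by
          by_contra hc
          obtain rfl : c = 0 := by omega
          have : gk ≤ gi * gk := Nat.le_mul_of_pos_left _ hgi
          omega
        rcases Nat.lt_or_ge c (s + gi) with hs' | hs' <;>
          rcases Nat.lt_or_ge c (t + gk) with ht' | ht'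
        · rcases Nat.lt_or_ge (gi + 1) fi with hfi' | hfi'
          · exact h.false_of_two_overflows hc hi hk hfi' (by omega) hF hir hkr (by omega) (by omega)
              hs' ht'
          · have hfk' : gk + 2 ≤ fk := by
              by_contra hfk'
              have := h.fik_le
              rw [show fi = gi + 1 by omega, show fk = gk + 1 by omega] at this
              omega
            exact h.symm.false_of_two_overflows hc hk hi hfk' (by omega) hF' hkr hir (by omega)
              (by omega) ht' hs'
        · exact h.false_of_one_overflow hc hk hfi (by omega) hF hir hkr (by omega) hs' ht'
        · exact h.symm.false_of_one_overflow hc hi hfk (by omega) hF' hkr hir (by omega) ht' hs'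
        · exact h.false_of_no_overflow hc hi hk (by omega) hF hir hkr hs' ht'
      · exact h.symm.false_of_s_eq hk hi (by omega) hF' hkr hir (by omega) hfk hDk
    · exact h.false_of_s_eq hi hk (by omega) hF hir hkr (by omega) hfi hDi

end MaximalNumbers

theorem exists_facetNumbers (hA : Γ ∈ Δ.classA) {i k r : Fin 3} (hik : i ≠ k)
    (hir : i ≠ r) (hkr : k ≠ r) (hpr : Γ.p ≠ r) (hqr : Γ.q ≠ r) :
    ∃ s t u u' ε, (Γ.complex Δ).flag {i, r} = Γ.g i * Γ.g r + s ∧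
      (Γ.complex Δ).flag {k, r} = Γ.g k * Γ.g r + t ∧ IsFacetData Γ Δ i k r s t u u' ε ∧
      FacetNumbers (Δ.flag {i}) (Δ.flag {k}) (Δ.flag {r}) (Δ.flag {i, k}) (Δ.flag {i, r})
        (Δ.flag {k, r}) (Γ.g i) (Γ.g k) (Γ.g r) (Γ.numVert Δ i) (Γ.numVert Δ k) s t u u' ε
        (Γ.complex Δ).facets := by
  obtain ⟨hpq, hpos, h1, h2⟩ := mem_classA_iff.1 hA
  obtain ⟨hni, hnk, Fik, Fir, Fkr⟩ := exists_numbers hA hik hir hkr hpr hqr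
  obtain ⟨s, hs⟩ := Nat.exists_eq_add_of_le (mul_le_flag_complex_pair (Δ := Δ) hpq i r hir)
  obtain ⟨t, ht⟩ := Nat.exists_eq_add_of_le (mul_le_flag_complex_pair (Δ := Δ) hpq k r hkr)
  obtain ⟨u, u', ε, data⟩ := exists_isFacetData hA hik hpr hqr hir hkr hs ht
  exact ⟨s, t, u, u', ε, hs, ht, data, hpos i, hpos k, hpos r, h1 i, h1 k, h1 r,
    h2 i k hik, h2 i r hir, h2 k r hkr, Δ.flag_pair_le i k, Δ.flag_pair_le i r, Δ.flag_pair_le k r,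
    hni, hnk, by rw [← hs, Fir], by rw [← ht, Fkr], by rw [← data.flag_eq, Fik], data.facets_eq,
    data.u_le, data.u'_le, data.ε_le, data.full_of_pos, data.left_eq_zero, data.right_eq_zero⟩

theorem exists_maximalNumbers (hC : Γ ∈ Δ.classC) {i k r : Fin 3} (hik : i ≠ k)
    (hir : i ≠ r) (hkr : k ≠ r) (hpr : Γ.p ≠ r) (hqr : Γ.q ≠ r) :
    ∃ s t u u' ε, (Γ.complex Δ).flag {i, r} = Γ.g i * Γ.g r + s ∧
      (Γ.complex Δ).flag {k, r} = Γ.g k * Γ.g r + t ∧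
      (Γ.complex Δ).flag {i, k} = Γ.g i * Γ.g k + u + u' + ε ∧
      MaximalNumbers (Δ.flag {i}) (Δ.flag {k}) (Δ.flag {r}) (Δ.flag {i, k}) (Δ.flag {i, r})
        (Δ.flag {k, r}) (Γ.g i) (Γ.g k) (Γ.g r) (Γ.numVert Δ i) (Γ.numVert Δ k) s t u u' ε
        (Γ.complex Δ).facets := by
  obtain ⟨s, t, u, u', ε, hs, ht, data, h⟩ := exists_facetNumbers hC.1.1 hik hir hkr hpr hqr
  have hE := edges_eq (Γ.complex Δ) hik hir hkr
  have eik := Finset.pair_comm k i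
  have eir := Finset.pair_comm r i
  have ekr := Finset.pair_comm r k
  have c1 := notImprovable_of_mem_classC hC hik hir hkr
  have c2 := notImprovable_of_mem_classC hC hir hik hkr.symm
  have c3 := notImprovable_of_mem_classC hC hik.symm hkr hir
  have c4 := notImprovable_of_mem_classC hC hkr hik.symm hir.symm
  have c5 := notImprovable_of_mem_classC hC hir.symm hkr.symm hik
  have c6 := notImprovable_of_mem_classC hC hkr.symm hir.symm hik.symm
  rw [hE, data.flag_eq, hs, ht] at c1 c2 c3 c4 c5 c6
  rw [ekr] at c2
  rw [eik] at c3
  rw [eik, eir] at c4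
  rw [eir, ekr] at c5
  rw [ekr, eir, eik] at c6
  exact ⟨s, t, u, u', ε, hs, ht, data.flag_eq, h, c1, c2, c3, c4, c5, c6⟩

/-- A member of `𝒟(Δ)` has as many edges of each color set as `Δ`, provided that the edges of color
`kr` are at least as many as those of color `ik`. -/
theorem flag_eq_of_mem_classD (hD : Γ ∈ Δ.classD) {i k r : Fin 3} (hik : i ≠ k)
    (hir : i ≠ r) (hkr : k ≠ r) (hr : Γ.r = r) (hle : Δ.flag {i, k} ≤ Δ.flag {k, r}) :
    ∀ a b, a ≠ b → (Γ.complex Δ).flag {a, b} = Δ.flag {a, b} := by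
  obtain ⟨hpr, hqr⟩ := ne_r hD.1.1.1.1
  rw [hr] at hpr hqr
  obtain ⟨s, t, u, u', ε, hs, ht, hu, h⟩ :=
    exists_maximalNumbers hD.1 hik hir hkr hpr hqr
  have key : ∀ a b c : Fin 3, a ≠ b → a ≠ c → b ≠ c →
      (Γ.complex Δ).facets < Δ.flag {a} * Δ.flag {b, c} := by
    have h0 := hD.2
    simp only [lt_min_iff] at h0
    have e1 := Finset.pair_comm (1 : Fin 3) 0
    have e2 := Finset.pair_comm (2 : Fin 3) 0
    have e3 := Finset.pair_comm (2 : Fin 3) 1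
    intro a b c hab hac hbc
    fin_cases a <;> fin_cases b <;> fin_cases c <;>
      first
        | exact absurd rfl hab
        | exact absurd rfl hac
        | exact absurd rfl hbc
        | (simp only [Fin.zero_eta, Fin.mk_one, Fin.reduceFinMk, e1, e2, e3]; tauto)
  have k1 := h.fir_eq (key r i k hir.symm hkr.symm hik)
  have k2 := h.symm.fir_eq (key r i k hir.symm hkr.symm hik)
  have k3 := h.fik_eq k1 k2 (key i k r hik hir hkr) (key k i r hik.symm hkr hir) hle
  refine forall_pair (fun a b h => by rwa [Finset.pair_comm]) hik hir hkr ?_ ?_ ?_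
  · rw [hu, k3]
  · rw [hs, k1]
  · rw [ht, k2]

end Params

/-! ### The prescribed complex has the most facets -/

namespace Params

variable {V : Type*} {Γ : Params} {Δ : ColoredComplex V}

theorem mul_add_mul_le_of_le {s t u v w w' : ℕ} (hts : t ≤ s) (huv : u ≤ v) (h : u + w = v + w') :
    s * u + t * w ≤ s * v + t * w' := by
  obtain ⟨d, rfl⟩ := Nat.exists_eq_add_of_le huv
  obtain rfl : w = w' + d := by omega
  have := Nat.mul_le_mul_right d hts
  nlinarith

namespace FacetNumbers

variable {fi fk fr fik fir fkr gi gk gr ni nk s t u u' ε F a b na nb s' t' v v' δ F' : ℕ}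

/-- With the same constants `g`, it is best to give as many edges of color `ik` as possible to the
extra vertex with more neighbors of color `r`. -/
theorem facets_le_of_eq (h : FacetNumbers fi fk fr fik fir fkr gi gk gr ni nk s t u u' ε F)
    (h' : FacetNumbers fi fk fr fik fir fkr gi gk gr na nb s t v v' δ F')
    (hu : gi * gk + u + u' + ε = fik) (hv : gi * gk + v + v' + δ = fik)
    (hi : t < s → na = gi + 1 → v = gk ∨ (v' = 0 ∧ δ = 0)) (hts : t ≤ s) : F ≤ F' := by
  rw [h.F_eq, h'.F_eq, min_eq_right hts]
  have key : s * u + t * (u' + ε) ≤ s * v + t * (v' + δ) := by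
    rcases hts.lt_or_eq with hlt | rfl
    · refine mul_add_mul_le_of_le hts ?_ (by omega)
      rcases h'.ni_cases with ⟨h1, -⟩ | ⟨h1, -⟩
      · have := (h'.left_eq_zero h1).1
        omega
      · have := h.u_le
        rcases hi hlt h1 with h2 | ⟨h2, h3⟩ <;> omega
    · rw [← mul_add, ← mul_add]
      exact Nat.mul_le_mul_left _ (by omega)
  nlinarith

/-- An extra vertex of color `i` that is joined to all vertices of color `r` is better counted in
`g_i`. -/
theorem facets_le_of_succ_left (h : FacetNumbers fi fk fr fik fir fkr gi gk gr ni nk s t u u' ε F)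
    (h' : FacetNumbers fi fk fr fik fir fkr (gi + 1) gk gr na nb 0 t v v' δ F')
    (hs : s = gr) (hv : (gi + 1) * gk + v + v' + δ = fik)
    (hk : 0 < t → nb = gk + 1 → v' = gi + 1 ∨ (v = 0 ∧ δ = 0)) : F ≤ F' := by
  refine (h.F_le_of_s_eq hs (by omega)).trans ?_
  rw [h'.F_eq, zero_mul, Nat.zero_min, mul_zero, add_zero, add_zero]
  have e1 : gk * gr * (gi + 1) = (gi + 1) * gk * gr := by ring
  rw [e1]
  refine Nat.add_le_add_left (?_ : _ ≤ t * v') _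
  rcases Nat.eq_zero_or_pos t with rfl | ht
  · simp
  · refine Nat.mul_le_mul_left _ ?_
    rcases h'.nk_cases with ⟨h1, -⟩ | ⟨h1, hb⟩
    · have := (h'.right_eq_zero h1).1
      omega
    · have h2 := h.nk_eq
      rw [show nk = gk + 1 by omega, Nat.add_sub_cancel_left, one_mul, mul_comm gk]
      rcases hk ht h1 with h2 | ⟨h2, h3⟩ <;> omega

/-- Comparison of two complexes with the same number of vertices of the third color `r`, such that
both use all edges and that the first extra vertex of the second one is the one with more neighbors
of color `r`. By `ha` and `hb`, the constants `a`, `b` of the second complex arise from those of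
the first one by counting an extra vertex that is joined to all vertices of color `r` in `g_i` or
`g_k`; the last alternative of `hb` covers the case that this leaves too few edges of color `ik`
for all `g_k` vertices of color `k`, of which one becomes an extra vertex. -/
theorem facets_le (h : FacetNumbers fi fk fr fik fir fkr gi gk gr ni nk s t u u' ε F)
    (h' : FacetNumbers fi fk fr fik fir fkr a b gr na nb s' t' v v' δ F')
    (hs : gi * gr + s = fir) (ht : gk * gr + t = fkr) (hu : gi * gk + u + u' + ε = fik)
    (hs' : a * gr + s' = fir) (ht' : b * gr + t' = fkr) (hv : a * b + v + v' + δ = fik)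
    (hi : t' < s' → na = a + 1 → v = b ∨ (v' = 0 ∧ δ = 0))
    (hk : s' < t' → nb = b + 1 → v' = a ∨ (v = 0 ∧ δ = 0))
    (ha : a = gi ∨ (a = gi + 1 ∧ s = gr))
    (hb : b = gk ∨ (b = gk + 1 ∧ t = gr) ∨
      (a = gi + 1 ∧ s = gr ∧ t = 0 ∧ gk = b + 1 ∧ fik < a * gk)) : F ≤ F' := by
  have hgr := h.gr_pos
  rcases ha with rfl | ⟨rfl, hsr⟩
  · obtain rfl : s' = s := by omega
    rcases hb with rfl | ⟨rfl, htr⟩ | hb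
    · obtain rfl : t' = t := by omega
      rcases Nat.le_total t' s' with hts | hts
      · exact h.facets_le_of_eq h' hu hv hi hts
      · refine h.symm.facets_le_of_eq h'.symm ?_ ?_ hk hts
        · rw [mul_comm]; omega
        · rw [mul_comm]; omega
    · have e1 : (gk + 1) * gr = gk * gr + gr := by ring
      obtain rfl : t' = 0 := by omega
      refine h.symm.facets_le_of_succ_left h'.symm htr ?_ hi
      rw [mul_comm]; omega
    · omega
  · have e0 : (gi + 1) * gr = gi * gr + gr := by ring
    obtain rfl : s' = 0 := by omega
    rcases hb with rfl | ⟨rfl, htr⟩ | ⟨-, -, rfl, rfl, hlt⟩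
    · obtain rfl : t' = t := by omega
      exact h.facets_le_of_succ_left h' hsr hv hk
    · refine h.F_le_mul.trans ?_
      have h1 := h.u_eq
      have h2 : ni * nk ≤ (gi + 1) * (gk + 1) :=
        Nat.mul_le_mul (by have := h.ni_eq; omega) (by have := h.nk_eq; omega)
      have h3 : fik = (gi + 1) * (gk + 1) := by omega
      rw [h3, h'.F_eq]
      omega
    · have e1 : (b + 1) * gr = b * gr + gr := by ring
      have e2 : (gi + 1) * (b + 1) = (gi + 1) * b + gi + 1 := by ring
      obtain rfl : t' = gr := by omega
      have h1 : nb = b + 1 := by have := h'.nk_eq; have := h.gk_le; omega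
      have h2 : v = 0 ∧ δ = 0 := by
        rcases hk hgr h1 with h2 | h2
        · omega
        · exact h2
      obtain ⟨rfl, rfl⟩ := h2
      refine h.F_le_mul.trans ?_
      rw [h'.F_eq, ← hv]
      apply le_of_eq
      ring

end FacetNumbers

/-- If `f_{kr} = g x + t` with `t ≤ x`, then the numbers `⌈f_{kr}/x - 1⌉` and `f_{kr}/x` are near
`g`. -/
theorem ceil_div_sub_one {f g x t : ℕ} (hx : 0 < x) (hf : g * x + t = f) (ht : t ≤ x) :
    ⌈(f : ℚ) / x - 1⌉₊ ≤ g ∧ f / x ≤ ⌈(f : ℚ) / x - 1⌉₊ + 1 ∧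
      (¬ x ∣ f → f / x ≤ ⌈(f : ℚ) / x - 1⌉₊) := by
  have hx' : (0 : ℚ) < x := by exact_mod_cast hx
  have h0 : ((f / x : ℕ) : ℚ) ≤ (f : ℚ) / x := Nat.cast_div_le
  have h1 := Nat.le_ceil ((f : ℚ) / x - 1)
  refine ⟨Nat.ceil_le.2 ?_, ?_, fun hdvd => ?_⟩
  · rw [sub_le_iff_le_add, div_le_iff₀ hx']
    have : f ≤ (g + 1) * x := by rw [add_mul, one_mul]; omega
    exact_mod_cast this
  · have : ((f / x : ℕ) : ℚ) ≤ ((⌈(f : ℚ) / x - 1⌉₊ + 1 : ℕ) : ℚ) := by push_cast; linarith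
    exact_mod_cast this
  · have h2 : ((f / x : ℕ) : ℚ) < (f : ℚ) / x := by
      rw [lt_div_iff₀ hx']
      have : f / x * x < f :=
        lt_of_le_of_ne (Nat.div_mul_le_self f x) fun h => hdvd ⟨f / x, by rw [mul_comm, h]⟩
      exact_mod_cast this
    have : ((f / x : ℕ) : ℚ) < ((⌈(f : ℚ) / x - 1⌉₊ + 1 : ℕ) : ℚ) := by push_cast; linarith
    have : f / x < ⌈(f : ℚ) / x - 1⌉₊ + 1 := by exact_mod_cast this
    omega

theorem div_eq_of_mul_add {f g x t : ℕ} (hx : 0 < x) (hf : g * x + t = f) (ht : t ≤ x) :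
    (f / x = g ∧ t < x ∧ (x ∣ f → t = 0)) ∨ (f / x = g + 1 ∧ t = x ∧ x ∣ f) := by
  subst hf
  rcases ht.lt_or_eq with h | rfl
  · left
    refine ⟨?_, h, fun hd => ?_⟩
    · rw [mul_comm, Nat.mul_add_div hx, Nat.div_eq_of_lt h, add_zero]
    · exact Nat.eq_zero_of_dvd_of_lt ((Nat.dvd_add_right (Dvd.intro_left _ rfl)).1 hd) h
  · right
    have : g * t + t = t * (g + 1) := by ring
    rw [this]
    exact ⟨Nat.mul_div_cancel_left _ hx, rfl, Dvd.intro _ rfl⟩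

/-- How the prescribed constants differ from those of a complex that uses all edges of the colors
`ir` and `kr` and has the same number `x` of vertices of color `r`. -/
theorem prescribed_cases {i k r : Fin 3} (hik : i ≠ k) (hir : i ≠ r) (hkr : k ≠ r)
    {x gi gk s t : ℕ} (hx : 0 < x) (hgi : 0 < gi) (hgk : 0 < gk)
    (hs : gi * x + s = Δ.flag {i, r}) (ht : gk * x + t = Δ.flag {k, r})
    (hsx : s ≤ x) (htx : t ≤ x) (hgik : gi * gk ≤ Δ.flag {i, k})
    (hle : Δ.flag {i, r} ≤ Δ.flag {k, r}) :
    ∃ a b, (Δ.prescribed i k r x).g i = a ∧ (Δ.prescribed i k r x).g k = b ∧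
      (Δ.prescribed i k r x).g r = x ∧
      (Δ.prescribed i k r x).p = (if Δ.flag {k, r} - b * x ≤ Δ.flag {i, r} - a * x then i else k) ∧
      (Δ.prescribed i k r x).q = (if Δ.flag {k, r} - b * x ≤ Δ.flag {i, r} - a * x then k else i) ∧
      0 < a ∧ 0 < b ∧ a * b ≤ Δ.flag {i, k} ∧ (a = gi ∨ (a = gi + 1 ∧ s = x)) ∧
      (b = gk ∨ (b = gk + 1 ∧ t = x) ∨
        (a = gi + 1 ∧ s = x ∧ t = 0 ∧ gk = b + 1 ∧ Δ.flag {i, k} < a * gk)) := by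
  obtain ⟨c1, c2, c3⟩ := ceil_div_sub_one hx ht htx
  simp only [ColoredComplex.prescribed, if_true, hir, hkr, hik.symm, if_false]
  generalize Δ.flag {i, r} = fir at *
  generalize Δ.flag {k, r} = fkr at *
  generalize Δ.flag {i, k} = fik at *
  generalize ⌈(fkr : ℚ) / x - 1⌉₊ = C at *
  obtain ⟨a, ha⟩ : ∃ a, a = if ¬ x ∣ fir then fir / x else if fik < fir / x * C then fir / x - 1
    else fir / x := ⟨_, rfl⟩
  rw [← ha]
  obtain ⟨b, hb⟩ : ∃ b, b = if ¬ x ∣ fkr then fkr / x else if fik < fkr / x * a then fkr / x - 1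
    else fkr / x := ⟨_, rfl⟩
  rw [← hb]
  have h1 : a = gi ∨ (a = gi + 1 ∧ s = x ∧ a * C ≤ fik) := by
    rcases div_eq_of_mul_add hx hs hsx with ⟨e1, e2, e3⟩ | ⟨e1, e2, e3⟩
    · rw [e1] at ha
      have : gi * C ≤ gi * gk := Nat.mul_le_mul_left _ c1
      rw [if_neg (show ¬ fik < gi * C by omega)] at ha
      left; rw [ha]; split_ifs <;> rfl
    · rw [e1, if_neg (not_not.2 e3)] at ha
      split_ifs at ha with h
      · left; omega
      · right; rw [ha]; exact ⟨rfl, e2, by omega⟩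
  have hmul : ∀ b', b' ≤ gk → b' ≤ C → a * b' ≤ fik := by
    intro b' hb1 hb2
    rcases h1 with h1 | ⟨-, -, h1⟩
    · rw [h1]; exact (Nat.mul_le_mul_left _ hb1).trans hgik
    · exact (Nat.mul_le_mul_left _ hb2).trans h1
  refine ⟨a, b, rfl, rfl, trivial, rfl, rfl, by omega, ?_⟩
  have h2 : (0 < b ∧ a * b ≤ fik) ∧ (b = gk ∨ (b = gk + 1 ∧ t = x) ∨
      (a = gi + 1 ∧ s = x ∧ t = 0 ∧ gk = b + 1 ∧ fik < a * gk)) := by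
    rcases div_eq_of_mul_add hx ht htx with ⟨e1, e2, e3⟩ | ⟨e1, e2, e3⟩
    · rw [e1] at hb c2 c3
      by_cases h3 : x ∣ fkr
      · rw [if_neg (not_not.2 h3)] at hb
        split_ifs at hb with h4
        · have h5 : a = gi + 1 ∧ s = x := by
            rcases h1 with h1 | ⟨h1, h1', -⟩
            · rw [h1, mul_comm] at h4; omega
            · exact ⟨h1, h1'⟩
          -- Here `f_{ir} = (g_i + 1) x ≥ 2 x`, so that `g_k = f_{kr} / x` is at least `2`.
          have h6 : 2 ≤ gk := by
            have h7 : 2 * x ≤ (gi + 1) * x := Nat.mul_le_mul_right _ (by omega)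
            rw [add_mul gi, one_mul] at h7
            have h8 : t = 0 := e3 h3
            have h9 : 2 * x ≤ gk * x := by omega
            exact Nat.le_of_mul_le_mul_right h9 hx
          exact ⟨⟨by omega, hmul _ (by omega) (by omega)⟩, Or.inr (Or.inr ⟨h5.1, h5.2,
            e3 h3, by omega, by rwa [mul_comm]⟩)⟩
        · subst hb
          exact ⟨⟨hgk, by rw [mul_comm]; omega⟩, Or.inl rfl⟩
      · rw [if_pos h3] at hb
        subst hb
        exact ⟨⟨hgk, hmul _ le_rfl (c3 h3)⟩, Or.inl rfl⟩
    · rw [e1, if_neg (not_not.2 e3)] at hb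
      split_ifs at hb with h4
      · have : b = gk := by omega
        exact ⟨⟨by omega, hmul _ (by omega) (by omega)⟩, Or.inl this⟩
      · subst hb
        exact ⟨⟨Nat.succ_pos _, by rw [mul_comm]; omega⟩, Or.inr (Or.inl ⟨rfl, e2⟩)⟩
  exact ⟨h2.1.1, h2.1.2, h1.imp id (fun h => ⟨h.1, h.2.1⟩), h2.2⟩

set_option maxHeartbeats 1600000 in
/-- The complex with the prescribed constants uses all edges and has as many facets as possible,
among the complexes with the same third color `r` and the same number of vertices of this color that
use all edges. -/
theorem prescribed_spec (hA : Γ ∈ Δ.classA) {i k r : Fin 3} (hik : i ≠ k)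
    (hir : i ≠ r) (hkr : k ≠ r) (hr : Γ.r = r)
    (hfull : ∀ a b, a ≠ b → (Γ.complex Δ).flag {a, b} = Δ.flag {a, b})
    (hle : Δ.flag {i, r} ≤ Δ.flag {k, r}) :
    Δ.prescribed i k r (Γ.g r) ∈ Δ.classA ∧
      (∀ a b, a ≠ b → ((Δ.prescribed i k r (Γ.g r)).complex Δ).flag {a, b} = Δ.flag {a, b}) ∧
      (Γ.complex Δ).facets ≤ ((Δ.prescribed i k r (Γ.g r)).complex Δ).facets := by
  obtain ⟨hpr, hqr⟩ := ne_r hA.1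
  rw [hr] at hpr hqr
  obtain ⟨s, t, u, u', ε, hs, ht, data, h⟩ := exists_facetNumbers hA hik hir hkr hpr hqr
  have hu := data.flag_eq
  rw [hfull _ _ hik] at hu
  rw [hfull _ _ hir] at hs
  rw [hfull _ _ hkr] at ht
  obtain ⟨a, b, ga, gb, gr, hp, hq, ha, hb, hab, ha', hb'⟩ := prescribed_cases hik hir hkr h.gr_pos
    h.gi_pos h.gk_pos hs.symm ht.symm h.symm.t_le h.t_le h.gik_le hle
  have hgr := h.gr_pos
  have hnk := h.nk_eq
  have hni := h.ni_eq
  have hsi := h.s_eq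
  have htk := h.t_eq
  have hgi' := h.gi_le
  have hgk' := h.gk_le
  have hgir := h.gir_le
  have hgkr := h.gkr_le
  have hue := h.u_eq
  rw [← hu] at hue
  generalize hT : Δ.prescribed i k r (Γ.g r) = T at *
  have hafi : a ≤ Δ.flag {i} := by
    rcases ha' with rfl | ⟨rfl, hs'⟩
    · exact hgi'
    · rcases h.ni_cases with ⟨h1, -⟩ | ⟨h1, h2⟩
      · have := (h.left_eq_zero h1).1
        omega
      · exact h2
  have hbfk : b ≤ Δ.flag {k} := by
    rcases hb' with rfl | ⟨rfl, hs'⟩ | ⟨-, -, -, h1, -⟩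
    · exact hgk'
    · rcases h.nk_cases with ⟨h1, -⟩ | ⟨h1, h2⟩
      · have := (h.right_eq_zero h1).1
        omega
      · exact h2
    · omega
  have har : a * Γ.g r ≤ Δ.flag {i, r} := by
    rcases ha' with rfl | ⟨rfl, hs'⟩
    · exact hgir
    · rw [add_mul, one_mul]; omega
  have hbr : b * Γ.g r ≤ Δ.flag {k, r} := by
    rcases hb' with rfl | ⟨rfl, hs'⟩ | ⟨-, -, -, h1, -⟩
    · exact hgkr
    · rw [add_mul, one_mul]; omega
    · exact (Nat.mul_le_mul_right _ (by omega)).trans hgkr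
  have hpqT : (T.p = i ∧ T.q = k) ∨ (T.p = k ∧ T.q = i) := by
    rw [hp, hq]; split_ifs
    · exact Or.inl ⟨rfl, rfl⟩
    · exact Or.inr ⟨rfl, rfl⟩
  have hcol : ∀ c, c = i ∨ c = k ∨ c = r := by
    clear * - hik hir hkr
    revert i k r; decide
  have hTA : T ∈ Δ.classA := by
    refine mem_classA_iff.2 ⟨?_, fun c => ?_, fun c => ?_, ?_⟩
    · rcases hpqT with ⟨h1, h2⟩ | ⟨h1, h2⟩ <;> rw [h1, h2]
      exacts [hik, hik.symm]
    · rcases hcol c with rfl | rfl | rfl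
      · rwa [ga]
      · rwa [gb]
      · rwa [gr]
    · rcases hcol c with rfl | rfl | rfl
      · rwa [ga]
      · rwa [gb]
      · rw [gr]; exact h.gr_le
    · refine forall_pair (fun i j h => by rwa [mul_comm, Finset.pair_comm]) hik hir hkr ?_ ?_ ?_
      · rwa [ga, gb]
      · rwa [ga, gr]
      · rwa [gb, gr]
  have hTpr : T.p ≠ r := by
    rcases hpqT with ⟨h1, h2⟩ | ⟨h1, h2⟩ <;> rw [h1]
    exacts [hir, hkr]
  have hTqr : T.q ≠ r := by
    rcases hpqT with ⟨h1, h2⟩ | ⟨h1, h2⟩ <;> rw [h2]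
    exacts [hkr, hir]
  obtain ⟨s', t', v, v', δ, hs', ht', data', h'⟩ := exists_facetNumbers hTA hik hir hkr hTpr hTqr
  have hv := data'.flag_eq
  have hna := h'.ni_eq
  have hnb := h'.nk_eq
  have hsa := h'.s_eq
  have htb := h'.t_eq
  have hva := h'.u_eq
  rw [ga, gr] at hs' hsa
  rw [gb, gr] at ht' htb
  rw [ga, gb] at hv hva
  rw [ga] at hna
  rw [gb] at hnb
  have Fir : (T.complex Δ).flag {i, r} = Δ.flag {i, r} := by
    have : Δ.flag {i, r} ≤ T.numVert Δ i * Γ.g r := by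
      rcases ha' with h1 | ⟨h1, h2⟩
      · rw [hna, h1, ← hni]; omega
      · have h3 : a * Γ.g r ≤ T.numVert Δ i * Γ.g r := Nat.mul_le_mul_right _ (by omega)
        rw [h1, add_mul, one_mul] at h3
        omega
    omega
  have Fkr : (T.complex Δ).flag {k, r} = Δ.flag {k, r} := by
    have : Δ.flag {k, r} ≤ T.numVert Δ k * Γ.g r := by
      rcases hb' with h1 | ⟨h1, h2⟩ | ⟨-, -, h0, h1, -⟩
      · rw [hnb, h1, ← hnk]; omega
      · have h3 : b * Γ.g r ≤ T.numVert Δ k * Γ.g r := Nat.mul_le_mul_right _ (by omega)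
        rw [h1, add_mul, one_mul] at h3
        omega
      · have h3 : T.numVert Δ k = Γ.g k := by omega
        rw [h3]; omega
    omega
  have Fik : (T.complex Δ).flag {i, k} = Δ.flag {i, k} := by
    have : Δ.flag {i, k} ≤ T.numVert Δ i * T.numVert Δ k := by
      have h1 : Γ.numVert Δ i ≤ T.numVert Δ i := by
        rcases ha' with h1 | ⟨h1, h2⟩ <;> omega
      rcases hb' with h2 | ⟨h2, -⟩ | ⟨-, -, -, h2, h3⟩
      · have : Γ.numVert Δ i * Γ.numVert Δ k ≤ T.numVert Δ i * T.numVert Δ k :=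
          Nat.mul_le_mul h1 (by omega)
        omega
      · have : Γ.numVert Δ i * Γ.numVert Δ k ≤ T.numVert Δ i * T.numVert Δ k :=
          Nat.mul_le_mul h1 (by omega)
        omega
      · have : a * Γ.g k ≤ T.numVert Δ i * T.numVert Δ k :=
          Nat.mul_le_mul (by omega) (by omega)
        omega
    omega
  refine ⟨hTA, forall_pair (fun i j h => by rwa [Finset.pair_comm]) hik hir hkr Fik Fir Fkr, ?_⟩
  have dl := data'.of_p_eq_left
  have dr := data'.of_p_eq_right
  rw [ga, gb] at dl dr
  rw [ga, gb, gr] at h'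
  refine h.facets_le h' hs.symm ht.symm hu.symm (by omega) (by omega) (by omega)
    (fun h1 h2 => dl ?_ h2) (fun h1 h2 => dr ?_ h2) ha' hb'
  · rw [hp, if_pos (by omega)]
  · rw [hp, if_neg (by omega)]

end Params

/-! ### Real estimates for the bound `v` -/

section Estimates

/-- The difference of two values of the bound `v`, as a function of the number of vertices. -/
theorem bound_sub_bound {a b c β x y : ℝ} (hx : 0 < x) (hy : 0 < y) :
    (β * c + (a - β * x) * (b - β * c / x)) - (β * c + (a - β * y) * (b - β * c / y)) =
      β * (y - x) * (b * x * y - a * c) / (x * y) := by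
  field_simp
  ring

theorem bound_eq {a b c β x z s t : ℝ} (hx : 0 < x) (ha : a = β * x + s) (hc : c = z * x + t) :
    β * c + (a - β * x) * (b - β * c / x) =
      β * z * x + β * t + s * (b - β * z) - β * s * t / x := by
  subst ha hc
  field_simp
  ring

/-- Below the maximum of `v`, a value `x` whose bound exceeds what is attained at `x₀` within an
error of `β x₀` is at a distance of less than `√(a c) / b` from `x₀`. -/
theorem sq_lt_of_below {a b c β x x₀ : ℝ} (hb : 0 < b) (hβ : 0 < β) (hx : 0 < x) (hxx : x < x₀)
    (h₀ : b * x₀ ^ 2 ≤ a * c) (h : β * (x₀ - x) * (a * c - b * x * x₀) / (x * x₀) < β * x₀) :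
    (b * (x₀ - x)) ^ 2 < a * c := by
  have hx₀ : 0 < x₀ := hx.trans hxx
  rw [div_lt_iff₀ (by positivity)] at h
  have h1 : (x₀ - x) * (a * c - b * x * x₀) < x₀ * (x * x₀) := by
    have : β * ((x₀ - x) * (a * c - b * x * x₀)) < β * (x₀ * (x * x₀)) := by linarith
    exact lt_of_mul_lt_mul_left this hβ.le
  have h2 : (x₀ - x) * (b * x₀ * (x₀ - x)) ≤ (x₀ - x) * (a * c - b * x * x₀) := by
    refine mul_le_mul_of_nonneg_left ?_ (by linarith)
    nlinarith
  have h3 : b * (x₀ - x) ^ 2 < x₀ * x := by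
    have : x₀ * (b * (x₀ - x) ^ 2) < x₀ * (x₀ * x) := by nlinarith
    exact lt_of_mul_lt_mul_left this hx₀.le
  have h4 : x₀ * x < x₀ * x₀ := mul_lt_mul_of_pos_left hxx hx₀
  calc (b * (x₀ - x)) ^ 2 = b * (b * (x₀ - x) ^ 2) := by ring
    _ < b * (x₀ * x₀) := mul_lt_mul_of_pos_left (h3.trans h4) hb
    _ = b * x₀ ^ 2 := by ring
    _ ≤ a * c := h₀

/-- The maximum of `v` is attained at a point `w` between `a / (β + 1)` and `a / β`. -/
theorem exists_max_point {a b c β : ℝ} (ha : 0 < a) (hb : 0 < b) (hc : 0 < c) (hβ : 0 < β)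
    (h1 : β ^ 2 * c ≤ a * b) (h2 : a * b < (β + 1) ^ 2 * c) :
    ∃ w, 0 < w ∧ b * w ^ 2 = a * c ∧ β * w ≤ a ∧ a ≤ (β + 1) * w := by
  have hw : b * √(a * c / b) ^ 2 = a * c := by
    rw [Real.sq_sqrt (by positivity)]
    field_simp
  refine ⟨√(a * c / b), by positivity, hw, ?_, ?_⟩
  · refine le_of_sq_le_sq ?_ ha.le
    refine le_of_mul_le_mul_left ?_ hb
    calc b * (β * √(a * c / b)) ^ 2 = β ^ 2 * (b * √(a * c / b) ^ 2) := by ring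
      _ = a * (β ^ 2 * c) := by rw [hw]; ring
      _ ≤ a * (a * b) := mul_le_mul_of_nonneg_left h1 ha.le
      _ = b * a ^ 2 := by ring
  · refine le_of_sq_le_sq ?_ (by positivity)
    refine le_of_mul_le_mul_left ?_ hb
    calc b * a ^ 2 = a * (a * b) := by ring
      _ ≤ a * ((β + 1) ^ 2 * c) := mul_le_mul_of_nonneg_left h2.le ha.le
      _ = (β + 1) ^ 2 * (b * √(a * c / b) ^ 2) := by rw [hw]; ring
      _ = b * ((β + 1) * √(a * c / b)) ^ 2 := by ring

/-- Above the maximum of `v`, a value `x` whose bound exceeds what is attained at `x₀` within an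
error of `β s (1 - t / x₀)` is at a distance of less than `√2 √(a c) / b` from `x₀`. -/
theorem sq_lt_of_above {a b c β x x₀ s t w : ℝ} (hb : 0 < b) (hβ : 1 ≤ β) (hx₀ : 0 < x₀)
    (hxx : x₀ < x) (h₀ : a * c ≤ b * x₀ ^ 2) (ha : a = β * x₀ + s) (hs : 0 ≤ s) (ht : 0 ≤ t)
    (hw : 0 < w) (hbw : b * w ^ 2 = a * c) (haw : a ≤ (β + 1) * w) (hxa : β * x ≤ a)
    (h : β * (x - x₀) * (b * x₀ * x - a * c) / (x₀ * x) < β * s * (1 - t / x₀)) :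
    (b * (x - x₀)) ^ 2 < 2 * (a * c) := by
  have hx : 0 < x := hx₀.trans hxx
  have hβ0 : 0 < β := by linarith
  have hwx : w ≤ x₀ := by
    refine le_of_sq_le_sq ?_ hx₀.le
    refine le_of_mul_le_mul_left ?_ hb
    rw [hbw]; exact h₀
  have h' : β * (x - x₀) * (b * x₀ * x - a * c) / (x₀ * x) < β * s := by
    refine h.trans_le ?_
    refine mul_le_of_le_one_right (by positivity) ?_
    have : 0 ≤ t / x₀ := by positivity
    linarith
  rw [div_lt_iff₀ (by positivity)] at h'
  have h1 : (x - x₀) * (b * x₀ * x - a * c) < s * (x₀ * x) := by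
    have : β * ((x - x₀) * (b * x₀ * x - a * c)) < β * (s * (x₀ * x)) := by linarith
    exact lt_of_mul_lt_mul_left this hβ0.le
  have h2 : (x - x₀) * (b * x₀ * (x - x₀)) ≤ (x - x₀) * (b * x₀ * x - a * c) := by
    refine mul_le_mul_of_nonneg_left ?_ (by linarith)
    nlinarith
  have h3 : b * (x - x₀) ^ 2 < s * x := by
    have : x₀ * (b * (x - x₀) ^ 2) < x₀ * (s * x) := by nlinarith
    exact lt_of_mul_lt_mul_left this hx₀.le
  have h4 : s ≤ w := by nlinarith
  have h5 : x ≤ 2 * w := by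
    have : β * x ≤ β * (2 * w) := by nlinarith
    exact le_of_mul_le_mul_left this hβ0
  have h6 : s * x ≤ w * (2 * w) := mul_le_mul h4 h5 hx.le hw.le
  calc (b * (x - x₀)) ^ 2 = b * (b * (x - x₀) ^ 2) := by ring
    _ < b * (w * (2 * w)) := mul_lt_mul_of_pos_left (h3.trans_le h6) hb
    _ = 2 * (b * w ^ 2) := by ring
    _ = 2 * (a * c) := by rw [hbw]

/-- The same estimate when both extra vertices are joined to each other and to all vertices of the
color of the other one, so that `b = (β + 1) (z + 1)`.  The error may be larger, but then
`b x₀ ^ 2` exceeds `a c` by an amount that makes up for it. -/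
theorem sq_lt_of_above_of_full {a b c β x x₀ z s t w : ℝ} (hb : 0 < b) (hβ : 1 ≤ β) (hx₀ : 0 < x₀)
    (hxx : x₀ < x) (h₀ : a * c ≤ b * x₀ ^ 2) (ha : a = β * x₀ + s) (hc : c = z * x₀ + t)
    (hbz : b = (β + 1) * (z + 1)) (hz : 0 ≤ z) (hs : 0 ≤ s) (hsx : s ≤ x₀) (ht : 0 ≤ t)
    (htx : t ≤ x₀)
    (hw : 0 < w) (hbw : b * w ^ 2 = a * c) (haw : a ≤ (β + 1) * w)
    (h : β * (x - x₀) * (b * x₀ * x - a * c) / (x₀ * x) < β * s * (1 - t / x₀) + (s - t)) :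
    (b * (x - x₀)) ^ 2 < 2 * (a * c) := by
  have hx : 0 < x := hx₀.trans hxx
  have hβ0 : 0 < β := by linarith
  have hwx : w ≤ x₀ := by
    refine le_of_sq_le_sq ?_ hx₀.le
    refine le_of_mul_le_mul_left ?_ hb
    rw [hbw]; exact h₀
  have hτ : t / x₀ * x₀ = t := by field_simp
  have hτ0 : 0 ≤ t / x₀ := by positivity
  have hτ1 : t / x₀ ≤ 1 := (div_le_one hx₀).2 htx
  generalize t / x₀ = τ at *
  have ha0 : 0 ≤ a := by rw [ha]; positivity
  have h1 : s - t ≤ s * (1 - τ) := by nlinarith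
  have h2 : β * (x - x₀) * (b * x₀ * x - a * c) / (x₀ * x) < (β + 1) * s * (1 - τ) := by linarith
  rw [div_lt_iff₀ (by positivity)] at h2
  have h3 : a * (x₀ * (1 - τ)) ≤ b * x₀ ^ 2 - a * c := by
    have e1 : a ≤ (β + 1) * x₀ := by rw [ha]; linarith
    have e2 : a * ((z + 1) * x₀) ≤ (β + 1) * x₀ * ((z + 1) * x₀) :=
      mul_le_mul_of_nonneg_right e1 (by positivity)
    rw [hbz, hc, ← hτ]
    nlinarith
  have h4 : β * (x - x₀) * (b * x₀ * (x - x₀) + a * (x₀ * (1 - τ))) ≤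
      β * (x - x₀) * (b * x₀ * x - a * c) := by
    refine mul_le_mul_of_nonneg_left ?_ (mul_nonneg hβ0.le (by linarith))
    nlinarith
  have h5 : β * (x - x₀) * (b * (x - x₀) + a * (1 - τ)) < (β + 1) * s * (1 - τ) * x := by
    have : x₀ * (β * (x - x₀) * (b * (x - x₀) + a * (1 - τ))) <
        x₀ * ((β + 1) * s * (1 - τ) * x) := by linarith
    exact lt_of_mul_lt_mul_left this hx₀.le
  have h6 : (x - x₀) * ((β + 1) * s - β * a) ≤ 0 := by
    refine mul_nonpos_of_nonneg_of_nonpos (by linarith) ?_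
    rw [ha]
    nlinarith
  have h7 : s * x₀ ≤ w ^ 2 := by
    have e1 : s * x₀ ≤ (a - β * w) * w := by
      have : 0 ≤ (x₀ - w) * (β * (x₀ + w) - a) := by
        refine mul_nonneg (by linarith) ?_
        nlinarith
      rw [show s = a - β * x₀ by linarith]
      linarith
    have e2 : (a - β * w) * w ≤ w * w := mul_le_mul_of_nonneg_right (by linarith) hw.le
    rw [sq]
    exact e1.trans e2
  have h8 : β * (b * (x - x₀) ^ 2) < β * (2 * w ^ 2) := by
    have e1 : β * (b * (x - x₀) ^ 2) < (1 - τ) * ((β + 1) * s * x₀ +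
        (x - x₀) * ((β + 1) * s - β * a)) := by linarith
    have e2 : (1 - τ) * ((β + 1) * s * x₀ + (x - x₀) * ((β + 1) * s - β * a)) ≤
        (1 - τ) * ((β + 1) * s * x₀) :=
      mul_le_mul_of_nonneg_left (by linarith) (by linarith)
    have e3 : (1 - τ) * ((β + 1) * s * x₀) ≤ (β + 1) * s * x₀ :=
      mul_le_of_le_one_left (by positivity) (by linarith)
    have e4 : (β + 1) * (s * x₀) ≤ (β + 1) * w ^ 2 := mul_le_mul_of_nonneg_left h7 (by linarith)
    have e5 : (β + 1) * w ^ 2 ≤ β * (2 * w ^ 2) := by nlinarith [sq_nonneg w]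
    linarith
  have h9 := lt_of_mul_lt_mul_left h8 hβ0.le
  calc (b * (x - x₀)) ^ 2 = b * (b * (x - x₀) ^ 2) := by ring
    _ < b * (2 * w ^ 2) := mul_lt_mul_of_pos_left h9 hb
    _ = 2 * (b * w ^ 2) := by ring
    _ = 2 * (a * c) := by rw [hbw]

/-- Above the maximum of `v`, if few edges of color `13` remain for the extra vertices, then the
remaining values `x ≤ a / β` are all within a distance of less than `4` from `x₀`. -/
theorem sub_lt_four_of_above {a b c β x x₀ z s t w : ℝ} (hab : a ≤ b) (hc0 : 0 < c)
    (hβ : 1 ≤ β) (hx₀ : 0 < x₀) (hb : 0 < b)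
    (h₀ : a * c ≤ b * x₀ ^ 2) (ha : a = β * x₀ + s) (hc : c = z * x₀ + t)
    (he : b < β * z + β) (hs : 0 ≤ s) (ht : 0 ≤ t)
    (hw : 0 < w) (hbw : b * w ^ 2 = a * c) (haw : a ≤ (β + 1) * w) (hxa : β * x ≤ a) :
    x - x₀ < 4 := by
  have hβ0 : 0 < β := by linarith
  have h1 : β * (x - x₀) ≤ s := by nlinarith
  have h2 : s * c < β * x₀ ^ 2 := by
    have e1 : b * x₀ ^ 2 < (β * z + β) * x₀ ^ 2 := mul_lt_mul_of_pos_right he (by positivity)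
    have e2 : 0 ≤ β * x₀ * t := by positivity
    have e3 : a * c = β * z * x₀ ^ 2 + β * x₀ * t + s * c := by rw [ha, hc]; ring
    nlinarith
  have h3 : (x - x₀) * c < x₀ ^ 2 := by
    have : β * ((x - x₀) * c) < β * x₀ ^ 2 := by nlinarith
    exact lt_of_mul_lt_mul_left this hβ0.le
  have h4 : x₀ ≤ 2 * w := by
    have : β * x₀ ≤ β * (2 * w) := by nlinarith
    exact le_of_mul_le_mul_left this hβ0
  have h5 : x₀ ^ 2 ≤ (2 * w) ^ 2 := by gcongr
  have h6 : b * ((x - x₀) * c) < b * (2 * w) ^ 2 := mul_lt_mul_of_pos_left (h3.trans_le h5) hb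
  have h7 : c * (b * (x - x₀)) < c * (4 * b) := by nlinarith
  have h8 := lt_of_mul_lt_mul_left h7 hc0.le
  nlinarith

end Estimates

/-! ### Potential values of `g₂` -/

namespace Params

variable {V : Type*} {Γ : Params} {Δ : ColoredComplex V}

/-- The order in which the two extra vertices are added does not affect the numbers of edges. -/
theorem exists_reordered (hA : Γ ∈ Δ.classA) {i k r : Fin 3} (hik : i ≠ k)
    (hir : i ≠ r) (hkr : k ≠ r) (hr : Γ.r = r) :
    ∃ Γ' ∈ Δ.classA, Γ'.g = Γ.g ∧ Γ'.p = i ∧ Γ'.r = r ∧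
      ∀ a b, a ≠ b → (Γ'.complex Δ).flag {a, b} = (Γ.complex Δ).flag {a, b} := by
  obtain ⟨hpr, hqr⟩ := ne_r hA.1
  rw [hr] at hpr hqr
  obtain ⟨hpq, hpos, h1, h2⟩ := mem_classA_iff.1 hA
  have hA' : (⟨Γ.g, i, k⟩ : Params) ∈ Δ.classA := mem_classA_iff.2 ⟨hik, hpos, h1, h2⟩
  have hrr : (⟨Γ.g, i, k⟩ : Params).r = r := by
    show -(i + k) = r
    clear * - hik hir hkr
    revert i k r; decide
  refine ⟨⟨Γ.g, i, k⟩, hA', rfl, rfl, hrr, fun a b hab => ?_⟩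
  have hnum : ∀ c, (⟨Γ.g, i, k⟩ : Params).numVert Δ c = Γ.numVert Δ c := by
    intro c
    have : (c = i ∨ c = k) ↔ (c = Γ.p ∨ c = Γ.q) := by
      generalize Γ.p = p at *
      generalize Γ.q = q at *
      clear * - hik hir hkr hpq hpr hqr
      revert i k r p q c; decide
    simp only [numVert, this]
    rfl
  rw [flag_complex_pair hA' hab, flag_complex_pair hA hab, hnum, hnum]

end Params

namespace ColoredComplex

open Params

variable {V : Type*} {Δ : ColoredComplex V}

/-- What is known of a potential value `x`: here `z` is the number of vertices of color `3` of a
complex with `g₁ = b₁`, the extra vertices are joined to `s` and `t` vertices of color `2`, and the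
two lower bounds for the facets come from the two orders of the extra vertices.  The second
alternative of `of_ge` is that of two extra vertices joined to each other, which have only `min s t`
common neighbors. -/
structure PotentialNumbers (b₁ a b c x z s t F : ℕ) : Prop where
  x_pos : 0 < x
  a_eq : a = b₁ * x + s
  c_eq : c = z * x + t
  s_le : s ≤ x
  t_le : t ≤ x
  le_b : b₁ * z ≤ b
  of_le : b - b₁ * z ≤ z → b₁ * z * x + s * (b - b₁ * z) ≤ F
  of_ge : b₁ ≤ b - b₁ * z → b₁ * z * x + t * b₁ + s * (b - b₁ * z - b₁) ≤ F ∨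
    (b = (b₁ + 1) * (z + 1) ∧
      b₁ * z * x + t * b₁ + s * (b - b₁ * z - b₁) + min s t ≤ F + s)

theorem flag_two_one : Δ.flag {2, 1} = Δ.flag {1, 2} := by rw [Finset.pair_comm]

/-- The case of `prescribed_spec` that concerns the search. -/
theorem trial_spec (hle : Δ.flag {0, 1} ≤ Δ.flag {1, 2}) {Γ : Params} (hA : Γ ∈ Δ.classA)
    (hfull : ∀ a b, a ≠ b → (Γ.complex Δ).flag {a, b} = Δ.flag {a, b}) (hr : Γ.r = 1) :
    Δ.trial (Γ.g 1) ∈ Δ.classA ∧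
      (∀ a b, a ≠ b → ((Δ.trial (Γ.g 1)).complex Δ).flag {a, b} = Δ.flag {a, b}) ∧
      (Γ.complex Δ).facets ≤ Δ.trialFacets (Γ.g 1) :=
  prescribed_spec hA (by decide) (by decide) (by decide) hr hfull (by rwa [flag_two_one])

theorem exists_potentialNumbers (hle : Δ.flag {0, 1} ≤ Δ.flag {1, 2}) {Γ : Params}
    (hA : Γ ∈ Δ.classA) (hfull : ∀ a b, a ≠ b → (Γ.complex Δ).flag {a, b} = Δ.flag {a, b})
    (hg : Γ.g 0 = Δ.b1) (hr : Γ.r = 1) :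
    ∃ z s t, PotentialNumbers Δ.b1 (Δ.flag {0, 1}) (Δ.flag {0, 2}) (Δ.flag {1, 2}) (Γ.g 1) z s t
      (Δ.trialFacets (Γ.g 1)) := by
  have h02 : (0 : Fin 3) ≠ 2 := by decide
  have h01 : (0 : Fin 3) ≠ 1 := by decide
  have h21 : (2 : Fin 3) ≠ 1 := by decide
  obtain ⟨Γ₁, hA₁, hg₁, hp₁, hr₁, hf₁⟩ := exists_reordered hA h02 h01 h21 hr
  obtain ⟨Γ₂, hA₂, hg₂, hp₂, hr₂, hf₂⟩ := exists_reordered hA h02.symm h21 h01 hr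
  have hf₁' : ∀ a b, a ≠ b → (Γ₁.complex Δ).flag {a, b} = Δ.flag {a, b} :=
    fun a b hab => (hf₁ a b hab).trans (hfull a b hab)
  have hf₂' : ∀ a b, a ≠ b → (Γ₂.complex Δ).flag {a, b} = Δ.flag {a, b} :=
    fun a b hab => (hf₂ a b hab).trans (hfull a b hab)
  have F₁ := (trial_spec hle hA₁ hf₁' hr₁).2.2
  have F₂ := (trial_spec hle hA₂ hf₂' hr₂).2.2
  obtain ⟨hpr₁, hqr₁⟩ := ne_r hA₁.1
  rw [hr₁] at hpr₁ hqr₁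
  obtain ⟨hpr₂, hqr₂⟩ := ne_r hA₂.1
  rw [hr₂] at hpr₂ hqr₂
  obtain ⟨s, t, u₁, w₁, ε₁, hs, ht, data₁, h₁⟩ := exists_facetNumbers hA₁ h02 h01 h21 hpr₁ hqr₁
  obtain ⟨s₂, t₂, u₂, w₂, ε₂, hs₂, ht₂, data₂, h₂⟩ := exists_facetNumbers hA₂ h02 h01 h21 hpr₂ hqr₂
  have p₁ := data₁.of_p_eq_left hp₁
  have p₂ := data₂.of_p_eq_right hp₂
  have q₁ := data₁.flag_eq
  have q₂ := data₂.flag_eq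
  have n₁ := h₁.ni_cases
  have n₂ := h₂.nk_cases
  rw [hf₁' _ _ h01, hg₁, hg] at hs
  rw [hf₁' _ _ h21, hg₁, flag_two_one] at ht
  rw [hf₂' _ _ h01, hg₂, hg] at hs₂
  rw [hf₂' _ _ h21, hg₂, flag_two_one] at ht₂
  rw [hf₁' _ _ h02] at q₁
  rw [hf₂' _ _ h02] at q₂
  obtain rfl : s₂ = s := by omega
  obtain rfl : t₂ = t := by omega
  rw [hg₁, hg, flag_two_one] at h₁
  rw [hg₂, hg, flag_two_one] at h₂
  rw [hg₁, hg] at p₁ q₁ n₁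
  rw [hg₂, hg] at p₂ q₂
  rw [hg₂] at n₂
  rw [hg₁, h₁.F_eq] at F₁
  rw [hg₂, h₂.F_eq] at F₂
  clear data₁ data₂
  refine ⟨Γ.g 2, s₂, t₂, h₁.gr_pos, hs, ht, h₁.symm.t_le, h₁.t_le, h₁.gik_le, fun he => ?_,
    fun he => ?_⟩
  · refine le_trans ?_ F₁
    rcases n₁ with ⟨h, -⟩ | ⟨h, -⟩
    · rw [(h₁.left_eq_zero h).1]; omega
    · have : Δ.flag {0, 2} - Δ.b1 * Γ.g 2 ≤ u₁ := by
        rcases p₁ h with h' | h' <;> omega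
      have := Nat.mul_le_mul_left s₂ this
      omega
  · have h3 : w₂ = Δ.b1 ∨ t₂ = 0 ∧ w₂ = 0 ∧ ε₂ = 0 := by
      rcases n₂ with ⟨h, -⟩ | ⟨h, -⟩
      · exact Or.inr (h₂.right_eq_zero h)
      · left
        have := h₂.u'_le
        rcases p₂ h with h' | h' <;> omega
    rcases h3 with h3 | ⟨h3, h4, h5⟩
    · have h6 : Δ.flag {0, 2} - Δ.b1 * Γ.g 2 - Δ.b1 = u₂ + ε₂ := by omega
      rw [h6]
      rw [h3] at F₂
      have h7 := h₂.ε_le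
      interval_cases ε₂
      · left
        simpa [add_right_comm] using F₂
      · right
        have h8 := (h₂.full_of_pos one_pos).1
        refine ⟨by rw [q₂, h3, h8]; ring, ?_⟩
        rw [mul_add]; omega
    · left
      subst h3 h4 h5
      have : Δ.flag {0, 2} - Δ.b1 * Γ.g 2 - Δ.b1 ≤ u₂ := by omega
      have := Nat.mul_le_mul_left s₂ this
      omega

/-- The number `v(Δ, x)` bounds the facets of the complexes with `g₁ = b₁`, third color `2` and
`g₂ = x` that use all edges. -/
theorem facets_le_v {Γ : Params}
    (hA : Γ ∈ Δ.classA) (hfull : ∀ a b, a ≠ b → (Γ.complex Δ).flag {a, b} = Δ.flag {a, b})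
    (hg : Γ.g 0 = Δ.b1) (hr : Γ.r = 1) : ((Γ.complex Δ).facets : ℝ) ≤ Δ.v (Γ.g 1) := by
  have h02 : (0 : Fin 3) ≠ 2 := by decide
  have h01 : (0 : Fin 3) ≠ 1 := by decide
  have h21 : (2 : Fin 3) ≠ 1 := by decide
  obtain ⟨hpr, hqr⟩ := ne_r hA.1
  rw [hr] at hpr hqr
  obtain ⟨s, t, u, u', ε, hs, ht, data, h⟩ := exists_facetNumbers hA h02 h01 h21 hpr hqr
  have hu := data.flag_eq
  rw [hfull _ _ h01, hg] at hs
  rw [hfull _ _ h21, flag_two_one] at ht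
  rw [hfull _ _ h02, hg] at hu
  have hx : (0 : ℝ) < Γ.g 1 := by exact_mod_cast h.gr_pos
  have hF := h.F_eq
  have hsx : (s : ℝ) ≤ Γ.g 1 := by exact_mod_cast h.symm.t_le
  have htx : (t : ℝ) ≤ Γ.g 1 := by exact_mod_cast h.t_le
  have hu' : (u' : ℝ) ≤ Δ.b1 := by rw [← hg]; exact_mod_cast h.u'_le
  have hmin : ((min s t : ℕ) : ℝ) ≤ s := by exact_mod_cast min_le_left s t
  have hs' : (Δ.flag {0, 1} : ℝ) = Δ.b1 * Γ.g 1 + s := by exact_mod_cast hs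
  have ht' : (Δ.flag {1, 2} : ℝ) = Γ.g 2 * Γ.g 1 + t := by exact_mod_cast ht
  have hb' : (Δ.flag {0, 2} : ℝ) = Δ.b1 * Γ.g 2 + u + u' + ε := by exact_mod_cast hu
  have hF' : ((Γ.complex Δ).facets : ℝ) =
      Δ.b1 * Γ.g 2 * Γ.g 1 + s * u + t * u' + ε * (min s t : ℕ) := by
    rw [hF, hg]; push_cast; ring
  unfold v
  rw [bound_eq hx hs' ht', hF', hb']
  have hmin' : (ε : ℝ) * (min s t : ℕ) ≤ ε * s := mul_le_mul_of_nonneg_left hmin (by positivity)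
  have hτ : (t : ℝ) / Γ.g 1 * Γ.g 1 = t := by field_simp
  have hτ0 : 0 ≤ (t : ℝ) / Γ.g 1 := by positivity
  have hτ1 : (t : ℝ) / Γ.g 1 ≤ 1 := (div_le_one hx).2 htx
  rw [mul_div_assoc]
  generalize (t : ℝ) / Γ.g 1 = τ at *
  have hs0 : (0 : ℝ) ≤ s := by positivity
  have hb0 : (0 : ℝ) ≤ Δ.b1 := by positivity
  have hu0 : (0 : ℝ) ≤ u' := by positivity
  have key : (t - s) * u' ≤ Δ.b1 * t - Δ.b1 * s * τ := by
    rcases le_total (t : ℝ) s with hts | hts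
    · have e1 : ((t : ℝ) - s) * u' ≤ 0 := mul_nonpos_of_nonpos_of_nonneg (by linarith) hu0
      have e2 : (Δ.b1 : ℝ) * (s * τ) ≤ Δ.b1 * t := by
        refine mul_le_mul_of_nonneg_left ?_ hb0
        rw [← hτ, mul_comm τ]
        exact mul_le_mul_of_nonneg_right hsx hτ0
      linarith
    · have e1 : ((t : ℝ) - s) * u' ≤ (t - s) * Δ.b1 :=
        mul_le_mul_of_nonneg_left hu' (by linarith)
      have e2 : (Δ.b1 : ℝ) * (s * τ) ≤ Δ.b1 * s :=
        mul_le_mul_of_nonneg_left (mul_le_of_le_one_right hs0 hτ1) hb0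
      linarith
  linarith

theorem exists_of_mem_potential {x : ℕ} (hx : x ∈ Δ.potential) :
    ∃ Γ ∈ Δ.classA, (∀ a b, a ≠ b → (Γ.complex Δ).flag {a, b} = Δ.flag {a, b}) ∧
      Γ.g 0 = Δ.b1 ∧ Γ.r = 1 ∧ Γ.g 1 = x := by
  obtain ⟨Γ, hA, hfull, h⟩ := hx
  exact ⟨Γ, hA, fun a b hab => hfull _ (by revert a b; decide), h⟩

end ColoredComplex

/-! ### The search -/

namespace ColoredComplex

open Params

variable {V : Type*} {Δ : ColoredComplex V}

theorem scan_subset (Δ : ColoredComplex V) (l : List ℕ) : ∀ m, Δ.scan m l ⊆ l := by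
  induction l with
  | nil => intro m; simp [scan]
  | cons x l ih =>
    intro m
    rw [scan]
    split_ifs
    · exact List.cons_subset_cons x (ih _)
    · exact List.nil_subset _

theorem scan_sublist (Δ : ColoredComplex V) (l : List ℕ) : ∀ m, (Δ.scan m l).Sublist l := by
  induction l with
  | nil => intro m; simp [scan]
  | cons x l ih =>
    intro m
    rw [scan]
    split_ifs
    · exact (ih _).cons_cons x
    · exact List.nil_sublist _

/-- All values checked have a bound that exceeds the number found at the beginning. -/
theorem lt_v_of_mem_scan (Δ : ColoredComplex V) (l : List ℕ) :
    ∀ m, ∀ x ∈ Δ.scan m l, (m : ℝ) < Δ.v x := by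
  induction l with
  | nil => intro m x hx; simp [scan] at hx
  | cons y l ih =>
    intro m x hx
    rw [scan] at hx
    split_ifs at hx with h
    · rcases List.mem_cons.1 hx with rfl | hx
      · exact h
      · refine lt_of_le_of_lt ?_ (ih _ x hx)
        exact_mod_cast le_max_left _ _
    · simp at hx

/-- If the bound `v` decreases along the list, then a value that is not checked cannot improve on
the best value found. -/
theorem mem_scan_or (Δ : ColoredComplex V) (l : List ℕ)
    (hl : l.Pairwise fun x y : ℕ => Δ.v y ≤ Δ.v x) :
    ∀ m, ∀ x ∈ l, x ∈ Δ.scan m l ∨ Δ.v x ≤ m ∨ ∃ y ∈ Δ.scan m l, Δ.v x ≤ Δ.trialFacets y := by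
  induction l with
  | nil => intro m x hx; simp at hx
  | cons y l ih =>
    intro m x hx
    rw [List.pairwise_cons] at hl
    rw [scan]
    split_ifs with h
    · rcases List.mem_cons.1 hx with rfl | hx
      · exact Or.inl (List.mem_cons_self ..)
      · rcases ih hl.2 (max m (Δ.trialFacets y)) x hx with h1 | h1 | ⟨w, hw, h1⟩
        · exact Or.inl (List.mem_cons_of_mem _ h1)
        · push_cast at h1
          rcases le_max_iff.1 h1 with h2 | h2
          · exact Or.inr (Or.inl h2)
          · exact Or.inr (Or.inr ⟨y, List.mem_cons_self .., h2⟩)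
        · exact Or.inr (Or.inr ⟨w, List.mem_cons_of_mem _ hw, h1⟩)
    · refine Or.inr (Or.inl ?_)
      rcases List.mem_cons.1 hx with rfl | hx
      · exact not_lt.1 h
      · exact (hl.1 x hx).trans (not_lt.1 h)

/-- After the first value, only values with a bound exceeding the number found with the first value
are checked. -/
theorem scan_eq_nil_or (Δ : ColoredComplex V) (m : ℕ) (l : List ℕ) :
    Δ.scan m l = [] ∨ ∃ x₀ l', l = x₀ :: l' ∧ ∀ x ∈ Δ.scan m l, x = x₀ ∨
      (x ∈ l' ∧ (Δ.trialFacets x₀ : ℝ) < Δ.v x) := by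
  cases l with
  | nil => left; simp [scan]
  | cons x₀ l' =>
    rw [scan]
    split_ifs with h
    · refine Or.inr ⟨x₀, l', rfl, fun x hx => ?_⟩
      rcases List.mem_cons.1 hx with rfl | hx
      · exact Or.inl rfl
      · refine Or.inr ⟨Δ.scan_subset _ _ hx, lt_of_le_of_lt ?_ (Δ.lt_v_of_mem_scan _ _ x hx)⟩
        exact_mod_cast le_max_right _ _
    · exact Or.inl rfl

theorem mem_downList {x : ℕ} : x ∈ Δ.downList ↔ x ∈ Δ.potential ∧ x ≤ Δ.b2 := by
  simp [downList, and_comm]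

theorem mem_upList {x : ℕ} :
    x ∈ Δ.upList ↔ x ≤ Δ.flag {1} ∧ Δ.b2 < x ∧ x ∈ Δ.potential := by
  simp [upList]

theorem downList_pairwise (Δ : ColoredComplex V) : Δ.downList.Pairwise fun x y => y < x := by
  unfold downList
  rw [List.pairwise_reverse]
  exact List.Pairwise.filter _ List.pairwise_lt_range

theorem upList_pairwise (Δ : ColoredComplex V) : Δ.upList.Pairwise fun x y => x < y :=
  List.Pairwise.filter _ List.pairwise_lt_range

/-- What the definition of `b₁` says if `b₁ ≥ 1`. -/
theorem b1_spec (hb : 1 ≤ Δ.b1) :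
    (0 : ℝ) < Δ.flag {0, 1} ∧ (0 : ℝ) < Δ.flag {0, 2} ∧ (0 : ℝ) < Δ.flag {1, 2} ∧
    (Δ.b1 : ℝ) ^ 2 * Δ.flag {1, 2} ≤ Δ.flag {0, 1} * Δ.flag {0, 2} ∧
    (Δ.flag {0, 1} : ℝ) * Δ.flag {0, 2} < ((Δ.b1 : ℝ) + 1) ^ 2 * Δ.flag {1, 2} := by
  have h1 : (Δ.b1 : ℝ) ≤ √((Δ.flag {0, 1} : ℝ) * Δ.flag {0, 2} / Δ.flag {1, 2}) :=
    Nat.floor_le (Real.sqrt_nonneg _)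
  have h2 : √((Δ.flag {0, 1} : ℝ) * Δ.flag {0, 2} / Δ.flag {1, 2}) < Δ.b1 + 1 :=
    Nat.lt_floor_add_one _
  have hb' : (0 : ℝ) < Δ.b1 := by exact_mod_cast hb
  have h3 := Real.sqrt_pos.1 (hb'.trans_le h1)
  have hc : (0 : ℝ) < Δ.flag {1, 2} := by
    refine lt_of_le_of_ne (Nat.cast_nonneg _) fun h => ?_
    rw [← h] at h3
    simp at h3
  have ha : (0 : ℝ) < Δ.flag {0, 1} := by
    refine lt_of_le_of_ne (Nat.cast_nonneg _) fun h => ?_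
    rw [← h] at h3
    simp at h3
  have hb0 : (0 : ℝ) < Δ.flag {0, 2} := by
    refine lt_of_le_of_ne (Nat.cast_nonneg _) fun h => ?_
    rw [← h] at h3
    simp at h3
  rw [Real.le_sqrt' hb', le_div_iff₀ hc] at h1
  rw [Real.sqrt_lt' (by positivity), div_lt_iff₀ hc] at h2
  exact ⟨ha, hb0, hc, h1, h2⟩

theorem le_b2_iff (hb : (0 : ℝ) < Δ.flag {0, 2}) {x : ℕ} (hx : 0 < x) :
    x ≤ Δ.b2 ↔ (Δ.flag {0, 2} : ℝ) * x ^ 2 ≤ Δ.flag {0, 1} * Δ.flag {1, 2} := by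
  rw [b2, Nat.le_floor_iff (Real.sqrt_nonneg _), Real.le_sqrt' (by exact_mod_cast hx),
    le_div_iff₀ hb, mul_comm]

theorem v_sub_v {x y : ℕ} (hx : 0 < x) (hy : 0 < y) : Δ.v x - Δ.v y =
    Δ.b1 * ((y : ℝ) - x) * (Δ.flag {0, 2} * x * y - Δ.flag {0, 1} * Δ.flag {1, 2}) / (x * y) :=
  bound_sub_bound (by exact_mod_cast hx) (by exact_mod_cast hy)

theorem potential_pos {x : ℕ} (hx : x ∈ Δ.potential) : 0 < x := by
  obtain ⟨Γ, hA, -, -, -, rfl⟩ := exists_of_mem_potential hx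
  exact hA.2.1 1

theorem v_le_v_of_le_b2 (hb : (0 : ℝ) < Δ.flag {0, 2}) {x y : ℕ} (hx : 0 < x) (hxy : x < y)
    (hy : y ≤ Δ.b2) : Δ.v x ≤ Δ.v y := by
  have h1 := (le_b2_iff hb (hx.trans hxy)).1 hy
  have hx' : (0 : ℝ) < x := by exact_mod_cast hx
  have hxy' : (x : ℝ) < y := by exact_mod_cast hxy
  rw [← sub_nonpos, v_sub_v hx (hx.trans hxy)]
  refine div_nonpos_of_nonpos_of_nonneg ?_ (by positivity)
  refine mul_nonpos_of_nonneg_of_nonpos (mul_nonneg (by positivity) (by linarith)) ?_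
  have h2 : (Δ.flag {0, 2} : ℝ) * x * y ≤ Δ.flag {0, 2} * y * y := by gcongr
  nlinarith

theorem v_le_v_of_b2_lt (hb : (0 : ℝ) < Δ.flag {0, 2}) {x y : ℕ} (hx : 0 < x) (hxy : x < y)
    (h : Δ.b2 < x) : Δ.v y ≤ Δ.v x := by
  have h1 := lt_of_not_ge (mt (le_b2_iff hb hx).2 (not_le.2 h))
  have hx' : (0 : ℝ) < x := by exact_mod_cast hx
  have hxy' : (x : ℝ) < y := by exact_mod_cast hxy
  rw [← sub_nonneg, v_sub_v hx (hx.trans hxy)]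
  refine div_nonneg ?_ (by positivity)
  refine mul_nonneg (mul_nonneg (by positivity) (by linarith)) ?_
  have h2 : (Δ.flag {0, 2} : ℝ) * x * x ≤ Δ.flag {0, 2} * x * y := by gcongr
  nlinarith

theorem potentialNumbers_of_mem (hle : Δ.flag {0, 1} ≤ Δ.flag {1, 2}) {x : ℕ}
    (hx : x ∈ Δ.potential) : ∃ z s t, PotentialNumbers Δ.b1 (Δ.flag {0, 1}) (Δ.flag {0, 2})
      (Δ.flag {1, 2}) x z s t (Δ.trialFacets x) := by
  obtain ⟨Γ, hA, hfull, hg, hr, rfl⟩ := exists_of_mem_potential hx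
  exact exists_potentialNumbers hle hA hfull hg hr

/-- The error of the bound `v` if at least `b₁` edges of color `13` remain for the extra vertices.
The second alternative has both extra vertices joined to each other. -/
theorem v_sub_le_of_ge {x z s t : ℕ}
    (h : PotentialNumbers Δ.b1 (Δ.flag {0, 1}) (Δ.flag {0, 2}) (Δ.flag {1, 2}) x z s t
      (Δ.trialFacets x)) (he : Δ.b1 ≤ Δ.flag {0, 2} - Δ.b1 * z) :
    Δ.v x - Δ.trialFacets x ≤ Δ.b1 * s * (1 - t / x) ∨
      (Δ.flag {0, 2} = (Δ.b1 + 1) * (z + 1) ∧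
        Δ.v x - Δ.trialFacets x ≤ Δ.b1 * s * (1 - t / x) + (s - t)) := by
  have hx : (0 : ℝ) < x := by exact_mod_cast h.x_pos
  have ha : (Δ.flag {0, 1} : ℝ) = Δ.b1 * x + s := by exact_mod_cast h.a_eq
  have hc : (Δ.flag {1, 2} : ℝ) = z * x + t := by exact_mod_cast h.c_eq
  have hv : Δ.v x = _ := bound_eq (b := (Δ.flag {0, 2} : ℝ)) hx ha hc
  obtain ⟨e, hbe⟩ := Nat.exists_eq_add_of_le h.le_b
  have hF := h.of_ge he
  rw [show Δ.flag {0, 2} - Δ.b1 * z = e by omega] at he hF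
  obtain ⟨d, rfl⟩ := Nat.exists_eq_add_of_le he
  rw [Nat.add_sub_cancel_left] at hF
  have hb' : (Δ.flag {0, 2} : ℝ) = Δ.b1 * z + (Δ.b1 + d) := by exact_mod_cast hbe
  have hdiv : (Δ.b1 : ℝ) * s * t / x = Δ.b1 * s * (t / x) := by rw [mul_div_assoc]
  have key : Δ.v x = Δ.b1 * z * x + t * Δ.b1 + s * d + Δ.b1 * s * (1 - t / x) := by
    rw [hv, hb', hdiv]; ring
  have first : Δ.b1 * z * x + t * Δ.b1 + s * d ≤ Δ.trialFacets x →
      Δ.v x - Δ.trialFacets x ≤ Δ.b1 * s * (1 - t / x) := by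
    intro hF
    have : (Δ.b1 : ℝ) * z * x + t * Δ.b1 + s * d ≤ Δ.trialFacets x := by exact_mod_cast hF
    linarith
  rcases hF with hF | ⟨hfull, hF⟩
  · exact Or.inl (first hF)
  · rcases le_total s t with hst | hst
    · left
      rw [min_eq_left hst] at hF
      exact first (by omega)
    · right
      rw [min_eq_right hst] at hF
      have : (Δ.b1 : ℝ) * z * x + t * Δ.b1 + s * d + t ≤ Δ.trialFacets x + s := by
        exact_mod_cast hF
      exact ⟨hfull, by linarith⟩

/-- The values checked on the way down are at a distance of less than `√(f₁₂ f₂₃) / f₁₃` from the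
first one. -/
theorem sq_lt_of_mem_downList (h₁ : Δ.flag {0, 1} ≤ Δ.flag {1, 2}) (hb : 1 ≤ Δ.b1) {x x₀ : ℕ}
    (hx : x ∈ Δ.downList) (hx₀ : x₀ ∈ Δ.downList) (hxx : x < x₀)
    (h : (Δ.trialFacets x₀ : ℝ) < Δ.v x) :
    (Δ.flag {0, 2} * ((x₀ : ℝ) - x)) ^ 2 < Δ.flag {0, 1} * Δ.flag {1, 2} := by
  rw [mem_downList] at hx hx₀
  obtain ⟨ha0, hb0, hc0, hβ1, hβ2⟩ := b1_spec hb
  have hx0 := potential_pos hx.1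
  have hx0' : (0 : ℝ) < x := by exact_mod_cast hx0
  obtain ⟨z, s, t, num⟩ := potentialNumbers_of_mem h₁ hx₀.1
  have hx₀0 : (0 : ℝ) < x₀ := by exact_mod_cast num.x_pos
  have hβ : (0 : ℝ) < Δ.b1 := by exact_mod_cast hb
  have hxx' : (x : ℝ) < x₀ := by exact_mod_cast hxx
  have hle := (le_b2_iff hb0 num.x_pos).1 hx₀.2
  refine sq_lt_of_below hb0 hβ hx0' hxx' hle ?_
  have hsx : (s : ℝ) ≤ x₀ := by exact_mod_cast num.s_le
  have htx : (t : ℝ) ≤ x₀ := by exact_mod_cast num.t_le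
  have ha : (Δ.flag {0, 1} : ℝ) = Δ.b1 * x₀ + s := by exact_mod_cast num.a_eq
  have hc : (Δ.flag {1, 2} : ℝ) = z * x₀ + t := by exact_mod_cast num.c_eq
  have hdiff := v_sub_v (Δ := Δ) hx0 num.x_pos
  have hτ0 : (0 : ℝ) ≤ t / x₀ := by positivity
  have hs0 : (0 : ℝ) ≤ s := by positivity
  have hL : Δ.v x₀ - Δ.trialFacets x₀ ≤ Δ.b1 * x₀ := by
    have hst : (Δ.b1 : ℝ) * s * (1 - t / x₀) ≤ Δ.b1 * x₀ := by
      calc (Δ.b1 : ℝ) * s * (1 - t / x₀) ≤ Δ.b1 * s :=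
            mul_le_of_le_one_right (by positivity) (by linarith)
        _ ≤ Δ.b1 * x₀ := mul_le_mul_of_nonneg_left hsx hβ.le
    rcases Nat.lt_or_ge (Δ.flag {0, 2} - Δ.b1 * z) Δ.b1 with he | he
    · have hz : Δ.b1 ≤ z + 1 := by
        have e1 : Δ.b1 * x₀ ≤ (z + 1) * x₀ := by
          have := num.a_eq
          have := num.c_eq
          have := num.t_le
          rw [add_mul, one_mul]
          omega
        exact Nat.le_of_mul_le_mul_right e1 num.x_pos
      have hF := num.of_le (by omega)
      have hF' : (Δ.b1 : ℝ) * z * x₀ + s * (Δ.flag {0, 2} - Δ.b1 * z) ≤ Δ.trialFacets x₀ := by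
        have e1 : ((Δ.flag {0, 2} - Δ.b1 * z : ℕ) : ℝ) = Δ.flag {0, 2} - Δ.b1 * z := by
          rw [Nat.cast_sub num.le_b]; push_cast; ring
        rw [← e1]
        exact_mod_cast hF
      have hv : Δ.v x₀ = _ := bound_eq (b := (Δ.flag {0, 2} : ℝ)) hx₀0 ha hc
      have e2 : (0 : ℝ) ≤ Δ.b1 * s * t / x₀ := by positivity
      have e3 : (Δ.b1 : ℝ) * t ≤ Δ.b1 * x₀ := mul_le_mul_of_nonneg_left htx hβ.le
      rw [hv]
      linarith
    · rcases v_sub_le_of_ge num he with h' | ⟨hfull, h'⟩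
      · exact h'.trans hst
      · -- All inequalities in `b x₀ ^ 2 ≤ a c ≤ (b₁ + 1) (z + 1) x₀ ^ 2` are equalities.
        have hfull' : (Δ.flag {0, 2} : ℝ) = (Δ.b1 + 1) * (z + 1) := by exact_mod_cast hfull
        have e1 : (Δ.b1 + 1) * x₀ * ((z + 1) * x₀) ≤ (Δ.b1 * x₀ + s) * ((z : ℝ) * x₀ + t) := by
          rw [← ha, ← hc]
          refine le_trans (le_of_eq ?_) hle
          rw [hfull']; ring
        have e2 : (Δ.b1 * x₀ + s) * ((z : ℝ) * x₀ + t) ≤ (Δ.b1 * x₀ + s) * ((z + 1) * x₀) :=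
          mul_le_mul_of_nonneg_left (by linarith) (by positivity)
        have e3 : (Δ.b1 * x₀ + s) * ((z : ℝ) * x₀ + t) ≤ (Δ.b1 + 1) * x₀ * (z * x₀ + t) :=
          mul_le_mul_of_nonneg_right (by linarith) (by positivity)
        have e5 : (z + 1) * (x₀ : ℝ) ≤ z * x₀ + t := by
          refine le_of_mul_le_mul_left (e1.trans e3) (by positivity)
        have e6 : (t : ℝ) = x₀ := by linarith
        rw [e6, div_self hx₀0.ne'] at h'
        have : (0 : ℝ) ≤ Δ.b1 * x₀ := by positivity
        linarith
  have e0 : Δ.v x₀ - Δ.v x = Δ.b1 * ((x₀ : ℝ) - x) *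
      (Δ.flag {0, 1} * Δ.flag {1, 2} - Δ.flag {0, 2} * x * x₀) / (x * x₀) := by
    rw [← neg_sub, hdiff]; ring
  rw [← e0]
  linarith

/-- The values checked on the way up are at a distance of less than `√2 √(f₁₂ f₂₃) / f₁₃`, or of
less than `4`, from the first one. -/
theorem lt_of_mem_upList (h₁ : Δ.flag {0, 1} ≤ Δ.flag {0, 2}) (h₂ : Δ.flag {0, 2} ≤ Δ.flag {1, 2})
    (hb : 1 ≤ Δ.b1) {x x₀ : ℕ} (hx : x ∈ Δ.upList) (hx₀ : x₀ ∈ Δ.upList) (hxx : x₀ < x)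
    (h : (Δ.trialFacets x₀ : ℝ) < Δ.v x) :
    (Δ.flag {0, 2} * ((x : ℝ) - x₀)) ^ 2 < 2 * (Δ.flag {0, 1} * Δ.flag {1, 2}) ∨
      (x : ℝ) - x₀ < 4 := by
  rw [mem_upList] at hx hx₀
  obtain ⟨ha0, hb0, hc0, hβ1, hβ2⟩ := b1_spec hb
  obtain ⟨zx, sx, tx, numx⟩ := potentialNumbers_of_mem (h₁.trans h₂) hx.2.2
  obtain ⟨z, s, t, num⟩ := potentialNumbers_of_mem (h₁.trans h₂) hx₀.2.2
  have hx0' : (0 : ℝ) < x := by exact_mod_cast numx.x_pos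
  have hx₀0 : (0 : ℝ) < x₀ := by exact_mod_cast num.x_pos
  have hβ : (1 : ℝ) ≤ Δ.b1 := by exact_mod_cast hb
  have hxx' : (x₀ : ℝ) < x := by exact_mod_cast hxx
  have hle := (lt_of_not_ge (mt (le_b2_iff hb0 num.x_pos).2 (not_le.2 hx₀.2.1))).le
  have hsx : (s : ℝ) ≤ x₀ := by exact_mod_cast num.s_le
  have htx : (t : ℝ) ≤ x₀ := by exact_mod_cast num.t_le
  have hs0 : (0 : ℝ) ≤ s := by positivity
  have ht0 : (0 : ℝ) ≤ t := by positivity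
  have hz0 : (0 : ℝ) ≤ z := by positivity
  have ha : (Δ.flag {0, 1} : ℝ) = Δ.b1 * x₀ + s := by exact_mod_cast num.a_eq
  have hc : (Δ.flag {1, 2} : ℝ) = z * x₀ + t := by exact_mod_cast num.c_eq
  have hxa : (Δ.b1 : ℝ) * x ≤ Δ.flag {0, 1} := by
    have := numx.a_eq
    exact_mod_cast (show Δ.b1 * x ≤ Δ.flag {0, 1} by omega)
  have hab : (Δ.flag {0, 1} : ℝ) ≤ Δ.flag {0, 2} := by exact_mod_cast h₁
  obtain ⟨w, hw, hbw, -, haw⟩ := exists_max_point ha0 hb0 hc0 (by linarith) hβ1 hβ2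
  have hdiff := v_sub_v (Δ := Δ) num.x_pos numx.x_pos
  rcases Nat.lt_or_ge (Δ.flag {0, 2} - Δ.b1 * z) Δ.b1 with he | he
  · right
    have he' : (Δ.flag {0, 2} : ℝ) < Δ.b1 * z + Δ.b1 := by
      have := num.le_b
      exact_mod_cast (show Δ.flag {0, 2} < Δ.b1 * z + Δ.b1 by omega)
    exact sub_lt_four_of_above hab hc0 hβ hx₀0 hb0 hle ha hc he' hs0 ht0 hw hbw haw hxa
  · left
    rcases v_sub_le_of_ge num he with h' | ⟨hfull, h'⟩
    · exact sq_lt_of_above hb0 hβ hx₀0 hxx' hle ha hs0 ht0 hw hbw haw hxa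
        (by rw [← hdiff]; linarith)
    · exact sq_lt_of_above_of_full hb0 hβ hx₀0 hxx' hle ha hc (by exact_mod_cast hfull) hz0 hs0 hsx
        ht0 htx hw hbw haw (by rw [← hdiff]; linarith)

/-- A list without repetitions of numbers at a distance of less than `D` from its first element,
all on the same side of it, has fewer than `D + 1` elements. -/
theorem length_lt_of_above {l : List ℕ} (hl : l.Nodup) {x₀ : ℕ} {D : ℝ} (hD : 0 < D)
    (h : ∀ x ∈ l, x₀ ≤ x ∧ (x : ℝ) - x₀ < D) : (l.length : ℝ) < D + 1 := by
  have hsub : l.toFinset ⊆ Finset.Ico x₀ (x₀ + ⌈D⌉₊) := by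
    intro x hx
    obtain ⟨h1, h2⟩ := h x (List.mem_toFinset.1 hx)
    rw [Finset.mem_Ico]
    refine ⟨h1, ?_⟩
    have h3 := Nat.le_ceil D
    have h4 : (x : ℝ) < ((x₀ + ⌈D⌉₊ : ℕ) : ℝ) := by push_cast; linarith
    exact_mod_cast h4
  have hcard := Finset.card_le_card hsub
  rw [List.toFinset_card_of_nodup hl, Nat.card_Ico, Nat.add_sub_cancel_left] at hcard
  have h5 : (l.length : ℝ) ≤ ⌈D⌉₊ := by exact_mod_cast hcard
  exact h5.trans_lt (Nat.ceil_lt_add_one hD.le)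

theorem length_lt_of_below {l : List ℕ} (hl : l.Nodup) {x₀ : ℕ} {D : ℝ} (hD : 0 < D)
    (h : ∀ x ∈ l, x ≤ x₀ ∧ (x₀ : ℝ) - x < D) : (l.length : ℝ) < D + 1 := by
  have hnd : (l.map fun x => x₀ - x).Nodup := by
    refine (List.nodup_map_iff_inj_on hl).2 fun x hx y hy hxy => ?_
    have := (h x hx).1
    have := (h y hy).1
    omega
  have := length_lt_of_above (x₀ := 0) hnd hD (fun y hy => by
    obtain ⟨x, hx, rfl⟩ := List.mem_map.1 hy
    obtain ⟨h1, h2⟩ := h x hx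
    refine ⟨Nat.zero_le _, ?_⟩
    rw [Nat.cast_sub h1]
    simpa using h2)
  simpa using this

theorem foldr_max_mem (l : List ℕ) : l.foldr max 0 = 0 ∨ l.foldr max 0 ∈ l := by
  induction l with
  | nil => left; rfl
  | cons a l ih =>
    rw [List.foldr_cons]
    rcases le_total a (l.foldr max 0) with h | h
    · rw [max_eq_right h]
      exact ih.imp id (List.mem_cons_of_mem _)
    · rw [max_eq_left h]
      exact Or.inr (List.mem_cons_self ..)

theorem length_checkedDown_lt (h₁ : Δ.flag {0, 1} ≤ Δ.flag {1, 2}) (hb : 1 ≤ Δ.b1) :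
    (Δ.checkedDown.length : ℝ) <
      √((Δ.flag {0, 1} : ℝ) * Δ.flag {1, 2}) / Δ.flag {0, 2} + 1 := by
  obtain ⟨ha0, hb0, hc0, -, -⟩ := b1_spec hb
  have hR : 0 < √((Δ.flag {0, 1} : ℝ) * Δ.flag {1, 2}) / Δ.flag {0, 2} := by positivity
  have hnd : Δ.checkedDown.Nodup :=
    ((Δ.downList_pairwise.imp fun h => h.ne').sublist (Δ.scan_sublist _ 0))
  rcases Δ.scan_eq_nil_or 0 Δ.downList with h | ⟨x₀, l', hl, h⟩
  · rw [checkedDown, h]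
    simp only [List.length_nil, Nat.cast_zero]
    linarith
  · have hpw := Δ.downList_pairwise
    have hx₀ : x₀ ∈ Δ.downList := by rw [hl]; exact List.mem_cons_self ..
    rw [hl, List.pairwise_cons] at hpw
    refine length_lt_of_below hnd hR (x₀ := x₀) fun x hx => ?_
    rcases h x hx with rfl | ⟨hx', hv⟩
    · exact ⟨le_rfl, by rwa [sub_self]⟩
    · have hlt := hpw.1 x hx'
      have hxd : x ∈ Δ.downList := by rw [hl]; exact List.mem_cons_of_mem _ hx'
      have hsq := sq_lt_of_mem_downList h₁ hb hxd hx₀ hlt hv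
      refine ⟨hlt.le, ?_⟩
      rw [lt_div_iff₀ hb0, mul_comm]
      exact Real.lt_sqrt_of_sq_lt hsq

theorem length_scan_upList_lt (h₁ : Δ.flag {0, 1} ≤ Δ.flag {0, 2})
    (h₂ : Δ.flag {0, 2} ≤ Δ.flag {1, 2}) (hb : 1 ≤ Δ.b1) (m : ℕ) :
    ((Δ.scan m Δ.upList).length : ℝ) <
      √2 * (√((Δ.flag {0, 1} : ℝ) * Δ.flag {1, 2}) / Δ.flag {0, 2}) + 4 + 1 := by
  obtain ⟨ha0, hb0, hc0, -, -⟩ := b1_spec hb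
  have hR : 0 < √2 * (√((Δ.flag {0, 1} : ℝ) * Δ.flag {1, 2}) / Δ.flag {0, 2}) := by positivity
  have hnd : (Δ.scan m Δ.upList).Nodup :=
    ((Δ.upList_pairwise.imp fun h => h.ne).sublist (Δ.scan_sublist _ m))
  rcases Δ.scan_eq_nil_or m Δ.upList with h | ⟨x₀, l', hl, h⟩
  · rw [h]
    simp only [List.length_nil, Nat.cast_zero]
    linarith
  · have hpw := Δ.upList_pairwise
    have hx₀ : x₀ ∈ Δ.upList := by rw [hl]; exact List.mem_cons_self ..
    rw [hl, List.pairwise_cons] at hpw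
    refine length_lt_of_above hnd (by linarith) (x₀ := x₀) fun x hx => ?_
    rcases h x hx with rfl | ⟨hx', hv⟩
    · refine ⟨le_rfl, ?_⟩
      rw [sub_self]
      linarith
    · have hlt := hpw.1 x hx'
      have hxd : x ∈ Δ.upList := by rw [hl]; exact List.mem_cons_of_mem _ hx'
      refine ⟨hlt.le, ?_⟩
      rcases lt_of_mem_upList h₁ h₂ hb hxd hx₀ hlt hv with hsq | h4
      · have : (x : ℝ) - x₀ < √2 * (√((Δ.flag {0, 1} : ℝ) * Δ.flag {1, 2}) / Δ.flag {0, 2}) := by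
          rw [← mul_div_assoc, lt_div_iff₀ hb0, mul_comm, ← Real.sqrt_mul (by norm_num)]
          exact Real.lt_sqrt_of_sq_lt hsq
        linarith
      · linarith

/-- The search finds a complex with at least as many facets as any complex that uses all edges and
has `g₁ = b₁` and third color `2`. -/
theorem exists_mem_checked (hle : Δ.flag {0, 1} ≤ Δ.flag {1, 2}) (hb : 1 ≤ Δ.b1) {Γ : Params}
    (hA : Γ ∈ Δ.classA) (hfull : ∀ a b, a ≠ b → (Γ.complex Δ).flag {a, b} = Δ.flag {a, b})
    (hg : Γ.g 0 = Δ.b1) (hr : Γ.r = 1) :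
    ∃ x ∈ Δ.checked, (Γ.complex Δ).facets ≤ Δ.trialFacets x := by
  obtain ⟨-, hb0, -, -, -⟩ := b1_spec hb
  have hpot : Γ.g 1 ∈ Δ.potential := by
    refine ⟨Γ, hA, fun S hS => ?_, hg, hr, rfl⟩
    obtain ⟨i, j, hij, rfl⟩ := finset_fin_three_card_two S hS
    exact hfull i j hij
  have hv := facets_le_v hA hfull hg hr
  have htrial := (trial_spec hle hA hfull hr).2.2
  have hpos : 0 < (Γ.complex Δ).facets := by
    rw [facets_complex Δ hA.1 (ne_r hA.1).1 (ne_r hA.1).2]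
    have := Nat.mul_pos (Nat.mul_pos (hA.2.1 Γ.p) (hA.2.1 Γ.q)) (hA.2.1 Γ.r)
    omega
  rcases Nat.lt_or_ge Δ.b2 (Γ.g 1) with hx | hx
  · have hmem : Γ.g 1 ∈ Δ.upList :=
      mem_upList.2 ⟨(mem_classA_iff.1 hA).2.2.1 1, hx, hpot⟩
    have hmono : Δ.upList.Pairwise fun x y : ℕ => Δ.v y ≤ Δ.v x := by
      refine Δ.upList_pairwise.imp_of_mem fun {x y} hx hy hxy => ?_
      rw [mem_upList] at hx
      exact v_le_v_of_b2_lt hb0 (potential_pos hx.2.2) hxy hx.2.1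
    rcases Δ.mem_scan_or _ hmono ((Δ.checkedDown.map Δ.trialFacets).foldr max 0) _ hmem with
      h | h | ⟨y, hy, h⟩
    · exact ⟨_, List.mem_append_right _ h, htrial⟩
    · have h' : (Γ.complex Δ).facets ≤ (Δ.checkedDown.map Δ.trialFacets).foldr max 0 := by
        exact_mod_cast hv.trans h
      rcases foldr_max_mem (Δ.checkedDown.map Δ.trialFacets) with h0 | h0
      · omega
      · obtain ⟨y, hy, hy'⟩ := List.mem_map.1 h0
        exact ⟨y, List.mem_append_left _ hy, by rwa [hy']⟩
    · exact ⟨y, List.mem_append_right _ hy, by exact_mod_cast hv.trans h⟩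
  · have hmem : Γ.g 1 ∈ Δ.downList := mem_downList.2 ⟨hpot, hx⟩
    have hmono : Δ.downList.Pairwise fun x y : ℕ => Δ.v y ≤ Δ.v x := by
      refine Δ.downList_pairwise.imp_of_mem fun {x y} hx hy hxy => ?_
      rw [mem_downList] at hx hy
      exact v_le_v_of_le_b2 hb0 (potential_pos hy.1) hxy hx.2
    rcases Δ.mem_scan_or _ hmono 0 _ hmem with h | h | ⟨y, hy, h⟩
    · exact ⟨_, List.mem_append_left _ h, htrial⟩
    · have : (Γ.complex Δ).facets ≤ 0 := by exact_mod_cast hv.trans h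
      omega
    · exact ⟨y, List.mem_append_left _ hy, by exact_mod_cast hv.trans h⟩

theorem mem_potential_of_mem_checked {x : ℕ} (hx : x ∈ Δ.checked) : x ∈ Δ.potential := by
  rcases List.mem_append.1 hx with h | h
  · exact (mem_downList.1 (Δ.scan_subset _ _ h)).1
  · exact (mem_upList.1 (Δ.scan_subset _ _ h)).2.2

end ColoredComplex

open ColoredComplex Params in
theorem mainTheorem5 {V : Type*} (Δ : ColoredComplex V)
    (h₁ : Δ.flag {0, 1} ≤ Δ.flag {0, 2}) (h₂ : Δ.flag {0, 2} ≤ Δ.flag {1, 2})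
    (hb : 1 ≤ Δ.b1)
    (hΓ : ∃ Γ₀ ∈ Δ.classD, Γ₀.g 0 = Δ.b1 ∧ Γ₀.r = 1) :
    ((Δ.checked.length : ℝ) <
      6 + 2 * √2 * (√((Δ.flag {0, 1} : ℝ) * Δ.flag {1, 2}) / Δ.flag {0, 2})) ∧
    (∃ x ∈ Δ.checked, ∀ y ∈ Δ.checked, Δ.trialFacets y ≤ Δ.trialFacets x) ∧
    (∀ x ∈ Δ.checked, (∀ y ∈ Δ.checked, Δ.trialFacets y ≤ Δ.trialFacets x) →
      Δ.trial x ∈ Δ.classD) := by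
  obtain ⟨Γ₀, hD, hg, hr⟩ := hΓ
  have hA := hD.1.1.1
  have hle := h₁.trans h₂
  have hfull := flag_eq_of_mem_classD hD (i := 0) (k := 2) (r := 1) (by decide) (by decide)
    (by decide) hr (by rwa [flag_two_one])
  obtain ⟨x₀, hx₀, hmax⟩ := exists_mem_checked hle hb hA hfull hg hr
  refine ⟨?_, ?_, fun x hx hxmax => ?_⟩
  · have hd := length_checkedDown_lt hle hb
    have hu := length_scan_upList_lt h₁ h₂ hb
      ((Δ.checkedDown.map Δ.trialFacets).foldr max 0)
    have hR : 0 ≤ √((Δ.flag {0, 1} : ℝ) * Δ.flag {1, 2}) / Δ.flag {0, 2} := by positivity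
    have h2 : (1 : ℝ) ≤ √2 := Real.one_le_sqrt.2 (by norm_num)
    rw [checked, List.length_append]
    push_cast
    nlinarith
  · obtain ⟨x, hx, h⟩ := Finset.exists_max_image Δ.checked.toFinset Δ.trialFacets
      ⟨x₀, List.mem_toFinset.2 hx₀⟩
    exact ⟨x, List.mem_toFinset.1 hx, fun y hy => h y (List.mem_toFinset.2 hy)⟩
  · obtain ⟨Γ, hΓA, hΓfull, -, hΓr, hΓx⟩ :=
      exists_of_mem_potential (mem_potential_of_mem_checked hx)
    obtain ⟨hT, hTfull, -⟩ := trial_spec hle hΓA hΓfull hΓr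
    rw [hΓx] at hT hTfull
    have hbest : (Γ₀.complex Δ).facets ≤ ((Δ.trial x).complex Δ).facets :=
      hmax.trans (hxmax x₀ hx₀)
    refine ⟨⟨⟨hT, fun Γ' hΓ' => (hD.1.1.2 Γ' hΓ').trans hbest⟩, fun Γ' hΓ' => ?_⟩,
      (hD.1.1.2 _ hT).trans_lt hD.2⟩
    have hle' : ∀ S : Finset (Fin 3), S ≠ Finset.univ → (Γ'.complex Δ).flag S ≤ Δ.flag S :=
      hΓ'.1.2.2
    unfold edges
    rw [hTfull 0 1 (by decide), hTfull 0 2 (by decide), hTfull 1 2 (by decide)]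
    exact Nat.add_le_add (Nat.add_le_add (hle' _ (by decide)) (hle' _ (by decide)))
      (hle' _ (by decide))
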